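/- For a prime $p$, equip $\mathbb{Z}_p^m$ with its normalised Haar measure, and identify polynomials over $\mathbb{Z}_p$ of degree $n$ with their coefficient vectors in $\mathbb{Z}_p^{n+1}$ (the leading coefficient vanishes only on a null set) and monic polynomials of degree $n$ with vectors in $\mathbb{Z}_p^{n}$. For integers $n,d,r\ge 0$ let $\rho(n,d;p)$, $\alpha(n,d;p)$ and $\beta(n,d;p)$ denote the expected number of $d$-element sets of $\mathbb{Q}_p$-roots of a random polynomial of degree $n$ over $\mathbb{Z}_p$, of a random monic polynomial of degree $n$ over $\mathbb{Z}_p$, and of a random monic polynomial of degree $n$ over $\mathbb{Z}_p$ conditioned to be congruent to $x^n$ modulo $p$, respectively; let $\rho^*(n,r;p)$, $\alpha^*(n,r;p)$, $\beta^*(n,r;p)$ denote the corresponding probabilities of having exactly $r$ roots in $\mathbb{Q}_p$. (The number of roots is a random variable in each case, and all these expectations exist.) Omitting $p$ from the notation, put $$\mathcal{A}_d(t)=(1-t)\sum_{n\ge 0}\alpha(n,d)t^n,\qquad \mathcal{B}_d(t)=(1-t)\sum_{n\ge 0}\beta(n,d)t^n,$$ $$\mathcal{R}_d(t)=(1-t)(1-pt)\sum_{n\ge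 0}(p^n+p^{n-1}+\cdots+1)\rho(n,d)t^n.$$ (a) For fixed $n$ and $d$ there are rational functions of one variable over $\mathbb{Q}$, without poles at primes, whose values at every prime $p$ are $\alpha(n,d;p)$, $\beta(n,d;p)$ and $\rho(n,d;p)$; as rational functions they satisfy $$\rho(n,d;p)=\rho(n,d;1/p),\qquad \alpha(n,d;p)=\beta(n,d;1/p).$$ The same holds for the probabilities: for fixed $n$ and $r$, $\alpha^*(n,r;p)$, $\beta^*(n,r;p)$ and $\rho^*(n,r;p)$ are rational functions of $p$, with $\rho^*(n,r;p)=\rho^*(n,r;1/p)$ and $\alpha^*(n,r;p)=\beta^*(n,r;1/p)$. (b) For every prime $p$ the following identities of formal power series in $t$ and $u$ hold: $$\sum_{d\ge0}\mathcal{A}_d(pt)u^d=\Bigl(\sum_{d\ge0}\mathcal{B}_d(t)u^d\Bigr)^{p},$$ $$\sum_{d\ge0}\mathcal{R}_d(t)u^d=\Bigl(\sum_{d\ge0}\mathcal{A}_d(pt)u^d\Bigr)\Bigl(\sum_{d\ge0}\mathcal{B}_d(t)u^d\Bigr)=\Bigl(\sum_{d\ge0}\mathcal{B}_d(t)u^d\Bigr)^{p+1},$$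 and, for every $d\ge 0$, $$\mathcal{B}_d(t)-t\,\mathcal{B}_d(t/p)=\Phi\bigl(\mathcal{A}_d(t)-t\,\mathcal{A}_d(pt)\bigr),$$ where $\Phi$ multiplies the coefficient of $t^n$ by $p^{-\binom n2}$. (c) For every prime $p$ and every $d\ge 0$, the power series $\mathcal{A}_d$, $\mathcal{B}_d$ and $\mathcal{R}_d$ are polynomials of degree at most $2d$. Moreover $\alpha(n,d)=\mathcal{A}_d(1)$ and $\beta(n,d)=\mathcal{B}_d(1)$ for all $n\ge 2d$, and $\rho(n,d)=\mathcal{R}_d(1)$ for all $n\ge 0$ with $n\ge 2d-1$. Thus $\alpha(n,d)$, $\beta(n,d)$ and $\rho(n,d)$ are independent of $n$ once $n$ is sufficiently large relative to $d$. -/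

import Mathlib

open MeasureTheory Polynomial

noncomputable section

namespace PadicRoots

/-- `ℤ_[p]` carries its Borel σ-algebra. -/
instance instMeasurableSpacePadicInt (p : ℕ) [Fact p.Prime] : MeasurableSpace ℤ_[p] :=
  borel ℤ_[p]

instance instBorelSpacePadicInt (p : ℕ) [Fact p.Prime] : BorelSpace ℤ_[p] := ⟨rfl⟩

/-- The Haar measure on `ℤ_[p]`, normalised to total mass `1`. -/
def haarZp (p : ℕ) [Fact p.Prime] : Measure ℤ_[p] :=
  Measure.addHaarMeasure ⊤

/-- The product measure on `ℤ_[p] ^ n`. -/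
def haarZpPow (p : ℕ) [Fact p.Prime] (n : ℕ) : Measure (Fin n → ℤ_[p]) :=
  Measure.pi fun _ => haarZp p

/-- The polynomial `a₀ + a₁ x + ⋯ + aₙ xⁿ` with coefficient vector `a ∈ ℤ_[p] ^ (n + 1)`.
(The leading coefficient vanishes only on a set of measure zero.) -/
def genPoly (p : ℕ) [Fact p.Prime] (n : ℕ) (a : Fin (n + 1) → ℤ_[p]) : ℤ_[p][X] :=
  ∑ i : Fin (n + 1), C (a i) * X ^ (i : ℕ)

/-- The monic polynomial `xⁿ + aₙ₋₁ xⁿ⁻¹ + ⋯ + a₀`. -/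
def monicPoly (p : ℕ) [Fact p.Prime] (n : ℕ) (a : Fin n → ℤ_[p]) : ℤ_[p][X] :=
  X ^ n + ∑ i : Fin n, C (a i) * X ^ (i : ℕ)

/-- The probability measure on (the coefficient vectors of) monic polynomials of degree `n`
that reduce to `xⁿ` modulo `p`: the measure on all monic polynomials, conditioned on that
subset. -/
def reducedMeasure (p : ℕ) [Fact p.Prime] (n : ℕ) : Measure (Fin n → ℤ_[p]) :=
  ProbabilityTheory.cond (haarZpPow p n)
    {a | (monicPoly p n a).map PadicInt.toZMod = X ^ n}

open Classical in
/-- The finite set of (distinct) roots of `f` in `ℚ_[p]` (empty, by convention, for `f = 0`). -/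
def rootsQp (p : ℕ) [Fact p.Prime] (f : ℤ_[p][X]) : Finset ℚ_[p] :=
  (f.aroots ℚ_[p]).toFinset

/-- The number of roots of `f` in `ℚ_[p]`. -/
def numRoots (p : ℕ) [Fact p.Prime] (f : ℤ_[p][X]) : ℕ :=
  (rootsQp p f).card

/-- The number of `d`-element sets of roots of `f` in `ℚ_[p]`. -/
def numRootSets (p : ℕ) [Fact p.Prime] (d : ℕ) (f : ℤ_[p][X]) : ℕ :=
  ((rootsQp p f).powersetCard d).card

/-- `ρ(n, d)`: the expected number of `d`-sets of roots of a polynomial of degree `n`. -/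
def rho (p : ℕ) [Fact p.Prime] (n d : ℕ) : ℝ :=
  ∫ a, (numRootSets p d (genPoly p n a) : ℝ) ∂(haarZpPow p (n + 1))

/-- `α(n, d)`: the expected number of `d`-sets of roots of a monic polynomial of degree `n`. -/
def alpha (p : ℕ) [Fact p.Prime] (n d : ℕ) : ℝ :=
  ∫ a, (numRootSets p d (monicPoly p n a) : ℝ) ∂(haarZpPow p n)

/-- `β(n, d)`: the expected number of `d`-sets of roots of a monic polynomial of degree `n`
that reduces to `xⁿ` modulo `p`. -/
def beta (p : ℕ) [Fact p.Prime] (n d : ℕ) : ℝ :=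
  ∫ a, (numRootSets p d (monicPoly p n a) : ℝ) ∂(reducedMeasure p n)

/-- `ρ*(n, r)`: the probability of having exactly `r` roots. -/
def rhoStar (p : ℕ) [Fact p.Prime] (n r : ℕ) : ℝ :=
  (haarZpPow p (n + 1)).real {a | numRoots p (genPoly p n a) = r}

/-- `α*(n, r)`: the probability of having exactly `r` roots, for monic polynomials. -/
def alphaStar (p : ℕ) [Fact p.Prime] (n r : ℕ) : ℝ :=
  (haarZpPow p n).real {a | numRoots p (monicPoly p n a) = r}

/-- `β*(n, r)`: the probability of having exactly `r` roots, for monic polynomials that reduce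
to `xⁿ` modulo `p`. -/
def betaStar (p : ℕ) [Fact p.Prime] (n r : ℕ) : ℝ :=
  (reducedMeasure p n).real {a | numRoots p (monicPoly p n a) = r}

/-- `A_d(t) = (1 - t) ∑ α(n, d) tⁿ`. -/
def serA (p : ℕ) [Fact p.Prime] (d : ℕ) : PowerSeries ℝ :=
  (1 - PowerSeries.X) * PowerSeries.mk fun n => alpha p n d

/-- `B_d(t) = (1 - t) ∑ β(n, d) tⁿ`. -/
def serB (p : ℕ) [Fact p.Prime] (d : ℕ) : PowerSeries ℝ :=
  (1 - PowerSeries.X) * PowerSeries.mk fun n => beta p n d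

/-- `R_d(t) = (1 - t) (1 - p t) ∑ (pⁿ + ⋯ + p + 1) ρ(n, d) tⁿ`. -/
def serR (p : ℕ) [Fact p.Prime] (d : ℕ) : PowerSeries ℝ :=
  (1 - PowerSeries.X) * (1 - PowerSeries.C (p : ℝ) * PowerSeries.X) *
    PowerSeries.mk fun n => (∑ i ∈ Finset.range (n + 1), (p : ℝ) ^ i) * rho p n d

/-- The operator `Φ` that multiplies the coefficient of `tⁿ` by `p ^ (-(n choose 2))`. -/
def Phi (p : ℕ) (f : PowerSeries ℝ) : PowerSeries ℝ :=
  PowerSeries.mk fun n => ((p : ℝ) ^ n.choose 2)⁻¹ * PowerSeries.coeff n f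

/-- The rational function `F` has no pole at the real number `x`, and its value there is `v`. -/
def HasValue (F : RatFunc ℚ) (x v : ℝ) : Prop :=
  F.denom.aeval x ≠ 0 ∧ F.eval (algebraMap ℚ ℝ) x = v

/-- The rational function `F(1/X)`. -/
def substInv (F : RatFunc ℚ) : RatFunc ℚ :=
  F.eval RatFunc.C (RatFunc.X)⁻¹

end PadicRoots

end

/-! The expectations for all `d` are packed into one: `E[(1 + u) ^ N] = ∑ E[N choose d] u ^ d`,
where `N` is the number of roots. For `z = 1 + u` in `[0, 1]` the variable `z ^ N` is bounded, and
an identity on this interval is an identity of polynomials in `u`.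

The engine is Hensel factorization in measure form (`measurePreserving_factorMap`). If the reduction
modulo `p` splits into coprime factors, multiplication of lifts preserves and reflects congruences
modulo every `p ^ k`, hence preserves Haar measure, so the factors of a random lift are independent
and uniform. Thus `E[z ^ N]`, given the reduction `f`, is the product over `a ∈ 𝔽_p` of the
`β`-value at the multiplicity of `a` in `f` (`integral_pow_numIntRoots`). Summing over monic `f`
gives `A(pt) = B(t) ^ p`. For arbitrary polynomials the drop in degree of the reduction acts as the
multiplicity of a root at infinity and supplies one more factor `B` (`rhoZ_eq`). The third relation
concerns `f ≡ x ^ n`: substitute `px` for `x` and divide out powers of `p` one at a time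
(`gammaZ_step`); each step either divides again or stops at a nonzero reduction of smaller degree.

Stability in `n` comes from approximating roots by residues modulo `p ^ k`. Whether `c` is close to
a root with large derivative depends only on `f(c)` and `f'(c)`, so the event for `d` residues
depends only on `f` modulo `∏ (x - c) ^ 2`, and this remainder is uniform once `n ≥ 2d`
(`alpha_eq_of_le`). The bounds for `B_d` and `R_d` follow from the relations with `A_d`, and
`R_d(1/p) = R_d(1)` yields the slightly better range for `ρ`.

For rationality and symmetry, the power relation is replaced by its logarithmic derivative, in which
the exponent `p` is an ordinary coefficient. With the third relation it is a linear system
determining the coefficients of index at least 2 recursively over any field of characteristic zero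
with an `x` that is neither zero nor a root of unity. The system is invariant under `x ↦ 1/x`
together with the exchange of the two unknown series, which gives `α(p) = β(1/p)`. -/

noncomputable section

namespace PadicRoots

open scoped ENNReal

/-! ### Haar measure on `ℤ_[p] ^ n` and congruence cylinders -/

section Cylinders

variable {p : ℕ} [Fact p.Prime]

/-- The vectors congruent to `y` modulo `p ^ k`. -/
def cyl {n : ℕ} (k : ℕ) (y : Fin n → ℤ_[p]) : Set (Fin n → ℤ_[p]) :=
  {x | ∀ i, (p : ℤ_[p]) ^ k ∣ x i - y i}

lemma norm_le_iff_pow_dvd (x : ℤ_[p]) (k : ℕ) :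
    ‖x‖ ≤ (p : ℝ) ^ (-(k : ℤ)) ↔ (p : ℤ_[p]) ^ k ∣ x := by
  rw [PadicInt.norm_le_pow_iff_mem_span_pow, Ideal.mem_span_singleton]

lemma setOf_pow_dvd_sub (k : ℕ) (y : ℤ_[p]) :
    {x : ℤ_[p] | (p : ℤ_[p]) ^ k ∣ x - y} = Metric.closedBall y ((p : ℝ) ^ (-(k : ℤ))) := by
  ext x
  rw [Set.mem_ofPred_eq, ← norm_le_iff_pow_dvd, Metric.mem_closedBall, dist_eq_norm]

lemma prime_pos_real : (0 : ℝ) < p := by exact_mod_cast (Fact.out : p.Prime).pos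

lemma isOpen_setOf_pow_dvd_sub (k : ℕ) (y : ℤ_[p]) :
    IsOpen {x : ℤ_[p] | (p : ℤ_[p]) ^ k ∣ x - y} := by
  rw [setOf_pow_dvd_sub]
  exact IsUltrametricDist.isOpen_closedBall _ (zpow_pos prime_pos_real _).ne'

lemma cyl_eq_pi {n : ℕ} (k : ℕ) (y : Fin n → ℤ_[p]) :
    cyl k y = Set.univ.pi fun i => {x : ℤ_[p] | (p : ℤ_[p]) ^ k ∣ x - y i} := by
  ext x; simp [cyl, Set.mem_pi]

lemma isOpen_cyl {n : ℕ} (k : ℕ) (y : Fin n → ℤ_[p]) : IsOpen (cyl k y) := by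
  rw [cyl_eq_pi]
  exact isOpen_set_pi Set.finite_univ fun i _ => isOpen_setOf_pow_dvd_sub _ _

lemma measurableSet_cyl {n : ℕ} (k : ℕ) (y : Fin n → ℤ_[p]) : MeasurableSet (cyl k y) :=
  (isOpen_cyl k y).measurableSet

lemma mem_cyl_self {n : ℕ} (k : ℕ) (y : Fin n → ℤ_[p]) : y ∈ cyl k y := by
  intro i; simp

lemma cyl_eq_of_mem {n k : ℕ} {x y : Fin n → ℤ_[p]} (h : x ∈ cyl k y) : cyl k y = cyl k x := by
  ext z
  refine ⟨fun hz i => ?_, fun hz i => ?_⟩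
  · have := dvd_sub (hz i) (h i); simpa using this
  · have := dvd_add (hz i) (h i); simpa using this

lemma cyl_anti {n k l : ℕ} (hkl : k ≤ l) (y : Fin n → ℤ_[p]) : cyl l y ⊆ cyl k y :=
  fun _ hx i => (pow_dvd_pow _ hkl).trans (hx i)

lemma isTopologicalBasis_cyl (p : ℕ) [Fact p.Prime] (n : ℕ) :
    TopologicalSpace.IsTopologicalBasis
      {s : Set (Fin n → ℤ_[p]) | ∃ k y, s = cyl k y} := by
  refine TopologicalSpace.isTopologicalBasis_of_isOpen_of_nhds ?_ ?_
  · rintro _ ⟨k, y, rfl⟩; exact isOpen_cyl k y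
  · intro a u ha hu
    obtain ⟨ε, hε, hεu⟩ := Metric.isOpen_iff.1 hu a ha
    obtain ⟨k, hk⟩ := PadicInt.exists_pow_neg_lt p hε
    refine ⟨cyl k a, ⟨k, a, rfl⟩, mem_cyl_self k a, fun x hx => hεu ?_⟩
    rw [Metric.mem_ball, dist_pi_lt_iff hε]
    intro i
    rw [dist_eq_norm]
    exact ((norm_le_iff_pow_dvd _ _).2 (hx i)).trans_lt hk

lemma isPiSystem_cyl (p : ℕ) [Fact p.Prime] (n : ℕ) :
    IsPiSystem {s : Set (Fin n → ℤ_[p]) | ∃ k y, s = cyl k y} := by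
  rintro _ ⟨k, y, rfl⟩ _ ⟨l, z, rfl⟩ ⟨w, hw1, hw2⟩
  rw [cyl_eq_of_mem hw1, cyl_eq_of_mem hw2]
  rcases le_total k l with h | h
  · exact ⟨l, w, Set.inter_eq_right.2 (cyl_anti h w)⟩
  · exact ⟨k, w, Set.inter_eq_left.2 (cyl_anti h w)⟩

/-- A representative in `ℤ_[p] ^ n` of a vector over `ℤ / m`. -/
def liftVec {n m : ℕ} (c : Fin n → ZMod m) : Fin n → ℤ_[p] := fun i => ((c i).val : ℤ_[p])

lemma toZModPow_eq_iff (k : ℕ) (x y : ℤ_[p]) :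
    PadicInt.toZModPow k x = PadicInt.toZModPow k y ↔ (p : ℤ_[p]) ^ k ∣ x - y := by
  rw [← sub_eq_zero, ← map_sub, ← RingHom.mem_ker, PadicInt.ker_toZModPow,
    Ideal.mem_span_singleton]

lemma pow_dvd_sub_natCast_val (k : ℕ) (x : ℤ_[p]) (c : ZMod (p ^ k)) :
    (p : ℤ_[p]) ^ k ∣ x - (c.val : ℤ_[p]) ↔ PadicInt.toZModPow k x = c := by
  rw [← toZModPow_eq_iff, map_natCast, ZMod.natCast_zmod_val]

lemma mem_cyl_liftVec {n k : ℕ} (x : Fin n → ℤ_[p]) (c : Fin n → ZMod (p ^ k)) :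
    x ∈ cyl k (liftVec c : Fin n → ℤ_[p]) ↔ (fun i => PadicInt.toZModPow k (x i)) = c := by
  simp only [cyl, liftVec, Set.mem_ofPred_eq, pow_dvd_sub_natCast_val, funext_iff]

lemma exists_cyl_eq_liftVec {n k : ℕ} (y : Fin n → ℤ_[p]) :
    ∃ c : Fin n → ZMod (p ^ k), cyl k y = cyl k (liftVec c) := by
  refine ⟨fun i => PadicInt.toZModPow k (y i), (cyl_eq_of_mem ?_).symm⟩
  rw [mem_cyl_liftVec]

lemma sum_real_cyl {n k : ℕ} (ν : Measure (Fin n → ℤ_[p])) [IsProbabilityMeasure ν] :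
    ∑ c : Fin n → ZMod (p ^ k), ν.real (cyl k (liftVec c)) = 1 := by
  rw [← measureReal_biUnion_finset]
  · have : (⋃ c ∈ (Finset.univ : Finset (Fin n → ZMod (p ^ k))),
        cyl k (liftVec c : Fin n → ℤ_[p])) = Set.univ := by
      ext x
      simp only [Set.mem_iUnion, Finset.mem_univ, Set.mem_univ, iff_true, mem_cyl_liftVec]
      exact ⟨_, trivial, rfl⟩
    rw [this, probReal_univ]
  · intro c _ d _ hcd
    refine Set.disjoint_left.2 fun x hx hx' => hcd ?_
    rw [mem_cyl_liftVec] at hx hx'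
    exact hx.symm.trans hx'
  · intro c _
    exact measurableSet_cyl _ _

lemma card_vec_zmod (n k : ℕ) :
    (Finset.univ : Finset (Fin n → ZMod (p ^ k))).card = p ^ (k * n) := by
  simp [ZMod.card, pow_mul]

/-- A probability measure giving each cylinder at most its Haar volume gives it exactly this
volume. -/
lemma real_cyl_of_le {n : ℕ} (ν : Measure (Fin n → ℤ_[p])) [IsProbabilityMeasure ν]
    (h : ∀ k y, ν.real (cyl k y) ≤ ((p : ℝ) ^ (k * n))⁻¹) (k : ℕ) (y : Fin n → ℤ_[p]) :
    ν.real (cyl k y) = ((p : ℝ) ^ (k * n))⁻¹ := by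
  obtain ⟨c, hc⟩ := exists_cyl_eq_liftVec (k := k) y
  -- The `p ^ (k n)` cylinders of level `k` partition the space, so both sums equal `1`; a termwise
  -- inequality with equal sums is a termwise equality.
  have hs : ∑ c : Fin n → ZMod (p ^ k), ν.real (cyl k (liftVec c)) =
      ∑ c : Fin n → ZMod (p ^ k), ((p : ℝ) ^ (k * n))⁻¹ := by
    rw [sum_real_cyl, Finset.sum_const, card_vec_zmod, nsmul_eq_mul]
    have := (prime_pos_real (p := p)).ne'
    push_cast
    field_simp
  rw [hc]
  exact (Finset.sum_eq_sum_iff_of_le fun c _ => h k (liftVec c)).1 hs c (Finset.mem_univ _)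

instance : IsProbabilityMeasure (haarZp p) := ⟨by
  have := Measure.addHaarMeasure_self (K₀ := (⊤ : TopologicalSpace.PositiveCompacts ℤ_[p]))
  simpa [haarZp] using this⟩

instance : (haarZp p).IsAddLeftInvariant := by unfold haarZp; infer_instance

instance (n : ℕ) : IsProbabilityMeasure (haarZpPow p n) := by unfold haarZpPow; infer_instance

instance (n : ℕ) : (haarZpPow p n).IsAddLeftInvariant := by unfold haarZpPow; infer_instance

lemma real_haarZpPow_cyl {n : ℕ} (k : ℕ) (y : Fin n → ℤ_[p]) :
    (haarZpPow p n).real (cyl k y) = ((p : ℝ) ^ (k * n))⁻¹ := by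
  have h0 : ∀ y : Fin n → ℤ_[p],
      (haarZpPow p n).real (cyl k y) = (haarZpPow p n).real (cyl k 0) := by
    intro y
    rw [measureReal_def, measureReal_def,
      ← measure_preimage_add (haarZpPow p n) y (cyl k y)]
    congr 2
    ext x
    simp [cyl]
  have h1 := sum_real_cyl (k := k) (haarZpPow p n)
  simp only [h0 (liftVec _), Finset.sum_const, card_vec_zmod, nsmul_eq_mul] at h1
  rw [h0 y]
  push_cast at h1
  exact eq_inv_of_mul_eq_one_right h1

/-- Cylinders form a π-system generating the Borel sets. Only an upper bound is required, so a map
can be shown to preserve measure without first proving it surjective. -/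
theorem eq_haarZpPow_of_cyl_le {n : ℕ} (ν : Measure (Fin n → ℤ_[p])) [IsProbabilityMeasure ν]
    (h : ∀ k y, ν.real (cyl k y) ≤ ((p : ℝ) ^ (k * n))⁻¹) : ν = haarZpPow p n := by
  refine ext_of_generate_finite _ ?_ (isPiSystem_cyl p n) ?_ (by simp)
  · rw [← (isTopologicalBasis_cyl p n).borel_eq_generateFrom]
    exact BorelSpace.measurable_eq
  · rintro _ ⟨k, y, rfl⟩
    rw [← measureReal_eq_measureReal_iff, real_cyl_of_le ν h, real_haarZpPow_cyl]

theorem measurePreserving_of_cyl_le {X : Type*} [MeasurableSpace X] (μ : Measure X)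
    [IsProbabilityMeasure μ] {n : ℕ} {T : X → Fin n → ℤ_[p]} (hT : Measurable T)
    (h : ∀ k y, μ.real (T ⁻¹' cyl k y) ≤ ((p : ℝ) ^ (k * n))⁻¹) :
    MeasurePreserving T μ (haarZpPow p n) := by
  refine ⟨hT, ?_⟩
  have := Measure.isProbabilityMeasure_map (μ := μ) hT.aemeasurable
  refine eq_haarZpPow_of_cyl_le _ fun k y => ?_
  rw [map_measureReal_apply hT (measurableSet_cyl k y)]
  exact h k y

/-- Continuity of a map into `ℤ_[p] ^ n` that respects congruences. -/
lemma continuous_of_cyl {X : Type*} [TopologicalSpace X] {n : ℕ} {T : X → Fin n → ℤ_[p]}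
    (h : ∀ k x, ∃ U, IsOpen U ∧ x ∈ U ∧ ∀ x' ∈ U, T x' ∈ cyl k (T x)) : Continuous T := by
  rw [(isTopologicalBasis_cyl p n).continuous_iff]
  rintro _ ⟨k, y, rfl⟩
  rw [isOpen_iff_forall_mem_open]
  intro x hx
  obtain ⟨U, hU, hxU, hU'⟩ := h k x
  refine ⟨U, fun x' hx' => ?_, hU, hxU⟩
  rw [Set.mem_preimage, cyl_eq_of_mem hx]
  exact hU' x' hx'

/-- A self-map of `ℤ_[p] ^ n` which preserves and reflects congruences preserves the measure. -/
theorem measurePreserving_of_congr {n : ℕ} {T : (Fin n → ℤ_[p]) → Fin n → ℤ_[p]}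
    (h : ∀ k x x', T x' ∈ cyl k (T x) ↔ x' ∈ cyl k x) :
    MeasurePreserving T (haarZpPow p n) (haarZpPow p n) := by
  refine measurePreserving_of_cyl_le _ (continuous_of_cyl fun k x =>
    ⟨cyl k x, isOpen_cyl k x, mem_cyl_self k x, fun x' => (h k x x').2⟩).measurable fun k y => ?_
  -- The preimage of a cylinder is empty or a single cylinder of the same level; in both cases the
  -- upper bound holds.
  rcases Set.eq_empty_or_nonempty (T ⁻¹' cyl k y) with he | ⟨x, hx⟩
  · rw [he, measureReal_empty]
    have := prime_pos_real (p := p)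
    positivity
  · have : T ⁻¹' cyl k y = cyl k x := by
      ext x'
      rw [Set.mem_preimage, cyl_eq_of_mem hx]
      exact h k x x'
    rw [this, real_haarZpPow_cyl]

/-- Two-factor version of the preceding criterion, in the shape needed for multiplying two
polynomials: a nonempty preimage of a cylinder is a product of cylinders of the same level. -/
theorem measurePreserving_prod_of_congr {m n : ℕ}
    {T : (Fin m → ℤ_[p]) × (Fin n → ℤ_[p]) → Fin (m + n) → ℤ_[p]}
    (h : ∀ k x x', T x' ∈ cyl k (T x) ↔ x'.1 ∈ cyl k x.1 ∧ x'.2 ∈ cyl k x.2) :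
    MeasurePreserving T ((haarZpPow p m).prod (haarZpPow p n)) (haarZpPow p (m + n)) := by
  refine measurePreserving_of_cyl_le _ (continuous_of_cyl fun k x =>
    ⟨cyl k x.1 ×ˢ cyl k x.2, (isOpen_cyl k _).prod (isOpen_cyl k _),
      ⟨mem_cyl_self k _, mem_cyl_self k _⟩,
      fun x' hx' => (h k x x').2 (Set.mem_prod.1 hx')⟩).measurable fun k y => ?_
  rcases Set.eq_empty_or_nonempty (T ⁻¹' cyl k y) with he | ⟨x, hx⟩
  · rw [he, measureReal_empty]
    have := prime_pos_real (p := p)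
    positivity
  · have : T ⁻¹' cyl k y = cyl k x.1 ×ˢ cyl k x.2 := by
      ext x'
      rw [Set.mem_preimage, cyl_eq_of_mem hx]
      exact h k x x'
    rw [this, measureReal_prod_prod, real_haarZpPow_cyl, real_haarZpPow_cyl, mul_add, pow_add,
      mul_inv]

lemma mem_cyl_append {m n k : ℕ} (x x' : (Fin m → ℤ_[p]) × (Fin n → ℤ_[p])) :
    Fin.append x'.1 x'.2 ∈ cyl k (Fin.append x.1 x.2) ↔ x'.1 ∈ cyl k x.1 ∧ x'.2 ∈ cyl k x.2 := by
  simp [cyl, Fin.forall_fin_add]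

theorem measurePreserving_append (m n : ℕ) :
    MeasurePreserving (fun x : (Fin m → ℤ_[p]) × (Fin n → ℤ_[p]) => Fin.append x.1 x.2)
      ((haarZpPow p m).prod (haarZpPow p n)) (haarZpPow p (m + n)) :=
  measurePreserving_prod_of_congr fun _ x x' => mem_cyl_append x x'

theorem integral_haarZpPow_add {m n : ℕ} {F : (Fin (m + n) → ℤ_[p]) → ℝ}
    (hF : Integrable F (haarZpPow p (m + n))) :
    ∫ x, F x ∂haarZpPow p (m + n) =
      ∫ a, ∫ b, F (Fin.append a b) ∂haarZpPow p n ∂haarZpPow p m := by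
  have hmp := measurePreserving_append (p := p) m n
  rw [← integral_prod (f := fun x : (Fin m → ℤ_[p]) × (Fin n → ℤ_[p]) => F (Fin.append x.1 x.2))
    (hmp.integrable_comp_of_integrable hF)]
  rw [← hmp.map_eq]
  refine integral_map hmp.measurable.aemeasurable ?_
  rw [hmp.map_eq]
  exact hF.aestronglyMeasurable

/-- The vectors with a given reduction modulo `p`, parametrised by `ℤ_[p] ^ n`. -/
def resMap {n : ℕ} (c : Fin n → ZMod p) (x : Fin n → ℤ_[p]) : Fin n → ℤ_[p] :=
  fun i => (c i).val + p * x i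

lemma continuous_resMap {n : ℕ} (c : Fin n → ZMod p) :
    Continuous (resMap c : (Fin n → ℤ_[p]) → Fin n → ℤ_[p]) := by
  unfold resMap; fun_prop

lemma toZMod_resMap {n : ℕ} (c : Fin n → ZMod p) (x : Fin n → ℤ_[p]) (i : Fin n) :
    PadicInt.toZMod (resMap c x i) = c i := by
  simp [resMap]

lemma resMap_mem_cyl_succ {n k : ℕ} (c : Fin n → ZMod p) (x x' : Fin n → ℤ_[p]) :
    resMap c x' ∈ cyl (k + 1) (resMap c x) ↔ x' ∈ cyl k x := by
  refine forall_congr' fun i => ?_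
  have : resMap c x' i - resMap c x i = (p : ℤ_[p]) * (x' i - x i) := by
    simp [resMap]; ring
  rw [this, pow_succ', mul_dvd_mul_iff_left PadicInt.prime_p.ne_zero]

lemma toZMod_eq_iff (x y : ℤ_[p]) :
    PadicInt.toZMod x = PadicInt.toZMod y ↔ (p : ℤ_[p]) ∣ x - y := by
  rw [← sub_eq_zero, ← map_sub, ← RingHom.mem_ker, PadicInt.ker_toZMod,
    PadicInt.maximalIdeal_eq_span_p, Ideal.mem_span_singleton]

/-- Self-similarity of Haar measure: each residue class modulo `p` is a rescaled copy of the whole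
space. This underlies every conditioning on the reduction below. -/
theorem haarZpPow_eq_sum_map_resMap (p : ℕ) [Fact p.Prime] (n : ℕ) :
    haarZpPow p n =
      ((p : ℝ≥0∞) ^ n)⁻¹ • ∑ c : Fin n → ZMod p, (haarZpPow p n).map (resMap c) := by
  have hp : (p : ℝ≥0∞) ≠ 0 := by simpa using (Fact.out : p.Prime).ne_zero
  symm
  have hprob : ∀ c : Fin n → ZMod p, IsProbabilityMeasure ((haarZpPow p n).map (resMap c)) :=
    fun c => Measure.isProbabilityMeasure_map (continuous_resMap c).measurable.aemeasurable
  have : IsProbabilityMeasure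
      (((p : ℝ≥0∞) ^ n)⁻¹ • ∑ c : Fin n → ZMod p, (haarZpPow p n).map (resMap c)) := by
    constructor
    simp only [Measure.smul_apply, Measure.finsetSum_apply, measure_univ]
    simp only [Finset.sum_const, smul_eq_mul, nsmul_eq_mul, mul_one]
    rw [Finset.card_univ, Fintype.card_fun, ZMod.card, Fintype.card_fin]
    push_cast
    exact ENNReal.inv_mul_cancel (by simp [hp]) (by simp)
  refine eq_haarZpPow_of_cyl_le _ fun k y => ?_
  have hp' := prime_pos_real (p := p)
  cases k with
  | zero => exact measureReal_le_one.trans (by simp)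
  | succ k =>
    rw [measureReal_def, Measure.smul_apply, Measure.finsetSum_apply, smul_eq_mul,
      ENNReal.toReal_mul, ENNReal.toReal_sum (fun c _ => measure_ne_top _ _)]
    -- A cylinder of level at least `1` lies in one residue class modulo `p`, that of its centre.
    rw [Finset.sum_eq_single (fun i => PadicInt.toZMod (y i))]
    · rw [← measureReal_def, map_measureReal_apply (continuous_resMap _).measurable
        (measurableSet_cyl _ _)]
      have h1 : (haarZpPow p n).real
          (resMap (fun i => PadicInt.toZMod (y i)) ⁻¹' cyl (k + 1) y) ≤
            ((p : ℝ) ^ (k * n))⁻¹ := by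
        rcases Set.eq_empty_or_nonempty
          (resMap (fun i => PadicInt.toZMod (y i)) ⁻¹' cyl (k + 1) y) with he | ⟨x, hx⟩
        · rw [he, measureReal_empty]; positivity
        · rw [cyl_eq_of_mem hx, ← real_haarZpPow_cyl k x]
          refine measureReal_mono fun x' hx' => ?_
          exact (resMap_mem_cyl_succ _ _ _).1 hx'
      calc _ ≤ (((p : ℝ≥0∞) ^ n)⁻¹).toReal * ((p : ℝ) ^ (k * n))⁻¹ :=
            mul_le_mul_of_nonneg_left h1 ENNReal.toReal_nonneg
        _ = _ := by
            simp only [ENNReal.toReal_inv, ENNReal.toReal_pow, ENNReal.toReal_natCast]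
            rw [← mul_inv, ← pow_add]
            congr 2; ring
    · intro c _ hc
      rw [Measure.map_apply (continuous_resMap _).measurable (measurableSet_cyl _ _)]
      have : resMap c ⁻¹' cyl (k + 1) y = ∅ := by
        refine Set.eq_empty_of_forall_notMem fun x hx => hc (funext fun i => ?_)
        rw [← toZMod_resMap c x i, toZMod_eq_iff]
        exact (dvd_pow_self _ k.succ_ne_zero).trans (hx i)
      simp [this]
    · intro h; exact absurd (Finset.mem_univ _) h

theorem integral_haarZpPow_resMap {n : ℕ} {F : (Fin n → ℤ_[p]) → ℝ}
    (hF : Integrable F (haarZpPow p n)) :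
    ∫ x, F x ∂haarZpPow p n =
      ((p : ℝ) ^ n)⁻¹ * ∑ c : Fin n → ZMod p, ∫ x, F (resMap c x) ∂haarZpPow p n := by
  have hp : (p : ℝ≥0∞) ≠ 0 := by simpa using (Fact.out : p.Prime).ne_zero
  have hF' := hF
  rw [haarZpPow_eq_sum_map_resMap p n,
    integrable_smul_measure (by simp) (by simp [hp]), integrable_finsetSum_measure] at hF'
  conv_lhs => rw [haarZpPow_eq_sum_map_resMap p n]
  rw [integral_smul_measure, integral_finsetSum_measure hF']
  simp only [ENNReal.toReal_inv, ENNReal.toReal_pow, ENNReal.toReal_natCast, smul_eq_mul]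
  congr 1
  refine Finset.sum_congr rfl fun c hc => ?_
  exact integral_map (continuous_resMap _).measurable.aemeasurable (hF' c hc).aestronglyMeasurable

end Cylinders

end PadicRoots

end

noncomputable section

namespace PadicRoots

open scoped ENNReal

/-! ### Polynomials from coefficient vectors -/

section VecPoly

variable {R S : Type*} [CommRing R] [CommRing S]

/-- The polynomial of degree less than `n` with given coefficient vector. -/
def vecPoly {n : ℕ} (v : Fin n → R) : R[X] := ∑ i : Fin n, C (v i) * X ^ (i : ℕ)

lemma coeff_vecPoly {n : ℕ} (v : Fin n → R) (j : ℕ) :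
    (vecPoly v).coeff j = if h : j < n then v ⟨j, h⟩ else 0 := by
  simp only [vecPoly, finsetSum_coeff, coeff_C_mul, coeff_X_pow]
  split_ifs with h
  · rw [Finset.sum_eq_single ⟨j, h⟩]
    · simp
    · intro i _ hi
      have : j ≠ i := fun e => hi (Fin.ext e.symm)
      simp [this]
    · simp
  · refine Finset.sum_eq_zero fun i _ => ?_
    have : j ≠ i := by have := i.2; omega
    simp [this]

@[simp] lemma coeff_vecPoly_fin {n : ℕ} (v : Fin n → R) (i : Fin n) :
    (vecPoly v).coeff i = v i := by
  rw [coeff_vecPoly, dif_pos i.2]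

lemma coeff_vecPoly_of_le {n : ℕ} (v : Fin n → R) {j : ℕ} (h : n ≤ j) :
    (vecPoly v).coeff j = 0 := by
  rw [coeff_vecPoly, dif_neg (by omega)]

lemma degree_vecPoly_lt {n : ℕ} (v : Fin n → R) : (vecPoly v).degree < n := by
  rw [degree_lt_iff_coeff_zero]
  exact fun j hj => coeff_vecPoly_of_le v hj

lemma vecPoly_injective {n : ℕ} : Function.Injective (vecPoly : (Fin n → R) → R[X]) := by
  intro v w h
  funext i
  rw [← coeff_vecPoly_fin v, h, coeff_vecPoly_fin]

lemma vecPoly_coeff_of_degree_lt {n : ℕ} {f : R[X]} (hf : f.degree < n) :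
    vecPoly (fun i : Fin n => f.coeff i) = f := by
  ext j
  rw [coeff_vecPoly]
  split_ifs with h
  · rfl
  · exact (((degree_lt_iff_coeff_zero f n).1 hf) j (by omega)).symm

lemma vecPoly_add {n : ℕ} (v w : Fin n → R) : vecPoly (v + w) = vecPoly v + vecPoly w := by
  simp [vecPoly, add_mul, Finset.sum_add_distrib]

lemma vecPoly_sub {n : ℕ} (v w : Fin n → R) : vecPoly (v - w) = vecPoly v - vecPoly w := by
  simp [vecPoly, sub_mul, Finset.sum_sub_distrib]

lemma vecPoly_const_mul {n : ℕ} (a : R) (v : Fin n → R) :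
    vecPoly (fun i => a * v i) = C a * vecPoly v := by
  simp [vecPoly, Finset.mul_sum, mul_assoc]

@[simp] lemma vecPoly_zero {n : ℕ} : vecPoly (0 : Fin n → R) = 0 := by simp [vecPoly]

@[simp] lemma vecPoly_fin_zero (v : Fin 0 → R) : vecPoly v = 0 := by simp [vecPoly]

lemma vecPoly_eq_zero_iff {n : ℕ} {v : Fin n → R} : vecPoly v = 0 ↔ v = 0 := by
  rw [← vecPoly_zero (n := n), vecPoly_injective.eq_iff]

lemma vecPoly_map {n : ℕ} (φ : R →+* S) (v : Fin n → R) :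
    (vecPoly v).map φ = vecPoly fun i => φ (v i) := by
  simp [vecPoly, Polynomial.map_sum]

lemma vecPoly_append {m n : ℕ} (v : Fin m → R) (w : Fin n → R) :
    vecPoly (Fin.append v w) = vecPoly v + X ^ m * vecPoly w := by
  simp only [vecPoly, Fin.sum_univ_add, Fin.append_left, Fin.append_right, Fin.val_castAdd,
    Fin.val_natAdd, Finset.mul_sum]
  congr 1
  refine Finset.sum_congr rfl fun i _ => ?_
  rw [pow_add]; ring

lemma C_dvd_vecPoly_iff {n : ℕ} {a : R} {v : Fin n → R} :
    C a ∣ vecPoly v ↔ ∀ i, a ∣ v i := by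
  rw [C_dvd_iff_dvd_coeff]
  refine ⟨fun h i => by simpa using h i, fun h j => ?_⟩
  rw [coeff_vecPoly]
  split_ifs with hj
  · exact h _
  · exact dvd_zero _

lemma monic_X_pow_add_vecPoly {n : ℕ} (v : Fin n → R) : (X ^ n + vecPoly v).Monic :=
  monic_X_pow_add (degree_vecPoly_lt v)

lemma natDegree_X_pow_add_vecPoly [Nontrivial R] {n : ℕ} (v : Fin n → R) :
    (X ^ n + vecPoly v).natDegree = n := by
  rw [natDegree_add_eq_left_of_degree_lt, natDegree_X_pow]
  rw [degree_X_pow]; exact degree_vecPoly_lt v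

end VecPoly

variable {p : ℕ} [Fact p.Prime]

lemma monicPoly_eq (n : ℕ) (a : Fin n → ℤ_[p]) : monicPoly p n a = X ^ n + vecPoly a := rfl

lemma C_dvd_iff_map_toZMod_eq_zero (f : ℤ_[p][X]) :
    C (p : ℤ_[p]) ∣ f ↔ f.map PadicInt.toZMod = 0 := by
  rw [C_dvd_iff_dvd_coeff, Polynomial.ext_iff]
  refine forall_congr' fun i => ?_
  rw [coeff_map, coeff_zero, ← RingHom.mem_ker, PadicInt.ker_toZMod,
    PadicInt.maximalIdeal_eq_span_p, Ideal.mem_span_singleton]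

lemma C_pow_dvd_iff_map_toZModPow_eq_zero (k : ℕ) (f : ℤ_[p][X]) :
    C ((p : ℤ_[p]) ^ k) ∣ f ↔ f.map (PadicInt.toZModPow k) = 0 := by
  rw [C_dvd_iff_dvd_coeff, Polynomial.ext_iff]
  refine forall_congr' fun i => ?_
  rw [coeff_map, coeff_zero, ← RingHom.mem_ker, PadicInt.ker_toZModPow,
    Ideal.mem_span_singleton]

/-! ### Counting roots in `ℤ_[p]` and `ℚ_[p]` -/

section Roots

open Classical in
/-- The number of distinct roots of `f` in `ℤ_[p]`. -/
def numIntRoots (f : ℤ_[p][X]) : ℕ := f.roots.toFinset.card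

@[simp] lemma numIntRoots_zero : numIntRoots (0 : ℤ_[p][X]) = 0 := by simp [numIntRoots]

@[simp] lemma numRoots_zero : numRoots p (0 : ℤ_[p][X]) = 0 := by simp [numRoots, rootsQp]

lemma numIntRoots_eq_ncard {f : ℤ_[p][X]} (hf : f ≠ 0) :
    numIntRoots f = {x : ℤ_[p] | f.eval x = 0}.ncard := by
  classical
  rw [numIntRoots, ← Set.ncard_coe_finset]
  congr 1
  ext x
  simp [hf]

lemma mem_rootsQp {f : ℤ_[p][X]} (hf : f ≠ 0) (x : ℚ_[p]) :
    x ∈ rootsQp p f ↔ f.aeval x = 0 := by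
  classical
  rw [rootsQp, Multiset.mem_toFinset, mem_aroots]
  simp [hf]

lemma numRoots_eq_ncard {f : ℤ_[p][X]} (hf : f ≠ 0) :
    numRoots p f = {x : ℚ_[p] | f.aeval x = 0}.ncard := by
  rw [numRoots, ← Set.ncard_coe_finset]
  congr 1
  ext x
  simp [mem_rootsQp hf]

lemma finite_int_roots {f : ℤ_[p][X]} (hf : f ≠ 0) : {x : ℤ_[p] | f.eval x = 0}.Finite := by
  classical
  refine (f.roots.toFinset.finite_toSet).subset fun x hx => ?_
  simpa [hf] using hx

lemma finite_rootsQp {f : ℤ_[p][X]} (hf : f ≠ 0) : {x : ℚ_[p] | f.aeval x = 0}.Finite := by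
  refine ((rootsQp p f).finite_toSet).subset fun x hx => ?_
  simpa [mem_rootsQp hf] using hx

lemma aeval_coe (f : ℤ_[p][X]) (y : ℤ_[p]) : f.aeval (y : ℚ_[p]) = (f.eval y : ℤ_[p]) := by
  rw [← PadicInt.algebraMap_apply, aeval_algebraMap_apply, PadicInt.algebraMap_apply,
    coe_aeval_eq_eval]

lemma numRoots_le_natDegree (f : ℤ_[p][X]) : numRoots p f ≤ f.natDegree := by
  classical
  refine (Multiset.toFinset_card_le _).trans ?_
  refine (card_roots' _).trans ?_
  exact natDegree_map_le

/-- Used for monic polynomials and for those with unit leading coefficient, whose roots are integral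
over `ℤ_[p]`; the Hensel arguments then only deal with integral roots. -/
lemma numRoots_eq_numIntRoots_of_integral {f : ℤ_[p][X]} (hf : f ≠ 0)
    (h : ∀ x : ℚ_[p], f.aeval x = 0 → ‖x‖ ≤ 1) : numRoots p f = numIntRoots f := by
  rw [numRoots_eq_ncard hf, numIntRoots_eq_ncard hf]
  symm
  refine Set.ncard_congr (fun y _ => (y : ℚ_[p])) ?_ ?_ ?_
  · intro y hy
    simp only [Set.mem_ofPred_eq] at hy ⊢
    rw [aeval_coe, hy, PadicInt.coe_zero]
  · intro a b _ _ hab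
    exact PadicInt.ext hab
  · intro x hx
    refine ⟨⟨x, h x hx⟩, ?_, rfl⟩
    have := aeval_coe f ⟨x, h x hx⟩
    simp only [Set.mem_ofPred_eq] at hx ⊢
    rw [show ((⟨x, h x hx⟩ : ℤ_[p]) : ℚ_[p]) = x from rfl, hx] at this
    exact PadicInt.coe_eq_zero.1 this.symm

lemma norm_le_one_of_monic {f : ℤ_[p][X]} (hf : f.Monic) {x : ℚ_[p]} (hx : f.aeval x = 0) :
    ‖x‖ ≤ 1 := by
  have hi : IsIntegral ℤ_[p] x := ⟨f, hf, hx⟩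
  obtain ⟨y, rfl⟩ := IsIntegrallyClosed.isIntegral_iff.1 hi
  exact y.2

lemma numRoots_eq_numIntRoots {f : ℤ_[p][X]} (hf : f.Monic) : numRoots p f = numIntRoots f :=
  numRoots_eq_numIntRoots_of_integral hf.ne_zero fun _ => norm_le_one_of_monic hf

lemma numRoots_eq_numIntRoots_of_isUnit {f : ℤ_[p][X]} (hf : IsUnit f.leadingCoeff) :
    numRoots p f = numIntRoots f := by
  have hf0 : f ≠ 0 := by rintro rfl; simp at hf
  refine numRoots_eq_numIntRoots_of_integral hf0 fun x hx => ?_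
  obtain ⟨b, hb⟩ := hf.exists_left_inv
  refine norm_le_one_of_monic (f := C b * f) ?_ ?_
  · rw [Monic, leadingCoeff_mul, leadingCoeff_C, hb]
  · simp [hx]

lemma numIntRoots_const_mul {a : ℤ_[p]} (ha : a ≠ 0) (f : ℤ_[p][X]) :
    numIntRoots (C a * f) = numIntRoots f := by
  rw [numIntRoots, roots_C_mul f ha, numIntRoots]

lemma numRoots_const_mul {a : ℤ_[p]} (ha : a ≠ 0) (f : ℤ_[p][X]) :
    numRoots p (C a * f) = numRoots p f := by
  rw [numRoots, rootsQp, aroots_C_mul f ha, numRoots, rootsQp]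

lemma numIntRoots_mul {f g : ℤ_[p][X]} (hf : f ≠ 0) (hg : g ≠ 0)
    (h : ∀ x, f.eval x = 0 → g.eval x ≠ 0) :
    numIntRoots (f * g) = numIntRoots f + numIntRoots g := by
  rw [numIntRoots_eq_ncard hf, numIntRoots_eq_ncard hg, numIntRoots_eq_ncard (mul_ne_zero hf hg),
    ← Set.ncard_union_eq _ (finite_int_roots hf) (finite_int_roots hg)]
  · congr 1; ext x; simp
  · exact Set.disjoint_left.2 fun x hx hx' => h x hx hx'

lemma numRoots_mul {f g : ℤ_[p][X]} (hf : f ≠ 0) (hg : g ≠ 0)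
    (h : ∀ x : ℚ_[p], f.aeval x = 0 → g.aeval x ≠ 0) :
    numRoots p (f * g) = numRoots p f + numRoots p g := by
  rw [numRoots_eq_ncard hf, numRoots_eq_ncard hg, numRoots_eq_ncard (mul_ne_zero hf hg),
    ← Set.ncard_union_eq _ (finite_rootsQp hf) (finite_rootsQp hg)]
  · congr 1; ext x; simp
  · exact Set.disjoint_left.2 fun x hx hx' => h x hx hx'

lemma eval_map_toZMod (f : ℤ_[p][X]) (x : ℤ_[p]) :
    (f.map PadicInt.toZMod).eval (PadicInt.toZMod x) = PadicInt.toZMod (f.eval x) :=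
  eval_map_apply ..

/-- Scaling the variable by `p` in a polynomial all of whose roots are divisible by `p`. -/
lemma numIntRoots_comp_mul_prime {f : ℤ_[p][X]} (hf : f ≠ 0)
    (h : ∀ x, f.eval x = 0 → (p : ℤ_[p]) ∣ x) :
    numIntRoots (f.comp (C (p : ℤ_[p]) * X)) = numIntRoots f := by
  have hp : (p : ℤ_[p]) ≠ 0 := PadicInt.prime_p.ne_zero
  have hf' : f.comp (C (p : ℤ_[p]) * X) ≠ 0 := by
    rw [Ne, comp_C_mul_X_eq_zero_iff (mem_nonZeroDivisors_of_ne_zero hp)]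
    exact hf
  rw [numIntRoots_eq_ncard hf, numIntRoots_eq_ncard hf']
  refine Set.ncard_congr (fun y _ => (p : ℤ_[p]) * y) ?_ ?_ ?_
  · intro y hy
    simpa using hy
  · intro a b _ _ hab
    exact mul_left_cancel₀ hp hab
  · intro x hx
    obtain ⟨y, rfl⟩ := h x hx
    refine ⟨y, ?_, rfl⟩
    simpa using hx

lemma numIntRoots_comp_add (f : ℤ_[p][X]) (a : ℤ_[p]) :
    numIntRoots (f.comp (X + C a)) = numIntRoots f := by
  by_cases hf : f = 0
  · simp [hf]
  have hf' : f.comp (X + C a) ≠ 0 := by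
    rw [Ne, comp_X_add_C_eq_zero_iff]; exact hf
  rw [numIntRoots_eq_ncard hf, numIntRoots_eq_ncard hf']
  refine Set.ncard_congr (fun y _ => y + a) ?_ ?_ ?_
  · intro y hy
    simpa using hy
  · intro b c _ _ hab
    exact add_right_cancel hab
  · intro x hx
    refine ⟨x - a, ?_, by simp⟩
    simpa using hx

end Roots

/-! ### Measurability of the numbers of roots -/

section Measurability

open Filter Topology

lemma eventually_injOn_toZModPow (s : Finset ℤ_[p]) :
    ∀ᶠ j in atTop, Set.InjOn (PadicInt.toZModPow (p := p) j) s := by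
  have : ∀ᶠ j in atTop, ∀ x ∈ s, ∀ y ∈ s,
      PadicInt.toZModPow (p := p) j x = PadicInt.toZModPow j y → x = y := by
    refine (eventually_all_finset s).2 fun x _ => (eventually_all_finset s).2 fun y _ => ?_
    by_cases hxy : x = y
    · exact Eventually.of_forall fun _ _ => hxy
    · obtain ⟨n, hn⟩ := not_forall.1 fun h => hxy (PadicInt.ext_of_toZModPow.1 h)
      filter_upwards [eventually_ge_atTop n] with j hj h
      refine absurd ?_ hn
      rw [toZModPow_eq_iff] at h ⊢
      exact (pow_dvd_pow _ hj).trans h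
  filter_upwards [this] with j hj x hx y hy hxy
  exact hj x hx y hy hxy

/-- The set is the projection of a closed set along the compact factor `ℤ_[p]`. -/
lemma isClosed_exists_root (n j : ℕ) (c : ZMod (p ^ j)) :
    IsClosed {v : Fin n → ℤ_[p] | ∃ y, PadicInt.toZModPow j y = c ∧ (vecPoly v).eval y = 0} := by
  have hc : IsClosed {q : (Fin n → ℤ_[p]) × ℤ_[p] |
      PadicInt.toZModPow j q.2 = c ∧ (vecPoly q.1).eval q.2 = 0} := by
    refine IsClosed.inter ?_ ?_
    · have : {y : ℤ_[p] | PadicInt.toZModPow j y = c} =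
          Metric.closedBall (c.val : ℤ_[p]) ((p : ℝ) ^ (-(j : ℤ))) := by
        rw [← setOf_pow_dvd_sub]
        ext y
        simp only [Set.mem_ofPred_eq, pow_dvd_sub_natCast_val]
      have h2 : IsClosed {y : ℤ_[p] | PadicInt.toZModPow j y = c} := by
        rw [this]; exact Metric.isClosed_closedBall
      exact h2.preimage continuous_snd
    · refine isClosed_eq ?_ continuous_const
      simp only [vecPoly, eval_finsetSum, eval_mul, eval_C, eval_pow, eval_X]
      fun_prop
  have := isClosedMap_fst_of_compactSpace _ hc
  convert this using 1
  ext v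
  simp

-- The number of roots is the limit of the number of residues modulo `p ^ j` that contain a root:
-- finitely many roots are separated modulo a high power of `p`.
open Classical in
lemma measurable_numIntRoots_vecPoly (n : ℕ) :
    Measurable fun v : Fin n → ℤ_[p] => numIntRoots (vecPoly v) := by
  have hp : ∀ j, NeZero (p ^ j) := fun j => ⟨pow_ne_zero _ (Fact.out : p.Prime).ne_zero⟩
  -- The zero polynomial has by convention no roots, while every residue contains one of its zeros,
  -- so it is treated separately.
  let g : ℕ → (Fin n → ℤ_[p]) → ℕ := fun j v => if v = 0 then 0 else
    ∑ c : ZMod (p ^ j),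
      if ∃ y, PadicInt.toZModPow j y = c ∧ (vecPoly v).eval y = 0 then 1 else 0
  refine measurable_of_tendsto_metrizable (f := g) (fun j => ?_) ?_
  · refine Measurable.ite (measurableSet_singleton _) measurable_const ?_
    refine Finset.measurable_sum _ fun c _ => ?_
    exact Measurable.ite (isClosed_exists_root n j c).measurableSet measurable_const
      measurable_const
  · rw [tendsto_pi_nhds]
    intro v
    by_cases hv : v = 0
    · simp [g, hv]
    · have hv' : vecPoly v ≠ 0 := fun h => hv (vecPoly_eq_zero_iff.1 h)
      refine tendsto_const_nhds.congr' ?_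
      filter_upwards [eventually_injOn_toZModPow (vecPoly v).roots.toFinset] with j hj
      simp only [g, if_neg hv, Finset.sum_boole, Nat.cast_id]
      rw [numIntRoots, ← Finset.card_image_of_injOn hj]
      congr 1
      ext c
      simp [hv', and_comm]

lemma measurable_numIntRoots {X : Type*} [MeasurableSpace X] {f : X → ℤ_[p][X]} (n : ℕ)
    (hd : ∀ x, (f x).degree < n) (hf : ∀ i, Measurable fun x => (f x).coeff i) :
    Measurable fun x => numIntRoots (f x) := by
  have : (fun x => numIntRoots (f x)) =
      fun x => numIntRoots (vecPoly fun i : Fin n => (f x).coeff i) := by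
    funext x; rw [vecPoly_coeff_of_degree_lt (hd x)]
  rw [this]
  exact (measurable_numIntRoots_vecPoly n).comp (measurable_pi_lambda _ fun i => hf i)

/-- The polynomial `p ^ (k n) f (x / p ^ k)`. -/
def scalePoly {n : ℕ} (k : ℕ) (v : Fin n → ℤ_[p]) : ℤ_[p][X] :=
  vecPoly fun i => (p : ℤ_[p]) ^ (k * (n - i)) * v i

lemma aeval_scalePoly {n : ℕ} (k : ℕ) (v : Fin n → ℤ_[p]) (x : ℚ_[p]) :
    (scalePoly k v).aeval ((p : ℚ_[p]) ^ k * x) = (p : ℚ_[p]) ^ (k * n) * (vecPoly v).aeval x := by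
  simp only [scalePoly, vecPoly, map_sum, map_mul, aeval_C, aeval_X, map_pow, Finset.mul_sum]
  refine Finset.sum_congr rfl fun i _ => ?_
  have : k * n = k * (n - i) + k * i := by
    rw [← mul_add]; congr 1; have := i.2; omega
  rw [this, pow_add, mul_pow, ← pow_mul, map_natCast]
  ring

lemma numIntRoots_scalePoly {n : ℕ} (k : ℕ) {v : Fin n → ℤ_[p]} (hv : v ≠ 0) :
    numIntRoots (scalePoly k v) =
      {x : ℚ_[p] | (vecPoly v).aeval x = 0 ∧ ‖(p : ℚ_[p]) ^ k * x‖ ≤ 1}.ncard := by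
  have hp : (p : ℚ_[p]) ≠ 0 := by exact_mod_cast (Fact.out : p.Prime).ne_zero
  have hs : scalePoly k v ≠ 0 := by
    rw [scalePoly, Ne, vecPoly_eq_zero_iff]
    intro h
    refine hv (funext fun i => ?_)
    have := congrFun h i
    simpa [PadicInt.prime_p.ne_zero] using this
  rw [numIntRoots_eq_ncard hs]
  symm
  refine Set.ncard_congr (fun x hx => (⟨(p : ℚ_[p]) ^ k * x, hx.2⟩ : ℤ_[p])) ?_ ?_ ?_
  · intro x hx
    have := aeval_scalePoly k v x
    rw [hx.1, mul_zero] at this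
    have h2 := aeval_coe (scalePoly k v) ⟨(p : ℚ_[p]) ^ k * x, hx.2⟩
    rw [show ((⟨(p : ℚ_[p]) ^ k * x, hx.2⟩ : ℤ_[p]) : ℚ_[p]) = (p : ℚ_[p]) ^ k * x from rfl,
      this] at h2
    exact PadicInt.coe_eq_zero.1 h2.symm
  · intro a b _ _ hab
    have := congrArg (fun y : ℤ_[p] => (y : ℚ_[p])) hab
    exact mul_left_cancel₀ (pow_ne_zero k hp) this
  · intro y hy
    have e : (p : ℚ_[p]) ^ k * (((p : ℚ_[p]) ^ k)⁻¹ * y) = y :=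
      mul_inv_cancel_left₀ (pow_ne_zero k hp) _
    have h1 := aeval_scalePoly k v (((p : ℚ_[p]) ^ k)⁻¹ * y)
    rw [e, aeval_coe, show (scalePoly k v).eval y = 0 from hy, PadicInt.coe_zero] at h1
    refine ⟨((p : ℚ_[p]) ^ k)⁻¹ * y, ⟨?_, ?_⟩, ?_⟩
    · exact (mul_eq_zero.1 h1.symm).resolve_left (pow_ne_zero _ hp)
    · rw [e]; exact y.2
    · exact PadicInt.ext e

/-- Multiplying the variable by `p ^ k` makes any finite set of roots integral for large `k`, so
this count is a limit of counts of integral roots. -/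
lemma measurable_numRoots_vecPoly (n : ℕ) :
    Measurable fun v : Fin n → ℤ_[p] => numRoots p (vecPoly v) := by
  refine measurable_of_tendsto_metrizable
    (f := fun k (v : Fin n → ℤ_[p]) => numIntRoots (scalePoly k v)) (fun k => ?_) ?_
  · refine (measurable_numIntRoots_vecPoly n).comp (measurable_pi_lambda _ fun i => ?_)
    exact (measurable_pi_apply i).const_mul _
  · rw [tendsto_pi_nhds]
    intro v
    by_cases hv : v = 0
    · subst hv
      simp [scalePoly, vecPoly]
    · have hv' : vecPoly v ≠ 0 := fun h => hv (vecPoly_eq_zero_iff.1 h)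
      refine tendsto_const_nhds.congr' ?_
      have h1 : ∀ᶠ k in atTop, ∀ x ∈ rootsQp p (vecPoly v), ‖(p : ℚ_[p]) ^ k * x‖ ≤ 1 := by
        refine (eventually_all_finset _).2 fun x _ => ?_
        have h0 : Tendsto (fun k : ℕ => (p : ℚ_[p]) ^ k * x) atTop (𝓝 (0 * x)) :=
          (tendsto_pow_atTop_nhds_zero_of_norm_lt_one Padic.norm_p_lt_one).mul_const x
        rw [zero_mul] at h0
        have := h0.norm
        rw [norm_zero] at this
        filter_upwards [this.eventually (gt_mem_nhds one_pos)] with k hk using hk.le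
      filter_upwards [h1] with k hk
      rw [numIntRoots_scalePoly k hv, numRoots_eq_ncard hv']
      congr 1
      ext x
      simp only [Set.mem_ofPred_eq]
      exact ⟨fun h => ⟨h, hk x ((mem_rootsQp hv' x).2 h)⟩, fun h => h.1⟩

lemma measurable_numRoots_genPoly (n : ℕ) :
    Measurable fun a => numRoots p (genPoly p n a) := measurable_numRoots_vecPoly (n + 1)

lemma measurable_numIntRoots_monicPoly (n : ℕ) :
    Measurable fun a => numIntRoots (monicPoly p n a) := by
  refine measurable_numIntRoots (n + 1) (fun a => ?_) fun i => ?_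
  · rw [monicPoly_eq]
    have := monic_X_pow_add_vecPoly a
    rw [degree_eq_natDegree this.ne_zero, natDegree_X_pow_add_vecPoly]
    exact_mod_cast n.lt_succ_self
  · simp only [monicPoly_eq, coeff_add, coeff_vecPoly]
    refine measurable_const.add ?_
    split_ifs
    · exact measurable_pi_apply _
    · exact measurable_const

lemma numRoots_monicPoly (n : ℕ) (a : Fin n → ℤ_[p]) :
    numRoots p (monicPoly p n a) = numIntRoots (monicPoly p n a) :=
  numRoots_eq_numIntRoots (monic_X_pow_add_vecPoly a)

lemma measurable_numRoots_monicPoly (n : ℕ) :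
    Measurable fun a => numRoots p (monicPoly p n a) := by
  simp only [numRoots_monicPoly]
  exact measurable_numIntRoots_monicPoly n

end Measurability

/-! ### The measure conditioned on reduction to `xⁿ` -/

section Reduced

/-- The conditioned measure is the image of the Haar measure under multiplication by `p`. -/
theorem reducedMeasure_eq_map (n : ℕ) :
    reducedMeasure p n = (haarZpPow p n).map (resMap (0 : Fin n → ZMod p)) := by
  have hp : (p : ℝ≥0∞) ≠ 0 := by simpa using (Fact.out : p.Prime).ne_zero
  have hset : {a | (monicPoly p n a).map PadicInt.toZMod = X ^ n} =
      cyl 1 (0 : Fin n → ℤ_[p]) := by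
    ext a
    simp only [Set.mem_ofPred_eq, monicPoly_eq, Polynomial.map_add, Polynomial.map_pow, map_X,
      add_eq_left, cyl]
    rw [← C_dvd_iff_map_toZMod_eq_zero, C_dvd_vecPoly_iff]
    simp
  have hmeas := (continuous_resMap (0 : Fin n → ZMod p)).measurable
  have key : ∀ t, MeasurableSet t → haarZpPow p n (cyl 1 0 ∩ t) =
      ((p : ℝ≥0∞) ^ n)⁻¹ * (haarZpPow p n).map (resMap (0 : Fin n → ZMod p)) t := by
    intro t ht
    conv_lhs => rw [haarZpPow_eq_sum_map_resMap p n]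
    rw [Measure.smul_apply, Measure.finsetSum_apply, smul_eq_mul]
    congr 1
    rw [Finset.sum_eq_single 0]
    · rw [Measure.map_apply hmeas ((measurableSet_cyl _ _).inter ht), Measure.map_apply hmeas ht]
      congr 1
      ext x
      simp only [Set.preimage_inter, Set.mem_inter_iff, Set.mem_preimage, and_iff_right_iff_imp]
      intro _ i
      simp [resMap]
    · intro c _ hc
      rw [Measure.map_apply (continuous_resMap c).measurable ((measurableSet_cyl _ _).inter ht)]
      have : resMap c ⁻¹' (cyl 1 0 ∩ t) = ∅ := by
        refine Set.eq_empty_of_forall_notMem fun x hx => hc (funext fun i => ?_)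
        have := hx.1 i
        rw [pow_one, ← toZMod_eq_iff, toZMod_resMap] at this
        simpa using this
      simp [this]
    · intro h; exact absurd (Finset.mem_univ _) h
  have := Measure.isProbabilityMeasure_map (μ := haarZpPow p n) hmeas.aemeasurable
  have h1 : haarZpPow p n (cyl 1 0) = ((p : ℝ≥0∞) ^ n)⁻¹ := by
    have := key Set.univ MeasurableSet.univ
    rwa [Set.inter_univ, measure_univ, mul_one] at this
  ext t ht
  rw [reducedMeasure, hset, ProbabilityTheory.cond_apply (measurableSet_cyl _ _), key t ht, h1,
    inv_inv, ← mul_assoc, ENNReal.mul_inv_cancel (by simp [hp]) (by simp), one_mul]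

instance (n : ℕ) : IsProbabilityMeasure (reducedMeasure p n) := by
  rw [reducedMeasure_eq_map]
  exact Measure.isProbabilityMeasure_map (continuous_resMap _).measurable.aemeasurable

lemma vecPoly_resMap_zero {n : ℕ} (x : Fin n → ℤ_[p]) :
    vecPoly (resMap (0 : Fin n → ZMod p) x) = C (p : ℤ_[p]) * vecPoly x := by
  rw [← vecPoly_const_mul]
  congr 1
  funext i
  simp [resMap]

lemma vecPoly_resMap {n : ℕ} (c : Fin n → ZMod p) (x : Fin n → ℤ_[p]) :
    vecPoly (resMap c x) = vecPoly (liftVec c) + C (p : ℤ_[p]) * vecPoly x := by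
  rw [← vecPoly_const_mul, ← vecPoly_add]
  rfl

lemma vecPoly_liftVec_map {n : ℕ} (c : Fin n → ZMod p) :
    (vecPoly (liftVec c : Fin n → ℤ_[p])).map PadicInt.toZMod = vecPoly c := by
  rw [vecPoly_map]
  congr 1
  funext i
  simp [liftVec]

end Reduced

end PadicRoots

end

noncomputable section

namespace PadicRoots

open scoped ENNReal

variable {p : ℕ} [Fact p.Prime]

/-! ### Hensel factorization as a measure-preserving map -/

section FactorMap

/-- Uniqueness, modulo prime powers, of a factorization that is coprime modulo `p`. -/
lemma C_pow_dvd_sub_of_mul {g g' h h' : ℤ_[p][X]} (hg : g.Monic)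
    (hdeg : (g' - g).degree < g.degree) (hgg : C (p : ℤ_[p]) ∣ g' - g)
    (hhh : C (p : ℤ_[p]) ∣ h' - h)
    (hco : IsCoprime (g.map (PadicInt.toZMod (p := p))) (h.map PadicInt.toZMod)) (j : ℕ)
    (hj : C ((p : ℤ_[p]) ^ (j + 1)) ∣ g' * h' - g * h) :
    C ((p : ℤ_[p]) ^ (j + 1)) ∣ g' - g ∧ C ((p : ℤ_[p]) ^ (j + 1)) ∣ h' - h := by
  have hp0 : (p : ℤ_[p]) ≠ 0 := PadicInt.prime_p.ne_zero
  induction j with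
  | zero => simpa using ⟨hgg, hhh⟩
  | succ j ih =>
    -- With `g' = g + p ^ (j + 1) U` and `h' = h + p ^ (j + 1) V` the products differ by `p ^ (j +
    -- 1) (U h' + g V)`, whose cofactor must vanish modulo `p`. By coprimality `g` divides `U`
    -- modulo `p`; the degree bound forces `U ≡ 0`, and then `V ≡ 0`.
    obtain ⟨⟨U, hU⟩, ⟨V, hV⟩⟩ := ih ((_root_.map_dvd C (pow_dvd_pow _ (Nat.le_succ _))).trans hj)
    have e : g' * h' - g * h = C ((p : ℤ_[p]) ^ (j + 1)) * (U * h' + g * V) := by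
      rw [mul_add, ← mul_assoc, ← hU, mul_left_comm, ← hV]; ring
    have hne : C ((p : ℤ_[p]) ^ (j + 1)) ≠ 0 := C_ne_zero.2 (pow_ne_zero _ hp0)
    rw [e, pow_succ, C_mul, mul_dvd_mul_iff_left hne, C_dvd_iff_map_toZMod_eq_zero,
      Polynomial.map_add, Polynomial.map_mul, Polynomial.map_mul] at hj
    have hh' : h'.map (PadicInt.toZMod (p := p)) = h.map PadicInt.toZMod := by
      rw [C_dvd_iff_map_toZMod_eq_zero, Polynomial.map_sub, sub_eq_zero] at hhh
      exact hhh
    rw [hh'] at hj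
    have hdvd : g.map (PadicInt.toZMod (p := p)) ∣ U.map PadicInt.toZMod := by
      refine hco.dvd_of_dvd_mul_right ?_
      rw [eq_neg_of_add_eq_zero_left hj]
      exact (dvd_mul_right _ _).neg_right
    have hU0 : U.map (PadicInt.toZMod (p := p)) = 0 := by
      refine eq_zero_of_dvd_of_degree_lt hdvd ?_
      refine (degree_map_le).trans_lt ?_
      rw [hg.degree_map]
      rw [hU, degree_C_mul (pow_ne_zero _ hp0)] at hdeg
      exact hdeg
    have hV0 : V.map (PadicInt.toZMod (p := p)) = 0 := by
      rw [hU0, zero_mul, zero_add] at hj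
      exact (mul_eq_zero.1 hj).resolve_left (hg.map _).ne_zero
    rw [← C_dvd_iff_map_toZMod_eq_zero] at hU0 hV0
    rw [hU, hV, pow_succ, C_mul]
    exact ⟨mul_dvd_mul_left _ hU0, mul_dvd_mul_left _ hV0⟩

/-- Division by a monic polynomial commutes with reduction modulo `p ^ k`. -/
lemma C_pow_dvd_divByMonic_sub {g g' : ℤ_[p][X]} (hg : g.Monic) (hg' : g'.Monic) (H : ℤ_[p][X])
    (k : ℕ) (h : C ((p : ℤ_[p]) ^ k) ∣ g' - g) :
    C ((p : ℤ_[p]) ^ k) ∣ H /ₘ g' - H /ₘ g := by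
  rw [C_pow_dvd_iff_map_toZModPow_eq_zero, Polynomial.map_sub, sub_eq_zero] at h ⊢
  rw [map_divByMonic _ hg', map_divByMonic _ hg, h]

/-- Exact division by `p`, with value `0` where it is not possible. -/
def divPrime (x : ℤ_[p]) : ℤ_[p] := open Classical in if h : (p : ℤ_[p]) ∣ x then h.choose else 0

lemma mul_divPrime {x : ℤ_[p]} (h : (p : ℤ_[p]) ∣ x) : (p : ℤ_[p]) * divPrime x = x := by
  rw [divPrime, dif_pos h]
  exact h.choose_spec.symm

/-- For `g = g₀ + p u`, the vector `L` with `H + p L = g (H /ₘ g + p v)`. -/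
def factorMap {r s : ℕ} (H g₀ : ℤ_[p][X]) (x : (Fin r → ℤ_[p]) × (Fin s → ℤ_[p])) :
    Fin (r + s) → ℤ_[p] := fun i =>
  (vecPoly x.2 * (g₀ + C (p : ℤ_[p]) * vecPoly x.1)).coeff i -
    divPrime ((H %ₘ (g₀ + C (p : ℤ_[p]) * vecPoly x.1)).coeff i)

variable {r s : ℕ} {H g₀ : ℤ_[p][X]}

lemma degree_C_mul_vecPoly_lt (hd : g₀.natDegree = r) (hg : g₀.Monic) (u : Fin r → ℤ_[p]) :
    (C (p : ℤ_[p]) * vecPoly u).degree < g₀.degree := by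
  rw [degree_C_mul PadicInt.prime_p.ne_zero, degree_eq_natDegree hg.ne_zero, hd]
  exact degree_vecPoly_lt u

lemma monic_add_C_mul_vecPoly (hd : g₀.natDegree = r) (hg : g₀.Monic) (u : Fin r → ℤ_[p]) :
    (g₀ + C (p : ℤ_[p]) * vecPoly u).Monic :=
  hg.add_of_left (degree_C_mul_vecPoly_lt hd hg u)

lemma degree_add_C_mul_vecPoly (hd : g₀.natDegree = r) (hg : g₀.Monic) (u : Fin r → ℤ_[p]) :
    (g₀ + C (p : ℤ_[p]) * vecPoly u).degree = r := by
  rw [degree_add_eq_left_of_degree_lt (degree_C_mul_vecPoly_lt hd hg u),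
    degree_eq_natDegree hg.ne_zero, hd]

lemma map_add_C_mul (f g : ℤ_[p][X]) :
    (f + C (p : ℤ_[p]) * g).map (PadicInt.toZMod (p := p)) = f.map PadicInt.toZMod := by
  simp

/-- The remainder of `H` modulo `g` is divisible by `p`, because the reduction of `g₀` divides that
of `H`. The perturbation `L` can therefore cancel it and leave an exact product. -/
lemma factorMap_spec (hd : g₀.natDegree = r) (hg : g₀.Monic)
    (hdvd : g₀.map (PadicInt.toZMod (p := p)) ∣ H.map PadicInt.toZMod)
    (x : (Fin r → ℤ_[p]) × (Fin s → ℤ_[p])) :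
    H + C (p : ℤ_[p]) * vecPoly (factorMap H g₀ x) =
      (g₀ + C (p : ℤ_[p]) * vecPoly x.1) *
        (H /ₘ (g₀ + C (p : ℤ_[p]) * vecPoly x.1) + C (p : ℤ_[p]) * vecPoly x.2) := by
  set g := g₀ + C (p : ℤ_[p]) * vecPoly x.1 with hgdef
  have hgm : g.Monic := monic_add_C_mul_vecPoly hd hg x.1
  have hgd : g.degree = r := degree_add_C_mul_vecPoly hd hg x.1
  have hρ : C (p : ℤ_[p]) ∣ H %ₘ g := by
    rw [C_dvd_iff_map_toZMod_eq_zero, map_modByMonic _ hgm,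
      modByMonic_eq_zero_iff_dvd (hgm.map _), hgdef, map_add_C_mul]
    exact hdvd
  have hL : C (p : ℤ_[p]) * vecPoly (factorMap H g₀ x) =
      C (p : ℤ_[p]) * (vecPoly x.2 * g) - H %ₘ g := by
    ext i
    rw [coeff_C_mul, coeff_sub, coeff_C_mul, coeff_vecPoly]
    split_ifs with hi
    · simp only [factorMap, mul_sub, ← hgdef]
      rw [mul_divPrime ((C_dvd_iff_dvd_coeff _ _).1 hρ i)]
    -- For `i ≥ r + s` nothing is lost by truncation: both the product and the remainder have
    -- smaller degree.
    · have h1 : (vecPoly x.2 * g).coeff i = 0 := by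
        by_cases h0 : vecPoly x.2 = 0
        · simp [h0]
        refine coeff_eq_zero_of_degree_lt ?_
        have h2 := degree_vecPoly_lt x.2
        rw [degree_mul, hgd, degree_eq_natDegree h0] at *
        have h3 : (vecPoly x.2).natDegree < s := by exact_mod_cast h2
        have : (vecPoly x.2).natDegree + r < i := by omega
        exact_mod_cast this
      have h2 : (H %ₘ g).coeff i = 0 := by
        refine coeff_eq_zero_of_degree_lt ?_
        refine (degree_modByMonic_lt H hgm).trans_le ?_
        rw [hgd]
        have : r ≤ i := by omega
        exact_mod_cast this
      rw [h1, h2]; simp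
  rw [hL]
  have := modByMonic_add_div H g
  calc H + (C (p : ℤ_[p]) * (vecPoly x.2 * g) - H %ₘ g)
      = (H %ₘ g + g * (H /ₘ g)) + (C (p : ℤ_[p]) * (vecPoly x.2 * g) - H %ₘ g) := by rw [this]
    _ = _ := by ring

lemma map_divByMonic_add_C_mul {h₀ : (ZMod p)[X]} (hd : g₀.natDegree = r) (hg : g₀.Monic)
    (hH : H.map PadicInt.toZMod = g₀.map PadicInt.toZMod * h₀)
    (x : (Fin r → ℤ_[p]) × (Fin s → ℤ_[p])) :
    (H /ₘ (g₀ + C (p : ℤ_[p]) * vecPoly x.1) + C (p : ℤ_[p]) * vecPoly x.2).map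
      (PadicInt.toZMod (p := p)) = h₀ := by
  rw [map_add_C_mul, map_divByMonic _ (monic_add_C_mul_vecPoly hd hg x.1), map_add_C_mul, hH,
    mul_divByMonic_cancel_left _ (hg.map _)]

lemma mem_cyl_iff_C_dvd {n k : ℕ} (x x' : Fin n → ℤ_[p]) :
    x' ∈ cyl k x ↔ C ((p : ℤ_[p]) ^ k) ∣ vecPoly x' - vecPoly x := by
  rw [← vecPoly_sub, C_dvd_vecPoly_iff]
  rfl

lemma mem_cyl_iff_C_dvd' {n k : ℕ} (x x' : Fin n → ℤ_[p]) :
    x' ∈ cyl k x ↔ C ((p : ℤ_[p]) ^ (k + 1)) ∣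
      C (p : ℤ_[p]) * vecPoly x' - C (p : ℤ_[p]) * vecPoly x := by
  have hne : C (p : ℤ_[p]) ≠ 0 := C_ne_zero.2 PadicInt.prime_p.ne_zero
  rw [mem_cyl_iff_C_dvd, ← mul_sub, pow_succ', C_mul, mul_dvd_mul_iff_left hne]

/-- Products are congruent modulo `p ^ (k + 1)` exactly when both factors are: one direction is the
uniqueness half of Hensel's lemma, the other is algebra. The existence half is not needed, since the
volume count of `eq_haarZpPow_of_cyl_le` replaces it. -/
theorem measurePreserving_factorMap {h₀ : (ZMod p)[X]} (hd : g₀.natDegree = r) (hg : g₀.Monic)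
    (hH : H.map PadicInt.toZMod = g₀.map PadicInt.toZMod * h₀)
    (hco : IsCoprime (g₀.map PadicInt.toZMod) h₀) :
    MeasurePreserving (factorMap H g₀) ((haarZpPow p r).prod (haarZpPow p s))
      (haarZpPow p (r + s)) := by
  refine measurePreserving_prod_of_congr fun k x x' => ?_
  rw [mem_cyl_iff_C_dvd' (factorMap H g₀ x), mem_cyl_iff_C_dvd' x.1, mem_cyl_iff_C_dvd' x.2]
  have hdvd : g₀.map (PadicInt.toZMod (p := p)) ∣ H.map PadicInt.toZMod := ⟨_, hH⟩
  have e := factorMap_spec hd hg hdvd x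
  have e' := factorMap_spec hd hg hdvd x'
  have hr := map_divByMonic_add_C_mul hd hg hH x
  have hr' := map_divByMonic_add_C_mul hd hg hH x'
  have hgm := monic_add_C_mul_vecPoly hd hg x.1
  have hgm' := monic_add_C_mul_vecPoly hd hg x'.1
  have hgd := degree_add_C_mul_vecPoly hd hg x.1
  set g := g₀ + C (p : ℤ_[p]) * vecPoly x.1 with hgdef
  set g' := g₀ + C (p : ℤ_[p]) * vecPoly x'.1 with hgdef'
  have eg : g' - g = C (p : ℤ_[p]) * vecPoly x'.1 - C (p : ℤ_[p]) * vecPoly x.1 := by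
    rw [hgdef, hgdef']; ring
  have eL : C (p : ℤ_[p]) * vecPoly (factorMap H g₀ x') -
      C (p : ℤ_[p]) * vecPoly (factorMap H g₀ x) =
      g' * (H /ₘ g' + C (p : ℤ_[p]) * vecPoly x'.2) -
        g * (H /ₘ g + C (p : ℤ_[p]) * vecPoly x.2) := by
    rw [← e, ← e']; ring
  rw [eL, ← eg]
  constructor
  · intro h
    have hdeg : (g' - g).degree < g.degree := by
      rw [eg, ← mul_sub, ← vecPoly_sub, degree_C_mul PadicInt.prime_p.ne_zero, hgd]
      exact degree_vecPoly_lt _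
    have hco' : IsCoprime (g.map (PadicInt.toZMod (p := p)))
        ((H /ₘ g + C (p : ℤ_[p]) * vecPoly x.2).map PadicInt.toZMod) := by
      rw [hr, hgdef, map_add_C_mul]; exact hco
    have hgg : C (p : ℤ_[p]) ∣ g' - g := by rw [eg, ← mul_sub]; exact dvd_mul_right _ _
    have hhh : C (p : ℤ_[p]) ∣ (H /ₘ g' + C (p : ℤ_[p]) * vecPoly x'.2) -
        (H /ₘ g + C (p : ℤ_[p]) * vecPoly x.2) := by
      rw [C_dvd_iff_map_toZMod_eq_zero, Polynomial.map_sub, hr, hr', sub_self]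
    obtain ⟨h1, h2⟩ := C_pow_dvd_sub_of_mul hgm hdeg hgg hhh hco' k h
    refine ⟨h1, ?_⟩
    -- The second factor is `H /ₘ g + p v`, whose quotient also varies with `g`; that variation
    -- respects the congruence and can be subtracted.
    have h3 := dvd_sub h2 (C_pow_dvd_divByMonic_sub hgm hgm' H _ h1)
    convert h3 using 1
    ring
  · rintro ⟨h1, h2⟩
    have h3 := C_pow_dvd_divByMonic_sub hgm hgm' H _ h1
    have : g' * (H /ₘ g' + C (p : ℤ_[p]) * vecPoly x'.2) -
        g * (H /ₘ g + C (p : ℤ_[p]) * vecPoly x.2) =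
        (g' - g) * (H /ₘ g' + C (p : ℤ_[p]) * vecPoly x'.2) + g * ((H /ₘ g' - H /ₘ g) +
          (C (p : ℤ_[p]) * vecPoly x'.2 - C (p : ℤ_[p]) * vecPoly x.2)) := by ring
    rw [this]
    exact dvd_add (h1.mul_right _) ((dvd_add h3 h2).mul_left _)

end FactorMap

/-! ### The distribution of the roots given the reduction modulo `p` -/

section Weights

variable {z : ℝ}

lemma integrable_pow_of_measurable {X : Type*} [MeasurableSpace X] {μ : Measure X}
    [IsFiniteMeasure μ] (hz : z ∈ Set.Icc (0 : ℝ) 1) {N : X → ℕ} (hN : Measurable N) :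
    Integrable (fun x => z ^ N x) μ := by
  refine Integrable.of_bound
    ((measurable_of_countable (fun k : ℕ => z ^ k)).comp hN).aestronglyMeasurable 1 ?_
  refine Filter.Eventually.of_forall fun x => ?_
  rw [Real.norm_of_nonneg (pow_nonneg hz.1 _)]
  exact pow_le_one₀ hz.1 hz.2

/-- The expectation of `z ^ N` for the number `N` of roots of a random monic polynomial of
degree `m` reducing to `X ^ m` modulo `p`. -/
def betaZ (p : ℕ) [Fact p.Prime] (z : ℝ) (m : ℕ) : ℝ :=
  ∫ u : Fin m → ℤ_[p], z ^ numIntRoots (X ^ m + C (p : ℤ_[p]) * vecPoly u) ∂haarZpPow p m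

/-- The product of the expectations attached to the roots of `f`. -/
def rootWeight (p : ℕ) [Fact p.Prime] (z : ℝ) (f : (ZMod p)[X]) : ℝ :=
  ∏ a : ZMod p, betaZ p z (f.rootMultiplicity a)

lemma numIntRoots_one : numIntRoots (1 : ℤ_[p][X]) = 0 := by
  simp [numIntRoots]

@[simp] lemma betaZ_zero : betaZ p z 0 = 1 := by
  simp [betaZ, numIntRoots_one]

lemma measurable_numIntRoots_add (H : ℤ_[p][X]) (c : ℤ_[p]) (s : ℕ) :
    Measurable fun L : Fin s → ℤ_[p] => numIntRoots (H + C c * vecPoly L) := by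
  refine measurable_numIntRoots (max (H.natDegree + 1) s) (fun L => ?_) fun i => ?_
  · refine (degree_add_le _ _).trans_lt (max_lt ?_ ?_)
    · refine degree_le_natDegree.trans_lt ?_
      exact_mod_cast (Nat.lt_succ_self _).trans_le (le_max_left _ _)
    · rw [← vecPoly_const_mul]
      refine (degree_vecPoly_lt _).trans_le ?_
      exact_mod_cast le_max_right _ _
  · simp only [coeff_add, coeff_C_mul, coeff_vecPoly]
    refine measurable_const.add (Measurable.const_mul ?_ _)
    split_ifs
    · exact measurable_pi_apply _
    · exact measurable_const

/-- The substitution `X ↦ X + a` acts on coefficient vectors with an inverse over `ℤ_[p]`, so it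
preserves measure and moves the cluster of roots near `a` to `0`. -/
lemma integral_translate (a : ℤ_[p]) (m : ℕ) (z : ℝ) :
    ∫ u : Fin m → ℤ_[p], z ^ numIntRoots ((X - C a) ^ m + C (p : ℤ_[p]) * vecPoly u)
      ∂haarZpPow p m = betaZ p z m := by
  let T : (Fin m → ℤ_[p]) → Fin m → ℤ_[p] := fun u i => ((vecPoly u).comp (X + C a)).coeff i
  have hT : ∀ u, vecPoly (T u) = (vecPoly u).comp (X + C a) := by
    intro u
    refine vecPoly_coeff_of_degree_lt ?_
    by_cases h0 : vecPoly u = 0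
    · rw [h0]; simp
    · have h1 : (vecPoly u).comp (X + C a) ≠ 0 := by
        rwa [Ne, comp_X_add_C_eq_zero_iff]
      have h2 := degree_vecPoly_lt u
      rw [degree_eq_natDegree h0] at h2
      rw [degree_eq_natDegree h1, natDegree_comp, natDegree_X_add_C, mul_one]
      exact h2
  have hmp : MeasurePreserving T (haarZpPow p m) (haarZpPow p m) := by
    refine measurePreserving_of_congr fun k x x' => ?_
    rw [mem_cyl_iff_C_dvd, mem_cyl_iff_C_dvd, hT, hT, ← sub_comp]
    constructor
    · rintro ⟨q, hq⟩
      refine ⟨q.comp (X - C a), ?_⟩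
      have := congrArg (fun f => f.comp (X - C a)) hq
      simpa [comp_assoc] using this
    · rintro ⟨q, hq⟩
      exact ⟨q.comp (X + C a), by rw [hq]; simp⟩
  conv_rhs => rw [betaZ, ← hmp.map_eq]
  rw [integral_map hmp.measurable.aemeasurable]
  · refine integral_congr_ae (Filter.Eventually.of_forall fun u => ?_)
    simp only
    rw [hT, ← numIntRoots_comp_add _ a]
    simp
  · exact ((measurable_of_countable (fun k : ℕ => z ^ k)).comp
      (measurable_numIntRoots_add _ _ m)).aestronglyMeasurable

lemma rootWeight_of_no_root {f : (ZMod p)[X]} (h : ∀ a, f.eval a ≠ 0) :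
    rootWeight p z f = 1 := by
  refine Finset.prod_eq_one fun a _ => ?_
  rw [rootMultiplicity_eq_zero (h a), betaZ_zero]

lemma rootMultiplicity_X_sub_C_pow_mul {a : ZMod p} {h : (ZMod p)[X]} (hh : h ≠ 0) (m : ℕ)
    (b : ZMod p) : ((X - C a) ^ m * h).rootMultiplicity b =
      (if b = a then m else 0) + h.rootMultiplicity b := by
  classical
  rw [← count_roots, ← count_roots, roots_mul (mul_ne_zero (pow_ne_zero _ (X_sub_C_ne_zero a)) hh),
    Multiset.count_add, roots_pow, roots_X_sub_C, Multiset.count_nsmul, Multiset.count_singleton]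
  split_ifs <;> simp

lemma rootWeight_mul {a : ZMod p} {h : (ZMod p)[X]} (ha : h.eval a ≠ 0) (m : ℕ) :
    rootWeight p z ((X - C a) ^ m * h) = betaZ p z m * rootWeight p z h := by
  have hh : h ≠ 0 := by rintro rfl; simp at ha
  simp only [rootWeight, rootMultiplicity_X_sub_C_pow_mul hh]
  rw [← Finset.mul_prod_erase _ _ (Finset.mem_univ a), ← Finset.mul_prod_erase _
    (fun b => betaZ p z (h.rootMultiplicity b)) (Finset.mem_univ a)]
  rw [if_pos rfl, rootMultiplicity_eq_zero ha, add_zero, betaZ_zero, one_mul]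
  congr 1
  refine Finset.prod_congr rfl fun b hb => ?_
  rw [if_neg (Finset.ne_of_mem_erase hb), zero_add]

lemma rootWeight_C_mul {c : ZMod p} (hc : c ≠ 0) (f : (ZMod p)[X]) :
    rootWeight p z (C c * f) = rootWeight p z f := by
  classical
  refine Finset.prod_congr rfl fun a _ => ?_
  rw [← count_roots, ← count_roots, roots_C_mul _ hc]

/-- A common root of the two factors would reduce to a common root of coprime polynomials, so the
root counts add. -/
lemma map_numIntRoots_factor {r s : ℕ} {H g₀ : ℤ_[p][X]} {h₀ : (ZMod p)[X]}
    (hd : g₀.natDegree = r) (hg : g₀.Monic)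
    (hH : H.map PadicInt.toZMod = g₀.map PadicInt.toZMod * h₀)
    (hco : IsCoprime (g₀.map PadicInt.toZMod) h₀) (hh : h₀ ≠ 0)
    (x : (Fin r → ℤ_[p]) × (Fin s → ℤ_[p])) :
    numIntRoots (H + C (p : ℤ_[p]) * vecPoly (factorMap H g₀ x)) =
      numIntRoots (g₀ + C (p : ℤ_[p]) * vecPoly x.1) +
      numIntRoots (H /ₘ (g₀ + C (p : ℤ_[p]) * vecPoly x.1) + C (p : ℤ_[p]) * vecPoly x.2) := by
  rw [factorMap_spec hd hg ⟨_, hH⟩ x]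
  have hr := map_divByMonic_add_C_mul hd hg hH x
  refine numIntRoots_mul (monic_add_C_mul_vecPoly hd hg x.1).ne_zero ?_ fun y hy hy' => ?_
  · intro h0
    rw [h0, Polynomial.map_zero] at hr
    exact hh hr.symm
  · have h1 := eval_map_toZMod (g₀ + C (p : ℤ_[p]) * vecPoly x.1) y
    have h2 := eval_map_toZMod (H /ₘ (g₀ + C (p : ℤ_[p]) * vecPoly x.1) +
      C (p : ℤ_[p]) * vecPoly x.2) y
    rw [hr, hy', map_zero] at h2
    rw [map_add_C_mul, hy, map_zero] at h1
    obtain ⟨a, b, hab⟩ := hco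
    have := congrArg (fun f => f.eval (PadicInt.toZMod y)) hab
    simp [h1, h2] at this

/-- Integration along the factorization `H + p L = (g₀ + p u) (H /ₘ (g₀ + p u) + p v)`. -/
lemma integral_factorMap {r s : ℕ} {H g₀ : ℤ_[p][X]} {h₀ : (ZMod p)[X]}
    (hd : g₀.natDegree = r) (hg : g₀.Monic)
    (hH : H.map PadicInt.toZMod = g₀.map PadicInt.toZMod * h₀)
    (hco : IsCoprime (g₀.map PadicInt.toZMod) h₀)
    {F : (Fin (r + s) → ℤ_[p]) → ℝ} (hF : Integrable F (haarZpPow p (r + s)))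
    {A : (Fin r → ℤ_[p]) → ℝ} {B : (Fin r → ℤ_[p]) → (Fin s → ℤ_[p]) → ℝ}
    (hFAB : ∀ u v, F (factorMap H g₀ (u, v)) = A u * B u v) {w : ℝ}
    (hB : ∀ u, ∫ v, B u v ∂haarZpPow p s = w) :
    ∫ L, F L ∂haarZpPow p (r + s) = (∫ u, A u ∂haarZpPow p r) * w := by
  have hmp := measurePreserving_factorMap (s := s) hd hg hH hco
  have hint : Integrable (fun x => F (factorMap H g₀ x))
      ((haarZpPow p r).prod (haarZpPow p s)) := hmp.integrable_comp_of_integrable hF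
  have h1 : ∫ L, F L ∂haarZpPow p (r + s) =
      ∫ x, F (factorMap H g₀ x) ∂(haarZpPow p r).prod (haarZpPow p s) := by
    conv_lhs => rw [← hmp.map_eq]
    refine integral_map hmp.measurable.aemeasurable ?_
    rw [hmp.map_eq]
    exact hF.aestronglyMeasurable
  rw [h1, integral_prod _ hint, ← integral_mul_const]
  refine integral_congr_ae (Filter.Eventually.of_forall fun u => ?_)
  simp only [hFAB]
  rw [integral_const_mul, hB]

lemma isCoprime_X_sub_C_pow {a : ZMod p} {h : (ZMod p)[X]} (ha : h.eval a ≠ 0) (m : ℕ) :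
    IsCoprime ((X - C a) ^ m) h := by
  refine IsCoprime.pow_left ?_
  rw [(irreducible_X_sub_C a).coprime_iff_not_dvd, dvd_iff_isRoot]
  exact ha

/-- The distribution of the number of roots in a residue class depends only on the root
multiplicities of the reduction. -/
theorem integral_pow_numIntRoots (hz : z ∈ Set.Icc (0 : ℝ) 1) (s : ℕ) (H : ℤ_[p][X])
    (hH : H.map (PadicInt.toZMod (p := p)) ≠ 0)
    (hs : (H.map (PadicInt.toZMod (p := p))).roots.card ≤ s) :
    ∫ L : Fin s → ℤ_[p], z ^ numIntRoots (H + C (p : ℤ_[p]) * vecPoly L) ∂haarZpPow p s =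
      rootWeight p z (H.map PadicInt.toZMod) := by
  classical
  -- Each step splits off one root `a` of the reduction with its full multiplicity. `H` and `s` are
  -- generalized because the hypothesis is applied to the quotient, which depends on `u`, with fewer
  -- free coefficients.
  induction hn : (H.map (PadicInt.toZMod (p := p))).roots.card using Nat.strong_induction_on
    generalizing s H with
  | _ n ih =>
    by_cases hroot : ∃ a, (H.map (PadicInt.toZMod (p := p))).eval a = 0
    · obtain ⟨a, ha⟩ := hroot
      set m := (H.map (PadicInt.toZMod (p := p))).rootMultiplicity a with hm
      have hmpos : 0 < m := (rootMultiplicity_pos hH).2 ha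
      obtain ⟨h₀, hfac, hnd⟩ := exists_eq_pow_rootMultiplicity_mul_and_not_dvd _ hH a
      rw [← hm] at hfac
      have hh₀ : h₀ ≠ 0 := by rintro rfl; simp at hnd
      have hha : h₀.eval a ≠ 0 := fun h => hnd (dvd_iff_isRoot.2 h)
      have hcard : (H.map (PadicInt.toZMod (p := p))).roots.card = m + h₀.roots.card := by
        rw [hfac, roots_mul (hfac ▸ hH), Multiset.card_add, roots_pow, roots_X_sub_C]
        simp
      obtain ⟨k, rfl⟩ : ∃ k, s = m + k := ⟨s - m, by omega⟩
      set g₀ : ℤ_[p][X] := (X - C (a.val : ℤ_[p])) ^ m with hg₀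
      have hgmap : g₀.map (PadicInt.toZMod (p := p)) = (X - C a) ^ m := by
        simp [hg₀]
      have hgm : g₀.Monic := (monic_X_sub_C _).pow m
      have hgd : g₀.natDegree = m := by
        rw [hg₀, natDegree_pow, natDegree_X_sub_C, mul_one]
      have hH' : H.map PadicInt.toZMod = g₀.map PadicInt.toZMod * h₀ := by rw [hgmap]; exact hfac
      have hco : IsCoprime (g₀.map PadicInt.toZMod) h₀ := by
        rw [hgmap]; exact isCoprime_X_sub_C_pow hha m
      rw [integral_factorMap (s := k) hgd hgm hH' hco
        (A := fun u => z ^ numIntRoots (g₀ + C (p : ℤ_[p]) * vecPoly u))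
        (B := fun u v => z ^ numIntRoots
          (H /ₘ (g₀ + C (p : ℤ_[p]) * vecPoly u) + C (p : ℤ_[p]) * vecPoly v))
        (w := rootWeight p z h₀)
        (integrable_pow_of_measurable hz (measurable_numIntRoots_add _ _ _))]
      · rw [hfac, rootWeight_mul hha, integral_translate]
      · intro u v
        rw [map_numIntRoots_factor hgd hgm hH' hco hh₀ (u, v), pow_add]
      · intro u
        have hq : (H /ₘ (g₀ + C (p : ℤ_[p]) * vecPoly u)).map (PadicInt.toZMod (p := p)) = h₀ := by
          rw [map_divByMonic _ (monic_add_C_mul_vecPoly hgd hgm u), map_add_C_mul, hH',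
            mul_divByMonic_cancel_left _ (hgm.map _)]
        have := ih h₀.roots.card (by omega) k (H /ₘ (g₀ + C (p : ℤ_[p]) * vecPoly u))
          (by rwa [hq]) (by rw [hq]; omega) (by rw [hq])
        rw [this, hq]
    -- If the reduction has no root in `𝔽_p`, no lift has a root in `ℤ_[p]`, and both sides are `1`.
    · push Not at hroot
      rw [rootWeight_of_no_root hroot]
      have : ∀ L : Fin s → ℤ_[p], numIntRoots (H + C (p : ℤ_[p]) * vecPoly L) = 0 := by
        intro L
        have hne : H + C (p : ℤ_[p]) * vecPoly L ≠ 0 := by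
          intro h
          have := map_add_C_mul H (vecPoly L)
          rw [h, Polynomial.map_zero] at this
          exact hH this.symm
        rw [numIntRoots_eq_ncard hne, Set.ncard_eq_zero (finite_int_roots hne)]
        refine Set.eq_empty_of_forall_notMem fun y hy => hroot (PadicInt.toZMod y) ?_
        have h1 := eval_map_toZMod (H + C (p : ℤ_[p]) * vecPoly L) y
        rw [map_add_C_mul, show (H + C (p : ℤ_[p]) * vecPoly L).eval y = 0 from hy, map_zero] at h1
        exact h1
      simp only [this, pow_zero]
      simp

end Weights

end PadicRoots

end

/-! ### Weighted counts of polynomials over `𝔽_p` -/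

noncomputable section

namespace PadicRoots

open scoped ENNReal

variable {p : ℕ} [Fact p.Prime] {z : ℝ}

/-- The expectation of `z ^ N` for the number `N` of roots of a random monic polynomial. -/
def alphaZ (p : ℕ) [Fact p.Prime] (z : ℝ) (n : ℕ) : ℝ :=
  ∫ a : Fin n → ℤ_[p], z ^ numIntRoots (X ^ n + vecPoly a) ∂haarZpPow p n

/-- The expectation of `z ^ N` for the number `N` of roots of a random polynomial. -/
def rhoZ (p : ℕ) [Fact p.Prime] (z : ℝ) (n : ℕ) : ℝ :=
  ∫ a : Fin (n + 1) → ℤ_[p], z ^ numRoots p (vecPoly a) ∂haarZpPow p (n + 1)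

/-- The sum of the weights of the monic polynomials of degree `n` over `𝔽_p`. -/
def monicWeight (p : ℕ) [Fact p.Prime] (z : ℝ) (n : ℕ) : ℝ :=
  ∑ c : Fin n → ZMod p, rootWeight p z (X ^ n + vecPoly c)

/-- Average over the `p ^ n` equally likely reductions, each contributing its root weight. -/
theorem alphaZ_eq (hz : z ∈ Set.Icc (0 : ℝ) 1) (n : ℕ) :
    alphaZ p z n = ((p : ℝ) ^ n)⁻¹ * monicWeight p z n := by
  rw [alphaZ, integral_haarZpPow_resMap
    (integrable_pow_of_measurable hz (show Measurable fun a : Fin n → ℤ_[p] =>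
      numIntRoots (X ^ n + vecPoly a) from measurable_numIntRoots_monicPoly n)), monicWeight]
  congr 1
  refine Finset.sum_congr rfl fun c _ => ?_
  have hmap : (X ^ n + vecPoly (liftVec c) : ℤ_[p][X]).map (PadicInt.toZMod (p := p)) =
      X ^ n + vecPoly c := by
    rw [Polynomial.map_add, vecPoly_liftVec_map, Polynomial.map_pow, map_X]
  have := integral_pow_numIntRoots (p := p) hz n (X ^ n + vecPoly (liftVec c))
    (by rw [hmap]; exact (monic_X_pow_add_vecPoly c).ne_zero)
    (by rw [hmap]; exact (card_roots' _).trans_eq (natDegree_X_pow_add_vecPoly c))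
  rw [hmap] at this
  rw [← this]
  simp only [vecPoly_resMap, add_assoc]

lemma alphaZ_eq' (hz : z ∈ Set.Icc (0 : ℝ) 1) (n : ℕ) :
    monicWeight p z n = (p : ℝ) ^ n * alphaZ p z n := by
  have := (prime_pos_real (p := p)).ne'
  rw [alphaZ_eq hz]
  field_simp

lemma vecPoly_snoc {R : Type*} [CommRing R] {m : ℕ} (c : Fin m → R) (a : R) :
    vecPoly (Fin.snoc c a : Fin (m + 1) → R) = vecPoly c + C a * X ^ m := by
  simp [vecPoly, Fin.sum_univ_castSucc]

open Classical in
/-- Summation over the nonzero polynomials of degree less than `m` over `𝔽_p`. -/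
lemma sum_rootWeight (G : ℕ → ℝ) (m : ℕ) :
    ∑ c : Fin m → ZMod p, (if c = 0 then 0 else
      G (vecPoly c).natDegree * rootWeight p z (vecPoly c)) =
      (p - 1) * ∑ r ∈ Finset.range m, G r * monicWeight p z r := by
  induction m with
  | zero => exact (Finset.sum_eq_zero fun c _ => if_pos (Subsingleton.elim _ _)).trans (by simp)
  | succ m ih =>
    -- Split according to the coefficient of `X ^ m`: zero leaves the sum for `m`, and each of the
    -- `p - 1` nonzero values gives scalar multiples of the monic polynomials of degree `m`, with
    -- the same weights.
    rw [Finset.sum_range_succ, mul_add, ← ih,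
      ← (Fin.snocEquiv fun _ => ZMod p).sum_comp, Fintype.sum_prod_type,
      ← Finset.add_sum_erase _ _ (Finset.mem_univ (0 : ZMod p))]
    congr 1
    · refine Finset.sum_congr rfl fun c _ => ?_
      have hs : (Fin.snocEquiv fun _ => ZMod p) (0, c) = (Fin.snoc c 0 : Fin (m + 1) → ZMod p) :=
        rfl
      have h0 : (Fin.snoc c 0 : Fin (m + 1) → ZMod p) = 0 ↔ c = 0 := by
        rw [← vecPoly_eq_zero_iff, vecPoly_snoc, C_0, zero_mul, add_zero, vecPoly_eq_zero_iff]
      rw [hs]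
      simp only [h0, vecPoly_snoc, C_0, zero_mul, add_zero]
    · have key : ∀ a ∈ (Finset.univ : Finset (ZMod p)).erase 0,
          ∑ c : Fin m → ZMod p, (if (Fin.snocEquiv fun _ => ZMod p) (a, c) = 0 then 0 else
            G (vecPoly ((Fin.snocEquiv fun _ => ZMod p) (a, c))).natDegree *
              rootWeight p z (vecPoly ((Fin.snocEquiv fun _ => ZMod p) (a, c)))) =
          G m * monicWeight p z m := by
        intro a ha
        have ha0 : a ≠ 0 := Finset.ne_of_mem_erase ha
        let e : (Fin m → ZMod p) ≃ (Fin m → ZMod p) :=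
          Equiv.piCongrRight fun _ => Equiv.mulLeft₀ a ha0
        rw [← e.sum_comp, monicWeight, Finset.mul_sum]
        refine Finset.sum_congr rfl fun c _ => ?_
        have hp : vecPoly ((Fin.snocEquiv fun _ => ZMod p) (a, e c)) =
            C a * (X ^ m + vecPoly c) := by
          have h1 : (Fin.snocEquiv fun _ => ZMod p) (a, e c) =
            (Fin.snoc (e c) a : Fin (m + 1) → ZMod p) := rfl
          have h2 : vecPoly (e c) = C a * vecPoly c := by
            rw [← vecPoly_const_mul]; rfl
          rw [h1, vecPoly_snoc, h2]; ring
        have hm := monic_X_pow_add_vecPoly c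
        have hne : (Fin.snocEquiv fun _ => ZMod p) (a, e c) ≠ 0 := by
          intro h
          rw [h] at hp
          rw [show vecPoly (0 : Fin (m + 1) → ZMod p) = 0 from vecPoly_zero] at hp
          exact mul_ne_zero (C_ne_zero.2 ha0) hm.ne_zero hp.symm
        rw [if_neg hne, hp, rootWeight_C_mul ha0, natDegree_C_mul ha0,
          natDegree_X_pow_add_vecPoly]
      rw [Finset.sum_congr rfl key, Finset.sum_const, Finset.card_erase_of_mem (Finset.mem_univ _),
        Finset.card_univ, ZMod.card, nsmul_eq_mul, Nat.cast_sub (Fact.out : p.Prime).one_le,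
        Nat.cast_one]

/-! ### From `β` to `α` by dividing out powers of `p` -/

section Beta

lemma integral_haarZpPow_add_symm {m n : ℕ} {F : (Fin (m + n) → ℤ_[p]) → ℝ}
    (hF : Integrable F (haarZpPow p (m + n))) :
    ∫ x, F x ∂haarZpPow p (m + n) =
      ∫ b, ∫ a, F (Fin.append a b) ∂haarZpPow p m ∂haarZpPow p n := by
  rw [integral_haarZpPow_add hF]
  exact integral_integral_swap
    ((measurePreserving_append (p := p) m n).integrable_comp_of_integrable hF)

/-- The polynomial `∑ i < n, p ^ (i + 1 - m) xᵢ Xⁱ + p ^ (n - m) Xⁿ` (truncated subtraction). -/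
def scaledPoly (m n : ℕ) (x : Fin n → ℤ_[p]) : ℤ_[p][X] :=
  C ((p : ℤ_[p]) ^ (n - m)) * X ^ n +
    vecPoly fun i : Fin n => (p : ℤ_[p]) ^ ((i : ℕ) + 1 - m) * x i

/-- The expectation of `z ^ N` for the number `N` of roots of a random `scaledPoly m n`. -/
def gammaZ (p : ℕ) [Fact p.Prime] (z : ℝ) (m n : ℕ) : ℝ :=
  ∫ x : Fin n → ℤ_[p], z ^ numIntRoots (scaledPoly m n x) ∂haarZpPow p n

lemma measurable_numIntRoots_scaledPoly (m n : ℕ) :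
    Measurable fun x : Fin n → ℤ_[p] => numIntRoots (scaledPoly m n x) := by
  refine measurable_numIntRoots (n + 1) (fun x => ?_) fun i => ?_
  · refine (degree_add_le _ _).trans_lt (max_lt ?_ ?_)
    · refine (degree_C_mul_X_pow_le _ _).trans_lt ?_
      exact_mod_cast n.lt_succ_self
    · refine (degree_vecPoly_lt _).trans_le ?_
      exact_mod_cast n.le_succ
  · simp only [scaledPoly, coeff_add, coeff_vecPoly]
    refine measurable_const.add ?_
    split_ifs
    · exact (measurable_pi_apply _).const_mul _
    · exact measurable_const

lemma gammaZ_self (n : ℕ) : gammaZ p z n n = alphaZ p z n := by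
  refine integral_congr_ae (Filter.Eventually.of_forall fun x => ?_)
  have : ∀ i : Fin n, (i : ℕ) + 1 - n = 0 := fun i => by have := i.2; omega
  simp [scaledPoly, this]

/-- All integral roots of a polynomial congruent to `X ^ n` are divisible by `p`, so substituting `p
X` for `X` loses none. -/
lemma gammaZ_zero (n : ℕ) : gammaZ p z 0 n = betaZ p z n := by
  refine integral_congr_ae (Filter.Eventually.of_forall fun x => ?_)
  have hm : (X ^ n + C (p : ℤ_[p]) * vecPoly x).Monic := by
    rw [← vecPoly_const_mul]; exact monic_X_pow_add_vecPoly _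
  have : scaledPoly 0 n x = (X ^ n + C (p : ℤ_[p]) * vecPoly x).comp (C (p : ℤ_[p]) * X) := by
    simp only [scaledPoly, vecPoly, add_comp, Polynomial.mul_comp, Polynomial.sum_comp, X_pow_comp, C_comp,
      mul_pow, Finset.mul_sum, Nat.sub_zero, C_mul, C_pow]
    congr 1
    refine Finset.sum_congr rfl fun i _ => ?_
    ring
  simp only [this]
  rw [numIntRoots_comp_mul_prime hm.ne_zero]
  intro y hy
  rw [eval_add, eval_pow, eval_X, eval_mul, eval_C] at hy
  have : (p : ℤ_[p]) ∣ y ^ n := by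
    rw [eq_neg_of_add_eq_zero_left hy]
    exact (dvd_mul_right _ _).neg_right
  exact PadicInt.prime_p.dvd_of_dvd_pow this

lemma scaledPoly_append {m k : ℕ} (a c : Fin m → ℤ_[p]) (b : Fin k → ℤ_[p]) :
    scaledPoly m (m + k) (Fin.append (c + fun i => (p : ℤ_[p]) * a i) b) =
      scaledPoly m (m + k) (Fin.append c b) + C (p : ℤ_[p]) * vecPoly a := by
  have h0 : ∀ i : Fin m, (i : ℕ) + 1 - m = 0 := fun i => by have := i.2; omega
  simp only [scaledPoly, vecPoly, Fin.sum_univ_add, Fin.append_left, Fin.append_right,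
    Fin.val_castAdd, Fin.val_natAdd, h0, pow_zero, C_1, one_mul, Pi.add_apply, C_add, C_mul, add_mul,
    Finset.sum_add_distrib, Finset.mul_sum, mul_assoc]
  ring

/-- At level `m` every coefficient of index at least `m` carries a factor `p`. If the lower ones do
too, cancelling one `p` frees the coefficient of index `m` and raises the level by one. -/
lemma scaledPoly_mul_prime {m k : ℕ} (a : Fin m → ℤ_[p]) (b : Fin (k + 1) → ℤ_[p]) :
    scaledPoly m (m + (k + 1)) (Fin.append (fun i => (p : ℤ_[p]) * a i) b) =
      C (p : ℤ_[p]) * scaledPoly (m + 1) (m + (k + 1)) (Fin.append a b) := by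
  rw [scaledPoly, scaledPoly, mul_add, ← vecPoly_const_mul, ← mul_assoc, ← C_mul, ← pow_succ']
  congr 4
  · omega
  · funext i
    induction i using Fin.addCases with
    | left i =>
      have h0 : (i : ℕ) + 1 - m = 0 := by have := i.2; omega
      have h1 : (i : ℕ) + 1 - (m + 1) = 0 := by have := i.2; omega
      simp [h0]
    | right i =>
      have h0 : m + (i : ℕ) + 1 - m = i + 1 := by omega
      have h1 : m + (i : ℕ) + 1 - (m + 1) = i := by omega
      simp only [Fin.append_right, Fin.val_natAdd, h0, h1]
      ring

lemma map_scaledPoly {m k : ℕ} (c : Fin m → ZMod p) (b : Fin (k + 1) → ℤ_[p]) :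
    (scaledPoly m (m + (k + 1)) (Fin.append (liftVec c) b)).map (PadicInt.toZMod (p := p)) =
      vecPoly c := by
  have h0 : ∀ i : Fin m, (i : ℕ) + 1 - m = 0 := fun i => by have := i.2; omega
  have h1 : ∀ i : Fin (k + 1), m + (i : ℕ) + 1 - m = i + 1 := fun i => by omega
  have h2 : m + (k + 1) - m = k + 1 := by omega
  simp [scaledPoly, vecPoly, Fin.sum_univ_add, h0, h1, h2, liftVec, Polynomial.map_sum]

/-- Condition on the reduction of the `m` low coefficients, which determines the whole reduction. If
it is zero, divide by `p` and pass to level `m + 1`; otherwise it is a nonzero polynomial of degree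
less than `m` and contributes its root weight. -/
theorem gammaZ_step (hz : z ∈ Set.Icc (0 : ℝ) 1) {m n : ℕ} (hmn : m < n) :
    gammaZ p z m n = ((p : ℝ) ^ m)⁻¹ *
      (gammaZ p z (m + 1) n + (p - 1) * ∑ r ∈ Finset.range m, monicWeight p z r) := by
  classical
  obtain ⟨k, rfl⟩ : ∃ k, n = m + (k + 1) := ⟨n - m - 1, by omega⟩
  have hint : ∀ j, Integrable (fun x : Fin (m + (k + 1)) → ℤ_[p] =>
      z ^ numIntRoots (scaledPoly j (m + (k + 1)) x)) (haarZpPow p (m + (k + 1))) :=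
    fun j => integrable_pow_of_measurable hz (measurable_numIntRoots_scaledPoly _ _)
  have hmeas : ∀ (j) (b : Fin (k + 1) → ℤ_[p]), Measurable fun a : Fin m → ℤ_[p] =>
      numIntRoots (scaledPoly j (m + (k + 1)) (Fin.append a b)) := by
    intro j b
    refine (measurable_numIntRoots_scaledPoly _ _).comp ?_
    exact (measurePreserving_append (p := p) m (k + 1)).measurable.comp measurable_prodMk_right
  have hS := sum_rootWeight (p := p) (z := z) (fun _ => 1) m
  simp only [one_mul] at hS
  rw [← hS, gammaZ, integral_haarZpPow_add_symm (hint m)]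
  have inner : ∀ b : Fin (k + 1) → ℤ_[p],
      ∫ a, z ^ numIntRoots (scaledPoly m (m + (k + 1)) (Fin.append a b)) ∂haarZpPow p m =
      ((p : ℝ) ^ m)⁻¹ *
        ((∫ a, z ^ numIntRoots (scaledPoly (m + 1) (m + (k + 1)) (Fin.append a b))
          ∂haarZpPow p m) +
          ∑ c : Fin m → ZMod p, (if c = 0 then 0 else rootWeight p z (vecPoly c))) := by
    intro b
    rw [integral_haarZpPow_resMap (integrable_pow_of_measurable hz (hmeas m b))]
    congr 1
    rw [← Finset.add_sum_erase _ _ (Finset.mem_univ (0 : Fin m → ZMod p)),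
      ← Finset.add_sum_erase _ (fun c : Fin m → ZMod p =>
        if c = 0 then 0 else rootWeight p z (vecPoly c)) (Finset.mem_univ (0 : Fin m → ZMod p)),
      if_pos rfl, zero_add]
    congr 1
    · refine integral_congr_ae (Filter.Eventually.of_forall fun a => ?_)
      have : resMap (0 : Fin m → ZMod p) a = fun i => (p : ℤ_[p]) * a i := by
        funext i; simp [resMap]
      simp only [this]
      rw [scaledPoly_mul_prime, numIntRoots_const_mul PadicInt.prime_p.ne_zero]
    · refine Finset.sum_congr rfl fun c hc => ?_
      have hc0 : c ≠ 0 := Finset.ne_of_mem_erase hc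
      rw [if_neg hc0]
      have hmap := map_scaledPoly c b
      have hne : vecPoly c ≠ 0 := fun h => hc0 (vecPoly_eq_zero_iff.1 h)
      have := integral_pow_numIntRoots (p := p) hz m
        (scaledPoly m (m + (k + 1)) (Fin.append (liftVec c) b)) (by rwa [hmap]) (by
          rw [hmap]
          refine (card_roots' _).trans ?_
          have := degree_vecPoly_lt c
          rw [degree_eq_natDegree hne] at this
          exact_mod_cast this.le)
      rw [hmap] at this
      rw [← this]
      refine integral_congr_ae (Filter.Eventually.of_forall fun a => ?_)
      simp only
      rw [← scaledPoly_append]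
      rfl
  have hint2 : Integrable (fun b : Fin (k + 1) → ℤ_[p] =>
      ∫ a, z ^ numIntRoots (scaledPoly (m + 1) (m + (k + 1)) (Fin.append a b)) ∂haarZpPow p m)
      (haarZpPow p (k + 1)) := by
    have := (measurePreserving_append (p := p) m (k + 1)).integrable_comp_of_integrable
      (hint (m + 1))
    exact this.integral_prod_right
  simp only [inner]
  rw [integral_const_mul, integral_add hint2 (integrable_const _), integral_const, gammaZ,
    integral_haarZpPow_add_symm (hint (m + 1))]
  simp

/-- Iteration of `gammaZ_step` from level `0` to level `n`; the factors `p ^ (-m)` accumulate to the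
binomial exponents. -/
theorem betaZ_eq (hz : z ∈ Set.Icc (0 : ℝ) 1) (n : ℕ) :
    betaZ p z n = ((p : ℝ) ^ n.choose 2)⁻¹ * alphaZ p z n +
      ∑ m ∈ Finset.range n, ((p : ℝ) ^ (m + 1).choose 2)⁻¹ *
        ((p - 1) * ∑ r ∈ Finset.range m, (p : ℝ) ^ r * alphaZ p z r) := by
  have key : ∀ j ≤ n, betaZ p z n = ((p : ℝ) ^ j.choose 2)⁻¹ * gammaZ p z j n +
      ∑ m ∈ Finset.range j, ((p : ℝ) ^ (m + 1).choose 2)⁻¹ *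
        ((p - 1) * ∑ r ∈ Finset.range m, (p : ℝ) ^ r * alphaZ p z r) := by
    intro j hj
    induction j with
    | zero => simp [gammaZ_zero]
    | succ j ih =>
      rw [ih (by omega), gammaZ_step hz (by omega : j < n), Finset.sum_range_succ,
        Nat.choose_succ_succ' j 1, Nat.choose_one_right, pow_add]
      simp only [alphaZ_eq' hz]
      rw [mul_inv]
      ring
  rw [key n le_rfl, gammaZ_self]

end Beta

end PadicRoots

end

noncomputable section

namespace PadicRoots

open scoped ENNReal

variable {p : ℕ} [Fact p.Prime] {z : ℝ}

/-! ### Reversal of polynomials -/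

section Reflect

lemma aeval_reflect_eq_zero_iff {f : ℤ_[p][X]} {N : ℕ} (hN : f.natDegree ≤ N) {x : ℚ_[p]}
    (hx : x ≠ 0) : (reflect N f).aeval x⁻¹ = 0 ↔ f.aeval x = 0 := by
  let _ := invertibleOfNonzero hx
  have := eval₂_reflect_eq_zero_iff (algebraMap ℤ_[p] ℚ_[p]) x N f hN
  rwa [invOf_eq_inv] at this

lemma aeval_zero_ne_zero {f : ℤ_[p][X]} (h : f.coeff 0 ≠ 0) : f.aeval (0 : ℚ_[p]) ≠ 0 := by
  have := aeval_coe f 0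
  rw [PadicInt.coe_zero] at this
  rw [this, ← coeff_zero_eq_eval_zero]
  exact PadicInt.coe_ne_zero.2 h

lemma numRoots_reflect {f : ℤ_[p][X]} {N : ℕ} (hN : f.natDegree ≤ N) (h0 : f.coeff 0 ≠ 0)
    (h1 : f.coeff N ≠ 0) : numRoots p (reflect N f) = numRoots p f := by
  have hf : f ≠ 0 := by rintro rfl; simp at h0
  have hr0 : (reflect N f).coeff 0 ≠ 0 := by rwa [coeff_reflect, revAt_zero]
  rw [numRoots_eq_ncard hf, numRoots_eq_ncard (by rwa [Ne, reflect_eq_zero_iff])]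
  symm
  have hne : ∀ {g : ℤ_[p][X]}, g.coeff 0 ≠ 0 → ∀ x : ℚ_[p], g.aeval x = 0 → x ≠ 0 := by
    rintro g hg x hx rfl
    exact aeval_zero_ne_zero hg hx
  refine Set.ncard_congr (fun x _ => x⁻¹) ?_ ?_ ?_
  · intro x hx
    exact (aeval_reflect_eq_zero_iff hN (hne h0 x hx)).2 hx
  · intro a b _ _ hab
    exact inv_injective hab
  · intro y hy
    have hy0 : y ≠ 0 := hne hr0 y hy
    refine ⟨y⁻¹, ?_, inv_inv y⟩
    have := (aeval_reflect_eq_zero_iff hN (inv_ne_zero hy0)).1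
    rw [inv_inv] at this
    exact this hy

lemma reflect_vecPoly {R : Type*} [CommRing R] {n : ℕ} (v : Fin (n + 1) → R) :
    reflect n (vecPoly v) = vecPoly fun i => v i.rev := by
  ext j
  rw [coeff_reflect, coeff_vecPoly, coeff_vecPoly]
  by_cases hj : j ≤ n
  · rw [revAt_le hj, dif_pos (by omega), dif_pos (by omega)]
    congr 1
    ext
    simp
  · rw [revAt_eq_self_of_lt (by omega), dif_neg (by omega), dif_neg (by omega)]

lemma natDegree_vecPoly_succ_le {R : Type*} [CommRing R] {n : ℕ} (v : Fin (n + 1) → R) :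
    (vecPoly v).natDegree ≤ n :=
  natDegree_le_of_degree_le (Order.le_of_lt_succ (by
    have := degree_vecPoly_lt v
    exact_mod_cast this))

lemma measurePreserving_rev (n : ℕ) :
    MeasurePreserving (fun (v : Fin n → ℤ_[p]) (i : Fin n) => v i.rev) (haarZpPow p n)
      (haarZpPow p n) := by
  refine measurePreserving_of_congr fun k x x' => ?_
  simp only [cyl, Set.mem_ofPred_eq]
  exact ⟨fun h i => by simpa using h i.rev, fun h i => h i.rev⟩

end Reflect

/-! ### Coordinate hyperplanes are null -/

section Null

lemma measure_coord_eq_zero {n : ℕ} (i : Fin n) :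
    haarZpPow p n {u | u i = 0} = 0 := by
  have h1 : haarZp p {0} = 0 := by
    have h2 : ∀ k, (haarZpPow p 1).real {0} ≤ ((p : ℝ)⁻¹) ^ k := by
      intro k
      have := real_haarZpPow_cyl (p := p) k (0 : Fin 1 → ℤ_[p])
      rw [mul_one, ← inv_pow] at this
      rw [← this]
      refine measureReal_mono ?_
      rw [Set.singleton_subset_iff]
      exact mem_cyl_self _ _
    have h3 : (haarZpPow p 1).real {0} = 0 := by
      refine le_antisymm (ge_of_tendsto' (tendsto_pow_atTop_nhds_zero_of_lt_one ?_ ?_) h2)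
        measureReal_nonneg
      · exact inv_nonneg.2 prime_pos_real.le
      · exact inv_lt_one_of_one_lt₀ (by exact_mod_cast (Fact.out : p.Prime).one_lt)
    rw [measureReal_eq_zero_iff] at h3
    have h4 : ({0} : Set (Fin 1 → ℤ_[p])) = Set.univ.pi fun _ => {0} := by
      ext x; simp [funext_iff]
    rw [h4, haarZpPow, Measure.pi_pi] at h3
    simpa using h3
  have := (measurePreserving_eval (fun _ : Fin n => haarZp p) i).measure_preimage
    (measurableSet_singleton (0 : ℤ_[p])).nullMeasurableSet
  rw [h1] at this
  exact this

end Null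

/-! ### Random polynomials that need not be monic -/

section Rho

lemma isUnit_of_toZMod_ne_zero {x : ℤ_[p]} (h : PadicInt.toZMod x ≠ 0) : IsUnit x := by
  by_contra hx
  rw [PadicInt.not_isUnit_iff, PadicInt.norm_lt_one_iff_dvd] at hx
  refine h ?_
  rw [← map_zero (PadicInt.toZMod (p := p)), toZMod_eq_iff, sub_zero]
  exact hx

lemma coeff_X_pow_add_vecPoly_self {R : Type*} [CommRing R] {k : ℕ} (v : Fin k → R) :
    (X ^ k + vecPoly v).coeff k = 1 := by
  rw [coeff_add, coeff_X_pow_self, coeff_vecPoly_of_le _ le_rfl, add_zero]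

/-- The reversal of a random monic polynomial reducing to `X ^ k`. -/
lemma integral_reflect (k : ℕ) :
    ∫ u : Fin k → ℤ_[p], z ^ numRoots p (reflect k (X ^ k + C (p : ℤ_[p]) * vecPoly u))
      ∂haarZpPow p k = betaZ p z k := by
  -- Reversal inverts the roots, so a root at `0` would be lost; almost surely there is none.
  have hae : ∀ᵐ u ∂haarZpPow p k, (X ^ k + C (p : ℤ_[p]) * vecPoly u).coeff 0 ≠ 0 := by
    rcases Nat.eq_zero_or_pos k with rfl | hk
    · refine Filter.Eventually.of_forall fun u => ?_
      simp
    · have : haarZpPow p k {u | u ⟨0, hk⟩ = 0} = 0 := measure_coord_eq_zero _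
      filter_upwards [compl_mem_ae_iff.2 this] with u hu
      have hu' : u ⟨0, hk⟩ ≠ 0 := hu
      rw [coeff_add, coeff_X_pow, if_neg hk.ne, zero_add, coeff_C_mul, coeff_vecPoly, dif_pos hk]
      exact mul_ne_zero PadicInt.prime_p.ne_zero hu'
  refine integral_congr_ae ?_
  filter_upwards [hae] with u hu
  rw [← vecPoly_const_mul] at hu ⊢
  rw [numRoots_reflect (natDegree_X_pow_add_vecPoly _).le hu
    (by rw [coeff_X_pow_add_vecPoly_self]; exact one_ne_zero),
    numRoots_eq_numIntRoots (monic_X_pow_add_vecPoly _)]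

lemma natDegree_le_of_reflect {R : Type*} [CommRing R] {k r : ℕ} {f : R[X]}
    (hf : f.natDegree ≤ r) : reflect (k + r) f = X ^ k * reflect r f := by
  have := reflect_mul (1 : R[X]) f (F := k) (G := r) (by simp) hf
  rwa [one_mul, reflect_one] at this

/-- The number of roots of a random polynomial with given nonzero reduction. -/
theorem integral_pow_numRoots (hz : z ∈ Set.Icc (0 : ℝ) 1) {n : ℕ} (c : Fin (n + 1) → ZMod p)
    (hc : c ≠ 0) :
    ∫ L : Fin (n + 1) → ℤ_[p], z ^ numRoots p (vecPoly (resMap c L)) ∂haarZpPow p (n + 1) =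
      betaZ p z (n - (vecPoly c).natDegree) * rootWeight p z (vecPoly c) := by
  have hc' : vecPoly c ≠ 0 := fun h => hc (vecPoly_eq_zero_iff.1 h)
  obtain ⟨r, hr⟩ : ∃ r, r = (vecPoly c).natDegree := ⟨_, rfl⟩
  have hrn : r ≤ n := hr ▸ natDegree_vecPoly_succ_le c
  rw [← hr]
  obtain ⟨k, rfl⟩ : ∃ k, n = k + r := ⟨n - r, by omega⟩
  rw [Nat.add_sub_cancel]
  -- pass to the reversed polynomial
  set H : ℤ_[p][X] := vecPoly (fun i : Fin (k + r + 1) => liftVec c i.rev) with hH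
  set h₀ : (ZMod p)[X] := reflect r (vecPoly c) with hh₀
  -- Reversal turns the `k` vanishing leading coefficients of the reduction into a root `0` of
  -- multiplicity `k`. The corresponding factor is monic, so `factorMap` applies to it.
  have hHmap : H.map (PadicInt.toZMod (p := p)) = X ^ k * h₀ := by
    rw [hH, ← reflect_vecPoly, ← reflect_map, vecPoly_liftVec_map, hh₀,
      natDegree_le_of_reflect hr.ge]
  have h00 : h₀.eval 0 ≠ 0 := by
    rw [← coeff_zero_eq_eval_zero, hh₀, coeff_reflect, revAt_zero]
    have := leadingCoeff_ne_zero.2 hc'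
    rwa [leadingCoeff, ← hr] at this
  have hh0 : h₀ ≠ 0 := by intro h; rw [h] at h00; simp at h00
  have hgm : (X ^ k : ℤ_[p][X]).Monic := monic_X_pow k
  have hgd : (X ^ k : ℤ_[p][X]).natDegree = k := natDegree_X_pow k
  have hH' : H.map PadicInt.toZMod = (X ^ k : ℤ_[p][X]).map PadicInt.toZMod * h₀ := by
    rw [hHmap, Polynomial.map_pow, map_X]
  have hco : IsCoprime ((X ^ k : ℤ_[p][X]).map PadicInt.toZMod) h₀ := by
    have := isCoprime_X_sub_C_pow h00 k
    rw [C_0, sub_zero] at this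
    rwa [Polynomial.map_pow, map_X]
  have hHd : H.natDegree ≤ k + r := natDegree_vecPoly_succ_le _
  have hqmap : ∀ u : Fin k → ℤ_[p],
      (H /ₘ (X ^ k + C (p : ℤ_[p]) * vecPoly u)).map (PadicInt.toZMod (p := p)) = h₀ := by
    intro u
    rw [map_divByMonic _ (monic_add_C_mul_vecPoly hgd hgm u), map_add_C_mul, hH',
      mul_divByMonic_cancel_left _ (hgm.map _)]
  have hqd : ∀ u : Fin k → ℤ_[p], (H /ₘ (X ^ k + C (p : ℤ_[p]) * vecPoly u)).natDegree ≤ r := by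
    intro u
    rw [natDegree_divByMonic _ (monic_add_C_mul_vecPoly hgd hgm u),
      natDegree_eq_of_degree_eq_some (degree_add_C_mul_vecPoly hgd hgm u)]
    omega
  have hmp := measurePreserving_rev (p := p) (k + r + 1)
  have hrev : ∀ L : Fin (k + r + 1) → ℤ_[p], vecPoly (resMap c fun i => L i.rev) =
      reflect (k + r) (H + C (p : ℤ_[p]) * vecPoly L) := by
    intro L
    rw [vecPoly_resMap, reflect_add, reflect_C_mul, hH, reflect_vecPoly, reflect_vecPoly]
    simp
  have hmeas : Measurable fun L : Fin (k + r + 1) → ℤ_[p] =>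
      numRoots p (vecPoly (resMap c L)) :=
    (measurable_numRoots_vecPoly _).comp (continuous_resMap c).measurable
  have h1 : ∫ L : Fin (k + r + 1) → ℤ_[p], z ^ numRoots p (vecPoly (resMap c L))
      ∂haarZpPow p (k + r + 1) = ∫ L : Fin (k + r + 1) → ℤ_[p],
        z ^ numRoots p (reflect (k + r) (H + C (p : ℤ_[p]) * vecPoly L))
          ∂haarZpPow p (k + r + 1) := by
    conv_lhs => rw [← hmp.map_eq]
    rw [integral_map hmp.measurable.aemeasurable]
    · simp only [hrev]
    · exact (integrable_pow_of_measurable hz hmeas).aestronglyMeasurable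
  have hint : Integrable (fun L : Fin (k + (r + 1)) → ℤ_[p] =>
      z ^ numRoots p (reflect (k + r) (H + C (p : ℤ_[p]) * vecPoly L)))
      (haarZpPow p (k + (r + 1))) := by
    refine integrable_pow_of_measurable hz ?_
    have := hmeas.comp hmp.measurable
    simp only [Function.comp_def, hrev] at this
    exact this
  rw [h1]
  have h2 := integral_factorMap (s := r + 1) hgd hgm hH' hco hint
    (A := fun u => z ^ numRoots p (reflect k (X ^ k + C (p : ℤ_[p]) * vecPoly u)))
    (B := fun u v => z ^ numIntRoots (reflect r (H /ₘ (X ^ k + C (p : ℤ_[p]) * vecPoly u)) +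
      C (p : ℤ_[p]) * vecPoly fun i : Fin (r + 1) => v i.rev))
    (w := rootWeight p z (vecPoly c)) ?_ ?_
  · rw [integral_reflect] at h2
    exact h2
  · intro u v
    have hgmu := monic_add_C_mul_vecPoly hgd hgm u
    have hgdu := degree_add_C_mul_vecPoly hgd hgm u
    have hmapq := map_divByMonic_add_C_mul hgd hgm hH' (u, v)
    rw [factorMap_spec hgd hgm ⟨_, hH'⟩ (u, v)]
    simp only at hmapq ⊢
    have hhd : (H /ₘ (X ^ k + C (p : ℤ_[p]) * vecPoly u) +
        C (p : ℤ_[p]) * vecPoly v).natDegree ≤ r := by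
      refine (natDegree_add_le _ _).trans (max_le (hqd u) ?_)
      rw [← vecPoly_const_mul]
      exact natDegree_vecPoly_succ_le _
    have hsum : reflect r (H /ₘ (X ^ k + C (p : ℤ_[p]) * vecPoly u)) +
        C (p : ℤ_[p]) * vecPoly (fun i : Fin (r + 1) => v i.rev) =
        reflect r (H /ₘ (X ^ k + C (p : ℤ_[p]) * vecPoly u) + C (p : ℤ_[p]) * vecPoly v) := by
      rw [reflect_add, reflect_C_mul, reflect_vecPoly]
    rw [hsum]
    set g := X ^ k + C (p : ℤ_[p]) * vecPoly u with hg
    set h := H /ₘ g + C (p : ℤ_[p]) * vecPoly v with hh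
    have hgnd : g.natDegree = k := natDegree_eq_of_degree_eq_some hgdu
    rw [reflect_mul g h hgnd.le hhd]
    have hgc : g.coeff k = 1 := by
      rw [← hgnd]; exact hgmu
    have hhc : PadicInt.toZMod (h.coeff 0) ≠ 0 := by
      rw [← coeff_map, hmapq, coeff_zero_eq_eval_zero]
      exact h00
    have hhu : IsUnit (reflect r h).leadingCoeff := by
      have hcr : (reflect r h).coeff r = h.coeff 0 := by
        rw [coeff_reflect, revAt_le le_rfl, Nat.sub_self]
      have hn : (reflect r h).natDegree = r := by
        refine le_antisymm ((natDegree_reflect_le).trans (max_le le_rfl hhd)) ?_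
        refine le_natDegree_of_ne_zero ?_
        rw [hcr]
        rintro h'
        rw [h', map_zero] at hhc
        exact hhc rfl
      rw [leadingCoeff, hn, hcr]
      exact isUnit_of_toZMod_ne_zero hhc
    have hhne : h ≠ 0 := by
      intro h'
      rw [h', coeff_zero, map_zero] at hhc
      exact hhc rfl
    rw [numRoots_mul (by rw [Ne, reflect_eq_zero_iff]; exact hgmu.ne_zero)
      (by rwa [Ne, reflect_eq_zero_iff]), pow_add, numRoots_eq_numIntRoots_of_isUnit hhu]
    -- The reversed `h` has unit leading coefficient, so its roots are integral; a root of the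
    -- reversed `g` is the inverse of an element of `p ℤ_[p]`, hence not integral.
    intro x hx hx'
    have hx1 : ‖x‖ ≤ 1 := by
      obtain ⟨b, hb⟩ := hhu.exists_left_inv
      refine norm_le_one_of_monic (f := C b * reflect r h) ?_ ?_
      · rw [Monic, leadingCoeff_mul, leadingCoeff_C, hb]
      · simp [hx']
    have hx0 : x ≠ 0 := by
      rintro rfl
      refine aeval_zero_ne_zero ?_ hx
      rw [coeff_reflect, revAt_zero, hgc]
      exact one_ne_zero
    have hgx : g.aeval x⁻¹ = 0 := by
      have := (aeval_reflect_eq_zero_iff hgnd.le (inv_ne_zero hx0)).1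
      rw [inv_inv] at this
      exact this hx
    obtain ⟨y, hy⟩ : ∃ y : ℤ_[p], (y : ℚ_[p]) = x⁻¹ :=
      ⟨⟨x⁻¹, norm_le_one_of_monic hgmu hgx⟩, rfl⟩
    rw [← hy, aeval_coe, PadicInt.coe_eq_zero] at hgx
    have h5 := eval_map_toZMod g y
    rw [hgx, map_zero, hg, map_add_C_mul, Polynomial.map_pow, map_X, eval_pow, eval_X] at h5
    have h6 : PadicInt.toZMod y = 0 := eq_zero_of_pow_eq_zero h5
    have h7 : ‖y‖ < 1 := by
      rw [PadicInt.norm_lt_one_iff_dvd, ← sub_zero y, ← toZMod_eq_iff, h6, map_zero]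
    rw [PadicInt.norm_def, hy, norm_inv] at h7
    have h8 : 0 < ‖x‖ := norm_pos_iff.2 hx0
    have := (inv_lt_one₀ h8).1 h7
    linarith
  · intro u
    have hmp' := measurePreserving_rev (p := p) (r + 1)
    have hmap : (reflect r (H /ₘ (X ^ k + C (p : ℤ_[p]) * vecPoly u))).map
        (PadicInt.toZMod (p := p)) = vecPoly c := by
      rw [← reflect_map, hqmap, hh₀, reflect_reflect]
    have := integral_pow_numIntRoots (p := p) hz (r + 1)
      (reflect r (H /ₘ (X ^ k + C (p : ℤ_[p]) * vecPoly u))) (by rwa [hmap])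
      (by rw [hmap]; exact (card_roots' _).trans (by omega))
    rw [hmap] at this
    rw [← this]
    conv_rhs => rw [← hmp'.map_eq]
    rw [integral_map hmp'.measurable.aemeasurable]
    exact ((measurable_of_countable (fun k : ℕ => z ^ k)).comp
      (measurable_numIntRoots_add _ _ _)).aestronglyMeasurable

/-- Average over the reductions. A zero reduction reproduces the same expectation after division by
`p`, which gives an equation `p ^ (n + 1) ρ = ρ + (p - 1) S` to be solved for `ρ`. -/
theorem rhoZ_eq (hz : z ∈ Set.Icc (0 : ℝ) 1) (n : ℕ) :
    (∑ i ∈ Finset.range (n + 1), (p : ℝ) ^ i) * rhoZ p z n =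
      ∑ r ∈ Finset.range (n + 1), (p : ℝ) ^ r * alphaZ p z r * betaZ p z (n - r) := by
  classical
  have hp := prime_pos_real (p := p)
  have hp1 : (1 : ℝ) < p := by exact_mod_cast (Fact.out : p.Prime).one_lt
  have h := integral_haarZpPow_resMap (p := p) (n := n + 1)
    (integrable_pow_of_measurable hz (measurable_numRoots_vecPoly (n + 1)))
  rw [← Finset.add_sum_erase _ _ (Finset.mem_univ (0 : Fin (n + 1) → ZMod p))] at h
  have h0 : ∫ L : Fin (n + 1) → ℤ_[p], z ^ numRoots p (vecPoly (resMap (0 : Fin (n + 1) → ZMod p) L))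
      ∂haarZpPow p (n + 1) = rhoZ p z n := by
    simp only [vecPoly_resMap_zero, numRoots_const_mul PadicInt.prime_p.ne_zero]
    rfl
  have h1 : ∑ c ∈ Finset.univ.erase (0 : Fin (n + 1) → ZMod p),
      ∫ L : Fin (n + 1) → ℤ_[p], z ^ numRoots p (vecPoly (resMap c L)) ∂haarZpPow p (n + 1) =
      (p - 1) * ∑ r ∈ Finset.range (n + 1), betaZ p z (n - r) * monicWeight p z r := by
    rw [← sum_rootWeight (fun r => betaZ p z (n - r)), ← Finset.add_sum_erase _ (fun c :
      Fin (n + 1) → ZMod p => if c = 0 then 0 else _) (Finset.mem_univ 0), if_pos rfl, zero_add]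
    refine Finset.sum_congr rfl fun c hc => ?_
    rw [integral_pow_numRoots hz c (Finset.ne_of_mem_erase hc),
      if_neg (Finset.ne_of_mem_erase hc)]
  rw [h0, h1] at h
  change rhoZ p z n = _ at h
  have hgeom := geom_sum_eq hp1.ne' (n + 1)
  have hpn : ((p : ℝ) ^ (n + 1)) ≠ 0 := (pow_pos hp _).ne'
  have hp1' : (p : ℝ) - 1 ≠ 0 := by linarith
  simp only [alphaZ_eq' hz] at h
  have h2 : ∑ r ∈ Finset.range (n + 1), betaZ p z (n - r) * ((p : ℝ) ^ r * alphaZ p z r) =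
      ∑ r ∈ Finset.range (n + 1), (p : ℝ) ^ r * alphaZ p z r * betaZ p z (n - r) :=
    Finset.sum_congr rfl fun r _ => mul_comm _ _
  rw [h2] at h
  rw [hgeom, div_mul_eq_mul_div, div_eq_iff hp1']
  set S := ∑ r ∈ Finset.range (n + 1), (p : ℝ) ^ r * alphaZ p z r * betaZ p z (n - r)
  have h3 : (p : ℝ) ^ (n + 1) * rhoZ p z n = rhoZ p z n + (p - 1) * S := by
    conv_lhs => rw [h]
    rw [← mul_assoc, mul_inv_cancel₀ hpn, one_mul]
  linarith

end Rho

end PadicRoots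

end

noncomputable section

namespace PadicRoots

variable {p : ℕ} [Fact p.Prime]

/-! ### Generating functions over a finite field -/

section Combinatorics

variable {K : Type*} [Field K] [Fintype K]

open Classical in
/-- The monic polynomials of degree `n` over a finite field. -/
def monics (K : Type*) [Field K] [Fintype K] (n : ℕ) : Finset K[X] :=
  Finset.univ.image fun c : Fin n → K => X ^ n + vecPoly c

lemma mem_monics {n : ℕ} {f : K[X]} : f ∈ monics K n ↔ f.Monic ∧ f.natDegree = n := by
  classical
  simp only [monics, Finset.mem_image, Finset.mem_univ, true_and]
  constructor
  · rintro ⟨c, rfl⟩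
    exact ⟨monic_X_pow_add_vecPoly c, natDegree_X_pow_add_vecPoly c⟩
  · rintro ⟨hf, rfl⟩
    refine ⟨fun i => f.coeff i, ?_⟩
    ext j
    rw [coeff_add, coeff_X_pow, coeff_vecPoly]
    rcases lt_trichotomy j f.natDegree with h | h | h
    · rw [if_neg h.ne, dif_pos h, zero_add]
    · rw [if_pos h, dif_neg h.not_lt, add_zero, h, hf.coeff_natDegree]
    · rw [if_neg h.ne', dif_neg h.le.not_gt, coeff_eq_zero_of_natDegree_lt h, add_zero]

lemma sum_monics {M : Type*} [AddCommMonoid M] (n : ℕ) (F : K[X] → M) :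
    ∑ f ∈ monics K n, F f = ∑ c : Fin n → K, F (X ^ n + vecPoly c) := by
  classical
  rw [monics, Finset.sum_image]
  intro c _ d _ h
  exact vecPoly_injective (add_left_cancel h)

variable {R : Type*} [CommRing R]

open Classical in
/-- The monic polynomials, sorted by the multiplicity of the root `a`. -/
lemma sum_monics_rootMultiplicity (a : K) (G : ℕ → R) (Q : K[X] → R)
    (hQ : ∀ m h, h.eval a ≠ 0 → Q ((X - C a) ^ m * h) = Q h) (n : ℕ) :
    ∑ f ∈ monics K n, G (f.rootMultiplicity a) * Q f =
      ∑ x ∈ Finset.HasAntidiagonal.antidiagonal n,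
        G x.1 * ∑ h ∈ monics K x.2 with h.eval a ≠ 0, Q h := by
  simp only [Finset.mul_sum]
  rw [Finset.sum_sigma']
  symm
  have hmul : ∀ (m : ℕ) (h : K[X]), h.eval a ≠ 0 →
      ((X - C a) ^ m * h).rootMultiplicity a = m := by
    intro m h hh
    have h0 : h ≠ 0 := by rintro rfl; simp at hh
    rw [rootMultiplicity_mul (mul_ne_zero (pow_ne_zero _ (X_sub_C_ne_zero a)) h0),
      rootMultiplicity_X_sub_C_pow, rootMultiplicity_eq_zero hh, add_zero]
  refine Finset.sum_bij (fun x _ => (X - C a) ^ x.1.1 * x.2) ?_ ?_ ?_ ?_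
  · rintro ⟨⟨m, k⟩, h⟩ hx
    simp only [Finset.mem_sigma, Finset.HasAntidiagonal.mem_antidiagonal, Finset.mem_filter, mem_monics] at hx ⊢
    obtain ⟨h1, ⟨h2, h3⟩, h4⟩ := hx
    have hm : ((X - C a) ^ m).Monic := (monic_X_sub_C a).pow m
    refine ⟨hm.mul h2, ?_⟩
    rw [hm.natDegree_mul h2, natDegree_pow, natDegree_X_sub_C, mul_one, h3, h1]
  · rintro ⟨⟨m, k⟩, h⟩ hx ⟨⟨m', k'⟩, h'⟩ hx' heq
    simp only [Finset.mem_sigma, Finset.HasAntidiagonal.mem_antidiagonal, Finset.mem_filter, mem_monics]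
      at hx hx' heq
    obtain ⟨h1, ⟨h2, h3⟩, h4⟩ := hx
    obtain ⟨h1', ⟨h2', h3'⟩, h4'⟩ := hx'
    have hmm : m = m' := by rw [← hmul m h h4, heq, hmul m' h' h4']
    subst hmm
    have hk : k = k' := by omega
    subst hk
    have := mul_left_cancel₀ (pow_ne_zero _ (X_sub_C_ne_zero a)) heq
    rw [this]
  · intro f hf
    rw [mem_monics] at hf
    obtain ⟨h, hfac, hnd⟩ := exists_eq_pow_rootMultiplicity_mul_and_not_dvd _ hf.1.ne_zero a
    have hm : ((X - C a) ^ f.rootMultiplicity a).Monic := (monic_X_sub_C a).pow _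
    have hh : h.Monic := hm.of_mul_monic_left (hfac ▸ hf.1)
    have hd : f.rootMultiplicity a + h.natDegree = n := by
      rw [← hf.2]
      conv_rhs => rw [hfac]
      rw [hm.natDegree_mul hh, natDegree_pow, natDegree_X_sub_C, mul_one]
    refine ⟨⟨(f.rootMultiplicity a, h.natDegree), h⟩, ?_, hfac.symm⟩
    simp only [Finset.mem_sigma, Finset.HasAntidiagonal.mem_antidiagonal, Finset.mem_filter, mem_monics]
    exact ⟨hd, ⟨hh, trivial⟩, fun h0 => hnd (dvd_iff_isRoot.2 h0)⟩
  · rintro ⟨⟨m, k⟩, h⟩ hx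
    simp only [Finset.mem_sigma, Finset.mem_filter] at hx
    rw [hmul m h hx.2.2, hQ m h hx.2.2]

/-- The generating function of the weighted count of monic polynomials over a finite field, with
weights given by the multiplicities of the roots in a set. -/
lemma mk_sum_monics_prod (β : ℕ → R) (S : Finset K) :
    (PowerSeries.mk fun n => ∑ f ∈ monics K n, ∏ a ∈ S, β (f.rootMultiplicity a)) =
      ((1 - PowerSeries.X) * PowerSeries.mk β) ^ S.card *
        PowerSeries.mk fun n => (Fintype.card K : R) ^ n := by
  classical
  induction S using Finset.induction_on with
  | empty =>
    rw [Finset.card_empty, pow_zero, one_mul]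
    congr 1
    funext n
    rw [sum_monics]
    simp
  | insert a S ha ih =>
    set V : PowerSeries R := PowerSeries.mk fun k =>
      ∑ h ∈ monics K k with h.eval a ≠ 0, ∏ b ∈ S, β (h.rootMultiplicity b) with hV
    have hQ : ∀ (m : ℕ) (h : K[X]), h.eval a ≠ 0 →
        ∏ b ∈ S, β (((X - C a) ^ m * h).rootMultiplicity b) =
          ∏ b ∈ S, β (h.rootMultiplicity b) := by
      intro m h hh
      have h0 : h ≠ 0 := by rintro rfl; simp at hh
      refine Finset.prod_congr rfl fun b hb => ?_
      have hba : b ≠ a := fun e => ha (e ▸ hb)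
      rw [rootMultiplicity_mul (mul_ne_zero (pow_ne_zero _ (X_sub_C_ne_zero a)) h0),
        rootMultiplicity_eq_zero (p := (X - C a) ^ m), zero_add]
      simp [IsRoot, sub_ne_zero.2 hba]
    have key : ∀ G : ℕ → R, (PowerSeries.mk fun n => ∑ f ∈ monics K n,
        G (f.rootMultiplicity a) * ∏ b ∈ S, β (f.rootMultiplicity b)) =
          PowerSeries.mk G * V := by
      intro G
      ext n
      rw [PowerSeries.coeff_mk, PowerSeries.coeff_mul, sum_monics_rootMultiplicity a G _ hQ]
      simp [hV]
    -- Comparing the weight `β` at `a` with the trivial weight `1` eliminates the unknown series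
    -- `V`, so inserting `a` into the set costs exactly one factor `(1 - t) ∑ β(n) tⁿ`.
    have h1 := key fun _ => 1
    simp only [one_mul] at h1
    have h2 := key β
    have h3 : (1 - PowerSeries.X : PowerSeries R) * (PowerSeries.mk fun _ => 1) = 1 := by
      rw [mul_comm]; exact PowerSeries.mk_one_mul_one_sub_eq_one R
    simp only [Finset.prod_insert ha]
    rw [h2, Finset.card_insert_of_notMem ha, pow_succ]
    calc PowerSeries.mk β * V
        = PowerSeries.mk β * (((1 - PowerSeries.X : PowerSeries R) *
            (PowerSeries.mk fun _ => 1)) * V) := by rw [h3, one_mul]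
      _ = (1 - PowerSeries.X) * PowerSeries.mk β * ((PowerSeries.mk fun _ => 1) * V) := by ring
      _ = _ := by rw [← h1, ih]; ring

end Combinatorics

/-! ### The power series identities at a fixed `z` -/

section RealSeries

lemma mk_monicWeight (z : ℝ) :
    (PowerSeries.mk fun n => monicWeight p z n) =
      ((1 - PowerSeries.X) * PowerSeries.mk (betaZ p z)) ^ p *
        PowerSeries.mk fun n => (p : ℝ) ^ n := by
  have := mk_sum_monics_prod (K := ZMod p) (betaZ p z) Finset.univ
  rw [Finset.card_univ, ZMod.card] at this
  rw [← this]
  congr 1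
  funext n
  rw [sum_monics]
  rfl

lemma one_sub_C_mul_X_mul_mk_pow {R : Type*} [CommRing R] (c : R) :
    (1 - PowerSeries.C c * PowerSeries.X) * PowerSeries.mk (fun n => c ^ n) = 1 := by
  have := congrArg (PowerSeries.rescale c) (PowerSeries.mk_one_mul_one_sub_eq_one R)
  rw [map_mul, map_sub, map_one, PowerSeries.rescale_X, PowerSeries.rescale_mk] at this
  rw [mul_comm, ← this]
  congr 2
  funext n
  simp

/-- Replacing `t` by `p t` turns averages over reductions into sums, and turns `1 - t` into `1 - p
t`, which cancels the generating function of all monic polynomials. -/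
lemma rescale_alphaZ {z : ℝ} (hz : z ∈ Set.Icc (0 : ℝ) 1) :
    PowerSeries.rescale (p : ℝ) ((1 - PowerSeries.X) * PowerSeries.mk (alphaZ p z)) =
      ((1 - PowerSeries.X) * PowerSeries.mk (betaZ p z)) ^ p := by
  rw [map_mul, map_sub, map_one, PowerSeries.rescale_X, PowerSeries.rescale_mk]
  have h1 : (PowerSeries.mk fun n => (p : ℝ) ^ n * alphaZ p z n) =
      PowerSeries.mk fun n => monicWeight p z n := by
    congr 1; funext n; rw [alphaZ_eq' hz]
  rw [h1, mk_monicWeight, mul_left_comm, one_sub_C_mul_X_mul_mk_pow, mul_one]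

lemma mk_rhoZ {z : ℝ} (hz : z ∈ Set.Icc (0 : ℝ) 1) :
    (1 - PowerSeries.X) * (1 - PowerSeries.C (p : ℝ) * PowerSeries.X) *
      (PowerSeries.mk fun n => (∑ i ∈ Finset.range (n + 1), (p : ℝ) ^ i) * rhoZ p z n) =
      PowerSeries.rescale (p : ℝ) ((1 - PowerSeries.X) * PowerSeries.mk (alphaZ p z)) *
        ((1 - PowerSeries.X) * PowerSeries.mk (betaZ p z)) := by
  have h1 : (PowerSeries.mk fun n => (∑ i ∈ Finset.range (n + 1), (p : ℝ) ^ i) * rhoZ p z n) =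
      PowerSeries.rescale (p : ℝ) (PowerSeries.mk (alphaZ p z)) *
        PowerSeries.mk (betaZ p z) := by
    ext n
    rw [PowerSeries.coeff_mk, rhoZ_eq hz, PowerSeries.coeff_mul,
      Finset.Nat.sum_antidiagonal_eq_sum_range_succ_mk]
    simp [PowerSeries.coeff_rescale]
  rw [h1, map_mul, map_sub, map_one, PowerSeries.rescale_X]
  ring

end RealSeries

/-! ### Factorial moments and probability generating polynomials -/

section Expectation

/-- The generating polynomial of the factorial moments of a bounded random variable. -/
lemma integral_pow_eq_sum_choose {Ω : Type*} [MeasurableSpace Ω] {μ : Measure Ω}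
    [IsProbabilityMeasure μ] {N : Ω → ℕ} (hN : Measurable N) {n : ℕ} (hn : ∀ ω, N ω ≤ n) (u : ℝ) :
    ∫ ω, (1 + u) ^ N ω ∂μ =
      ∑ d ∈ Finset.range (n + 1), (∫ ω, ((N ω).choose d : ℝ) ∂μ) * u ^ d := by
  have hint : ∀ d, Integrable (fun ω => ((N ω).choose d : ℝ)) μ := by
    intro d
    refine Integrable.of_bound ((measurable_of_countable
      (fun k : ℕ => (k.choose d : ℝ))).comp hN).aestronglyMeasurable ((n.choose d : ℕ) : ℝ) ?_
    refine Filter.Eventually.of_forall fun ω => ?_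
    rw [Real.norm_of_nonneg (by positivity)]
    exact_mod_cast Nat.choose_le_choose d (hn ω)
  simp only [← integral_mul_const]
  rw [← integral_finsetSum _ fun d _ => (hint d).mul_const _]
  refine integral_congr_ae (Filter.Eventually.of_forall fun ω => ?_)
  simp only
  rw [add_comm, add_pow]
  simp only [one_pow, mul_one]
  rw [← Finset.sum_subset (Finset.range_mono (Nat.succ_le_succ (hn ω)))]
  · exact Finset.sum_congr rfl fun d _ => mul_comm _ _
  · intro d _ hd
    rw [Finset.mem_range, not_lt] at hd
    rw [Nat.choose_eq_zero_of_lt (by omega)]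
    simp

lemma integral_pow_eq_sum_measure {Ω : Type*} [MeasurableSpace Ω] {μ : Measure Ω}
    [IsProbabilityMeasure μ] {N : Ω → ℕ} (hN : Measurable N) {n : ℕ} (hn : ∀ ω, N ω ≤ n) (z : ℝ) :
    ∫ ω, z ^ N ω ∂μ = ∑ r ∈ Finset.range (n + 1), μ.real {ω | N ω = r} * z ^ r := by
  classical
  have hset : ∀ r, MeasurableSet {ω | N ω = r} := fun r => hN (measurableSet_singleton r)
  have h1 : ∀ ω, z ^ N ω =
      ∑ r ∈ Finset.range (n + 1), {ω | N ω = r}.indicator (fun _ => z ^ r) ω := by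
    intro ω
    rw [Finset.sum_eq_single (N ω)]
    · simp
    · intro r _ hr
      rw [Set.indicator_of_notMem]
      exact fun h => hr (Eq.symm h)
    · intro h
      exact absurd (Finset.mem_range.2 (Nat.lt_succ_of_le (hn ω))) h
  simp only [h1]
  rw [integral_finsetSum _ fun r _ => (integrable_const _).indicator (hset r)]
  refine Finset.sum_congr rfl fun r _ => ?_
  rw [integral_indicator_const _ (hset r), smul_eq_mul]

variable (p)

lemma numRootSets_eq (d : ℕ) (f : ℤ_[p][X]) : numRootSets p d f = (numRoots p f).choose d := by
  rw [numRootSets, Finset.card_powersetCard, numRoots]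

lemma numRoots_genPoly_le (n : ℕ) (a : Fin (n + 1) → ℤ_[p]) :
    numRoots p (genPoly p n a) ≤ n :=
  (numRoots_le_natDegree _).trans (natDegree_vecPoly_succ_le a)

lemma numRoots_monicPoly_le (n : ℕ) (a : Fin n → ℤ_[p]) :
    numRoots p (monicPoly p n a) ≤ n :=
  (numRoots_le_natDegree _).trans (natDegree_X_pow_add_vecPoly a).le

lemma integrable_numRootSets_of_le {Ω : Type*} [MeasurableSpace Ω] {μ : Measure Ω}
    [IsProbabilityMeasure μ] {f : Ω → ℤ_[p][X]} (hN : Measurable fun ω => numRoots p (f ω))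
    {n : ℕ} (hn : ∀ ω, numRoots p (f ω) ≤ n) (d : ℕ) :
    Integrable (fun ω => (numRootSets p d (f ω) : ℝ)) μ := by
  simp only [numRootSets_eq]
  refine Integrable.of_bound ((measurable_of_countable
    (fun k : ℕ => (k.choose d : ℝ))).comp hN).aestronglyMeasurable ((n.choose d : ℕ) : ℝ) ?_
  refine Filter.Eventually.of_forall fun ω => ?_
  rw [Real.norm_of_nonneg (by positivity)]
  exact_mod_cast Nat.choose_le_choose d (hn ω)

/-- The polynomial `∑ α(n, d) u ^ d`. -/
def alphaP (n : ℕ) : ℝ[X] := ∑ d ∈ Finset.range (n + 1), C (alpha p n d) * X ^ d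

/-- The polynomial `∑ β(n, d) u ^ d`. -/
def betaP (n : ℕ) : ℝ[X] := ∑ d ∈ Finset.range (n + 1), C (beta p n d) * X ^ d

/-- The polynomial `∑ ρ(n, d) u ^ d`. -/
def rhoP (n : ℕ) : ℝ[X] := ∑ d ∈ Finset.range (n + 1), C (rho p n d) * X ^ d

/-- The probability generating polynomial of `α*(n, r)`. -/
def alphaStarP (n : ℕ) : ℝ[X] := ∑ r ∈ Finset.range (n + 1), C (alphaStar p n r) * X ^ r

/-- The probability generating polynomial of `β*(n, r)`. -/
def betaStarP (n : ℕ) : ℝ[X] := ∑ r ∈ Finset.range (n + 1), C (betaStar p n r) * X ^ r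

/-- The probability generating polynomial of `ρ*(n, r)`. -/
def rhoStarP (n : ℕ) : ℝ[X] := ∑ r ∈ Finset.range (n + 1), C (rhoStar p n r) * X ^ r

lemma coeff_sum_range {R : Type*} [Semiring R] (c : ℕ → R) {n : ℕ} (hc : ∀ d, n < d → c d = 0)
    (d : ℕ) : (∑ d ∈ Finset.range (n + 1), C (c d) * X ^ d).coeff d = c d := by
  simp only [finsetSum_coeff, coeff_C_mul, coeff_X_pow, mul_ite, mul_one, mul_zero]
  rw [Finset.sum_ite_eq]
  split_ifs with h
  · rfl
  · rw [hc d (by simpa using h)]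

lemma integral_numRootSets_eq_zero {Ω : Type*} [MeasurableSpace Ω] {μ : Measure Ω}
    {f : Ω → ℤ_[p][X]} {n : ℕ} (hn : ∀ ω, numRoots p (f ω) ≤ n) {d : ℕ} (hd : n < d) :
    ∫ ω, (numRootSets p d (f ω) : ℝ) ∂μ = 0 := by
  simp only [numRootSets_eq]
  have : ∀ ω, (numRoots p (f ω)).choose d = 0 := fun ω =>
    Nat.choose_eq_zero_of_lt ((hn ω).trans_lt hd)
  simp [this]

lemma measureReal_numRoots_eq_zero {Ω : Type*} [MeasurableSpace Ω] {μ : Measure Ω}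
    {f : Ω → ℤ_[p][X]} {n : ℕ} (hn : ∀ ω, numRoots p (f ω) ≤ n) {r : ℕ} (hr : n < r) :
    μ.real {ω | numRoots p (f ω) = r} = 0 := by
  have : {ω | numRoots p (f ω) = r} = ∅ := by
    refine Set.eq_empty_of_forall_notMem fun ω hω => ?_
    have h1 : numRoots p (f ω) = r := hω
    have := hn ω
    omega
  rw [this, measureReal_empty]

lemma coeff_alphaP (n d : ℕ) : (alphaP p n).coeff d = alpha p n d :=
  coeff_sum_range _ (fun _ hd => integral_numRootSets_eq_zero p (numRoots_monicPoly_le p n) hd) d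

lemma coeff_betaP (n d : ℕ) : (betaP p n).coeff d = beta p n d :=
  coeff_sum_range _ (fun _ hd => integral_numRootSets_eq_zero p (numRoots_monicPoly_le p n) hd) d

lemma coeff_rhoP (n d : ℕ) : (rhoP p n).coeff d = rho p n d :=
  coeff_sum_range _ (fun _ hd => integral_numRootSets_eq_zero p (numRoots_genPoly_le p n) hd) d

lemma coeff_alphaStarP (n r : ℕ) : (alphaStarP p n).coeff r = alphaStar p n r :=
  coeff_sum_range _ (fun _ hd => measureReal_numRoots_eq_zero p (numRoots_monicPoly_le p n) hd) r

lemma coeff_betaStarP (n r : ℕ) : (betaStarP p n).coeff r = betaStar p n r :=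
  coeff_sum_range _ (fun _ hd => measureReal_numRoots_eq_zero p (numRoots_monicPoly_le p n) hd) r

lemma coeff_rhoStarP (n r : ℕ) : (rhoStarP p n).coeff r = rhoStar p n r :=
  coeff_sum_range _ (fun _ hd => measureReal_numRoots_eq_zero p (numRoots_genPoly_le p n) hd) r

lemma eval_sum_moments {Ω : Type*} [MeasurableSpace Ω] {μ : Measure Ω}
    [IsProbabilityMeasure μ] {f : Ω → ℤ_[p][X]} (hN : Measurable fun ω => numRoots p (f ω))
    {n : ℕ} (hn : ∀ ω, numRoots p (f ω) ≤ n) (u : ℝ) :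
    (∑ d ∈ Finset.range (n + 1), C (∫ ω, (numRootSets p d (f ω) : ℝ) ∂μ) * X ^ d).eval u =
      ∫ ω, (1 + u) ^ numRoots p (f ω) ∂μ := by
  simp only [numRootSets_eq, integral_pow_eq_sum_choose hN hn, eval_finsetSum, eval_mul, eval_C,
    eval_pow, eval_X]

/-- Both polynomials express `E[z ^ N]`, with `z = 1 + u`. This transfers part (a) from expectations
to probabilities. -/
lemma sum_measure_eq_comp {Ω : Type*} [MeasurableSpace Ω] {μ : Measure Ω}
    [IsProbabilityMeasure μ] {f : Ω → ℤ_[p][X]} (hN : Measurable fun ω => numRoots p (f ω))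
    {n : ℕ} (hn : ∀ ω, numRoots p (f ω) ≤ n) :
    (∑ r ∈ Finset.range (n + 1), C (μ.real {ω | numRoots p (f ω) = r}) * X ^ r) =
      (∑ d ∈ Finset.range (n + 1),
        C (∫ ω, (numRootSets p d (f ω) : ℝ) ∂μ) * X ^ d).comp (X - 1) := by
  refine Polynomial.funext fun z => ?_
  rw [eval_comp, eval_sum_moments p hN hn, eval_sub, eval_X, eval_one, add_sub_cancel,
    integral_pow_eq_sum_measure hN hn]
  simp [eval_finsetSum]

lemma alphaStarP_eq (n : ℕ) : alphaStarP p n = (alphaP p n).comp (X - 1) :=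
  sum_measure_eq_comp p (measurable_numRoots_monicPoly n) (numRoots_monicPoly_le p n)

lemma betaStarP_eq (n : ℕ) : betaStarP p n = (betaP p n).comp (X - 1) :=
  sum_measure_eq_comp p (measurable_numRoots_monicPoly n) (numRoots_monicPoly_le p n)

lemma rhoStarP_eq (n : ℕ) : rhoStarP p n = (rhoP p n).comp (X - 1) :=
  sum_measure_eq_comp p (measurable_numRoots_genPoly n) (numRoots_genPoly_le p n)

lemma eval_alphaP (n : ℕ) (u : ℝ) : (alphaP p n).eval u = alphaZ p (1 + u) n := by
  rw [alphaP]
  refine (eval_sum_moments p (measurable_numRoots_monicPoly n) (numRoots_monicPoly_le p n) u).trans ?_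
  simp only [numRoots_monicPoly]
  rfl

lemma eval_betaP (n : ℕ) (u : ℝ) : (betaP p n).eval u = betaZ p (1 + u) n := by
  rw [betaP]
  refine (eval_sum_moments p (measurable_numRoots_monicPoly n) (numRoots_monicPoly_le p n) u).trans ?_
  rw [reducedMeasure_eq_map, integral_map (continuous_resMap _).measurable.aemeasurable]
  · simp only [numRoots_monicPoly]
    simp only [monicPoly_eq, vecPoly_resMap_zero]
    rfl
  · exact ((measurable_of_countable (fun k : ℕ => (1 + u) ^ k)).comp
      (measurable_numRoots_monicPoly n)).aestronglyMeasurable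

lemma eval_rhoP (n : ℕ) (u : ℝ) : (rhoP p n).eval u = rhoZ p (1 + u) n := by
  rw [rhoP]
  exact eval_sum_moments p (measurable_numRoots_genPoly n) (numRoots_genPoly_le p n) u

end Expectation

end PadicRoots

end

noncomputable section

namespace PadicRoots

variable (p : ℕ) [Fact p.Prime]

/-! ### From fixed `z` to identities in two variables -/

section Lift

/-- The interval consists of the `u` with `1 + u ∈ [0, 1]`, where the integral identities are
available; being infinite, it determines a polynomial. -/
lemma polynomial_eq_of_eval {f g : ℝ[X]} (h : ∀ u ∈ Set.Icc (-1 : ℝ) 0, f.eval u = g.eval u) :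
    f = g :=
  Polynomial.eq_of_infinite_eval_eq f g
    ((Set.Icc_infinite (by norm_num : (-1 : ℝ) < 0)).mono fun u hu => h u hu)

lemma powerSeries_eq_of_eval {F G : PowerSeries ℝ[X]} (h : ∀ u ∈ Set.Icc (-1 : ℝ) 0,
    PowerSeries.map (evalRingHom u) F = PowerSeries.map (evalRingHom u) G) : F = G := by
  ext1 n
  refine polynomial_eq_of_eval fun u hu => ?_
  have := congrArg (PowerSeries.coeff n) (h u hu)
  simpa using this

lemma one_add_mem_Icc {u : ℝ} (hu : u ∈ Set.Icc (-1 : ℝ) 0) : 1 + u ∈ Set.Icc (0 : ℝ) 1 :=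
  ⟨by linarith [hu.1], by linarith [hu.2]⟩

/-- The power series `∑ A_d(t) u ^ d`, as a power series in `t`. -/
def serAP : PowerSeries ℝ[X] := (1 - PowerSeries.X) * PowerSeries.mk (alphaP p)

/-- The power series `∑ B_d(t) u ^ d`, as a power series in `t`. -/
def serBP : PowerSeries ℝ[X] := (1 - PowerSeries.X) * PowerSeries.mk (betaP p)

/-- The power series `∑ R_d(t) u ^ d`, as a power series in `t`. -/
def serRP : PowerSeries ℝ[X] :=
  (1 - PowerSeries.X) * (1 - PowerSeries.C (C (p : ℝ)) * PowerSeries.X) *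
    PowerSeries.mk fun n => C (∑ i ∈ Finset.range (n + 1), (p : ℝ) ^ i) * rhoP p n

lemma map_serAP (u : ℝ) : PowerSeries.map (evalRingHom u) (serAP p) =
    (1 - PowerSeries.X) * PowerSeries.mk (alphaZ p (1 + u)) := by
  rw [serAP, map_mul, map_sub, map_one, PowerSeries.map_X]
  congr 1
  ext n
  simp [eval_alphaP]

lemma map_serBP (u : ℝ) : PowerSeries.map (evalRingHom u) (serBP p) =
    (1 - PowerSeries.X) * PowerSeries.mk (betaZ p (1 + u)) := by
  rw [serBP, map_mul, map_sub, map_one, PowerSeries.map_X]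
  congr 1
  ext n
  simp [eval_betaP]

lemma map_rescale_C (u c : ℝ) (F : PowerSeries ℝ[X]) :
    PowerSeries.map (evalRingHom u) (PowerSeries.rescale (C c) F) =
      PowerSeries.rescale c (PowerSeries.map (evalRingHom u) F) := by
  ext n
  simp [PowerSeries.coeff_rescale]

lemma rescale_serAP : PowerSeries.rescale (C (p : ℝ)) (serAP p) = serBP p ^ p := by
  refine powerSeries_eq_of_eval fun u hu => ?_
  rw [map_rescale_C, map_pow, map_serAP, map_serBP, rescale_alphaZ (one_add_mem_Icc hu)]

lemma serRP_eq : serRP p = PowerSeries.rescale (C (p : ℝ)) (serAP p) * serBP p := by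
  refine powerSeries_eq_of_eval fun u hu => ?_
  rw [map_mul, map_rescale_C, map_serAP, map_serBP, ← mk_rhoZ (one_add_mem_Icc hu), serRP]
  simp only [map_mul, map_sub, map_one, PowerSeries.map_X, PowerSeries.map_C]
  congr 1
  · simp
  · ext n
    simp [eval_rhoP, eval_finsetSum]

/-- Interchange of the variables, from power series with polynomial coefficients. -/
def swapVars : PowerSeries ℝ[X] →+* PowerSeries (PowerSeries ℝ) where
  toFun F := PowerSeries.mk fun d => PowerSeries.mk fun n => (PowerSeries.coeff n F).coeff d
  map_one' := by
    ext d n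
    simp only [PowerSeries.coeff_mk, PowerSeries.coeff_one]
    split_ifs <;> simp_all [coeff_one, PowerSeries.coeff_one]
  map_mul' F G := by
    ext d n
    simp only [PowerSeries.coeff_mk, PowerSeries.coeff_mul, finsetSum_coeff, map_sum,
      Polynomial.coeff_mul]
    exact Finset.sum_comm
  map_zero' := by ext; simp
  map_add' F G := by ext; simp

lemma coeff_swapVars (F : PowerSeries ℝ[X]) (d n : ℕ) :
    PowerSeries.coeff n (PowerSeries.coeff d (swapVars F)) = (PowerSeries.coeff n F).coeff d := by
  simp [swapVars]

lemma swapVars_map_C (F : PowerSeries ℝ) :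
    swapVars (PowerSeries.map (C : ℝ →+* ℝ[X]) F) = PowerSeries.C F := by
  ext d n
  rw [coeff_swapVars, PowerSeries.coeff_map, coeff_C, PowerSeries.coeff_C]
  split_ifs <;> simp

lemma swapVars_map_C_mul (F : PowerSeries ℝ) (g : ℕ → ℝ[X]) (h : ℕ → ℕ → ℝ)
    (hg : ∀ n d, (g n).coeff d = h n d) :
    swapVars (PowerSeries.map (C : ℝ →+* ℝ[X]) F * PowerSeries.mk g) =
      PowerSeries.mk fun d => F * PowerSeries.mk fun n => h n d := by
  rw [map_mul, swapVars_map_C]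
  ext1 d
  rw [PowerSeries.coeff_C_mul, PowerSeries.coeff_mk]
  congr 1
  ext n
  rw [coeff_swapVars, PowerSeries.coeff_mk, PowerSeries.coeff_mk, hg]

lemma swapVars_serAP : swapVars (serAP p) = PowerSeries.mk (serA p) := by
  have := swapVars_map_C_mul (1 - PowerSeries.X) (alphaP p) (alpha p) (coeff_alphaP p)
  rw [map_sub, map_one, PowerSeries.map_X] at this
  exact this

lemma swapVars_serBP : swapVars (serBP p) = PowerSeries.mk (serB p) := by
  have := swapVars_map_C_mul (1 - PowerSeries.X) (betaP p) (beta p) (coeff_betaP p)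
  rw [map_sub, map_one, PowerSeries.map_X] at this
  exact this

lemma swapVars_serRP : swapVars (serRP p) = PowerSeries.mk (serR p) := by
  have := swapVars_map_C_mul ((1 - PowerSeries.X) * (1 - PowerSeries.C (p : ℝ) * PowerSeries.X))
    (fun n => C (∑ i ∈ Finset.range (n + 1), (p : ℝ) ^ i) * rhoP p n)
    (fun n d => (∑ i ∈ Finset.range (n + 1), (p : ℝ) ^ i) * rho p n d)
    (fun n d => by rw [coeff_C_mul, coeff_rhoP])
  have e : PowerSeries.map (C : ℝ →+* ℝ[X])
      ((1 - PowerSeries.X) * (1 - PowerSeries.C (p : ℝ) * PowerSeries.X)) =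
      (1 - PowerSeries.X) * (1 - PowerSeries.C (C (p : ℝ)) * PowerSeries.X) := by simp
  rw [e] at this
  exact this

lemma swapVars_rescale (c : ℝ) (F : PowerSeries ℝ[X]) :
    swapVars (PowerSeries.rescale (C c) F) =
      PowerSeries.mk fun d => PowerSeries.rescale c (PowerSeries.coeff d (swapVars F)) := by
  ext d n
  rw [coeff_swapVars, PowerSeries.coeff_mk, PowerSeries.coeff_rescale, PowerSeries.coeff_rescale,
    coeff_swapVars, ← C_pow, coeff_C_mul]

theorem mk_rescale_serA : (PowerSeries.mk fun d => PowerSeries.rescale (p : ℝ) (serA p d) :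
    PowerSeries (PowerSeries ℝ)) = (PowerSeries.mk fun d => serB p d) ^ p := by
  have := congrArg swapVars (rescale_serAP p)
  rw [swapVars_rescale, map_pow, swapVars_serAP, swapVars_serBP] at this
  simpa using this

theorem mk_serR : (PowerSeries.mk fun d => serR p d : PowerSeries (PowerSeries ℝ)) =
    (PowerSeries.mk fun d => PowerSeries.rescale (p : ℝ) (serA p d)) *
      (PowerSeries.mk fun d => serB p d) := by
  have := congrArg swapVars (serRP_eq p)
  rw [map_mul, swapVars_rescale, swapVars_serAP, swapVars_serBP, swapVars_serRP] at this
  simpa using this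

lemma coeff_serA (d n : ℕ) :
    PowerSeries.coeff n (serA p d) = (PowerSeries.coeff n (serAP p)).coeff d := by
  rw [← coeff_swapVars, swapVars_serAP, PowerSeries.coeff_mk]

lemma coeff_serB (d n : ℕ) :
    PowerSeries.coeff n (serB p d) = (PowerSeries.coeff n (serBP p)).coeff d := by
  rw [← coeff_swapVars, swapVars_serBP, PowerSeries.coeff_mk]

end Lift

/-! ### The recurrences for the coefficients -/

section System

/-- The recurrence relations satisfied by the coefficients of `∑ A_d(t) u ^ d` and
`∑ B_d(t) u ^ d`, over a field in which `x` plays the role of the prime. -/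
structure IsRootSystem {L : Type*} [Field L] (x : L) (a b : ℕ → L[X]) : Prop where
  a_zero : a 0 = 1
  b_zero : b 0 = 1
  a_one : a 1 = X
  b_one : b 1 = X
  conv : ∀ n : ℕ, ∑ i ∈ Finset.HasAntidiagonal.antidiagonal n,
    C ((((i.1 : ℕ) : L) - x * ((i.2 : ℕ) : L)) * x ^ i.1) * (a i.1 * b i.2) = 0
  step : ∀ n, b (n + 1) - C (x ^ n)⁻¹ * b n =
    C (x ^ (n + 1).choose 2)⁻¹ * (a (n + 1) - C (x ^ n) * a n)

-- Differencing `betaZ_eq` in `n` removes the outer sum; subtracting `p ^ (-(n + 1))` times the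
-- preceding difference equalizes the prefactors, so the inner sums cancel up to their last term.
variable {p} in
lemma betaZ_step {z : ℝ} (hz : z ∈ Set.Icc (0 : ℝ) 1) (n : ℕ) :
    betaZ p z (n + 2) - betaZ p z (n + 1) -
      ((p : ℝ) ^ (n + 1))⁻¹ * (betaZ p z (n + 1) - betaZ p z n) =
    ((p : ℝ) ^ (n + 2).choose 2)⁻¹ * (alphaZ p z (n + 2) - alphaZ p z (n + 1) -
      (p : ℝ) ^ (n + 1) * (alphaZ p z (n + 1) - alphaZ p z n)) := by
  have hp := (prime_pos_real (p := p)).ne'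
  rw [betaZ_eq hz (n + 2), betaZ_eq hz (n + 1), betaZ_eq hz n]
  simp only [Finset.sum_range_succ]
  have h1 : (n + 2).choose 2 = n.choose 2 + n + (n + 1) := by
    rw [Nat.choose_succ_succ' (n + 1) 1, Nat.choose_succ_succ' n 1, Nat.choose_one_right,
      Nat.choose_one_right]
    ring
  have h2 : (n + 1).choose 2 = n.choose 2 + n := by
    rw [Nat.choose_succ_succ' n 1, Nat.choose_one_right]
    ring
  rw [h1, h2, pow_add, pow_add, pow_succ]
  field_simp
  ring

lemma alphaZ_zero (z : ℝ) : alphaZ p z 0 = 1 := by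
  simp [alphaZ, numIntRoots_one]

lemma numIntRoots_X_add_C (c : ℤ_[p]) : numIntRoots (X + C c) = 1 := by
  rw [numIntRoots, roots_X_add_C]
  simp

lemma alphaZ_one (z : ℝ) : alphaZ p z 1 = z := by
  have : ∀ a : Fin 1 → ℤ_[p], numIntRoots (X ^ 1 + vecPoly a) = 1 := by
    intro a
    rw [show (X ^ 1 + vecPoly a : ℤ_[p][X]) = X + C (a 0) by simp [vecPoly],
      numIntRoots_X_add_C]
  simp only [alphaZ, this]
  simp

lemma alphaP_zero : alphaP p 0 = 1 :=
  polynomial_eq_of_eval fun u _ => by rw [eval_alphaP, alphaZ_zero, eval_one]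

lemma alphaP_one : alphaP p 1 = 1 + X :=
  polynomial_eq_of_eval fun u _ => by rw [eval_alphaP, alphaZ_one]; simp

lemma betaP_zero : betaP p 0 = 1 :=
  polynomial_eq_of_eval fun u _ => by rw [eval_betaP, betaZ_zero, eval_one]

lemma betaP_one : betaP p 1 = 1 + X :=
  polynomial_eq_of_eval fun u hu => by
    rw [eval_betaP, betaZ_eq (one_add_mem_Icc hu), alphaZ_one]; simp

lemma coeff_one_sub_X_mul_zero {R : Type*} [CommRing R] (f : ℕ → R) :
    PowerSeries.coeff 0 ((1 - PowerSeries.X) * PowerSeries.mk f) = f 0 := by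
  simp

lemma coeff_one_sub_X_mul_succ {R : Type*} [CommRing R] (f : ℕ → R) (n : ℕ) :
    PowerSeries.coeff (n + 1) ((1 - PowerSeries.X) * PowerSeries.mk f) = f (n + 1) - f n := by
  rw [sub_mul, one_mul, map_sub, PowerSeries.coeff_succ_X_mul, PowerSeries.coeff_mk,
    PowerSeries.coeff_mk]

lemma sum_coeff_one_sub_X_mul {R : Type*} [CommRing R] (f : ℕ → R) (n : ℕ) :
    ∑ i ∈ Finset.range (n + 1), PowerSeries.coeff i ((1 - PowerSeries.X) * PowerSeries.mk f) =
      f n := by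
  induction n with
  | zero => simp
  | succ n ih => rw [Finset.sum_range_succ, ih, coeff_one_sub_X_mul_succ]; ring

/-- The relation between the coefficients of a power series and those of its power. -/
lemma sum_antidiagonal_of_eq_pow {R : Type*} [CommRing R] {F G : PowerSeries R} {m : ℕ}
    (h : F = G ^ m) (n : ℕ) :
    ∑ i ∈ Finset.HasAntidiagonal.antidiagonal n, ((i.1 : R) - m * i.2) *
      (PowerSeries.coeff i.1 F * PowerSeries.coeff i.2 G) = 0 := by
  set D : PowerSeries R → PowerSeries R :=
    fun H => PowerSeries.X * PowerSeries.derivative R H with hD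
  have hc : ∀ H n, PowerSeries.coeff n (D H) = (n : R) * PowerSeries.coeff n H := by
    intro H n
    cases n with
    | zero => simp [hD]
    | succ n =>
      rw [hD, PowerSeries.coeff_succ_X_mul, PowerSeries.coeff_derivative]
      push_cast; ring
  -- Logarithmic differentiation of `F = G ^ m` with the operator `t d/dt`, which multiplies the
  -- coefficient of `tⁿ` by `n`.
  have h1 : D F * G = (m : PowerSeries R) * (F * D G) := by
    have hder : PowerSeries.derivative R (G ^ m) =
        (m : PowerSeries R) * G ^ (m - 1) * PowerSeries.derivative R G := by
      rw [Derivation.leibniz_pow]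
      simp [mul_assoc]
    simp only [hD, h]
    rw [hder]
    cases m with
    | zero => simp
    | succ m => rw [Nat.succ_sub_one, pow_succ]; ring
  have h2 := congrArg (PowerSeries.coeff n) h1
  rw [← sub_eq_zero] at h2
  rw [← h2, ← nsmul_eq_mul, map_nsmul, PowerSeries.coeff_mul, PowerSeries.coeff_mul,
    nsmul_eq_mul, Finset.mul_sum, ← Finset.sum_sub_distrib]
  refine Finset.sum_congr rfl fun i _ => ?_
  rw [hc, hc]
  ring

/-- The power relation enters only through its logarithmic derivative: there the exponent `p` has
become a scalar, which can be replaced by an indeterminate. -/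
theorem isRootSystem_real :
    IsRootSystem (p : ℝ) (fun n => PowerSeries.coeff n (serAP p))
      (fun n => PowerSeries.coeff n (serBP p)) where
  a_zero := by rw [serAP, coeff_one_sub_X_mul_zero, alphaP_zero]
  b_zero := by rw [serBP, coeff_one_sub_X_mul_zero, betaP_zero]
  a_one := by rw [serAP, coeff_one_sub_X_mul_succ, alphaP_zero, alphaP_one]; ring
  b_one := by rw [serBP, coeff_one_sub_X_mul_succ, betaP_zero, betaP_one]; ring
  conv n := by
    rw [← sum_antidiagonal_of_eq_pow (rescale_serAP p) n]
    refine Finset.sum_congr rfl fun i _ => ?_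
    rw [PowerSeries.coeff_rescale]
    simp only [C_mul, C_sub, C_pow, map_natCast]
    ring
  step n := by
    cases n with
    | zero =>
      simp only [serAP, serBP, coeff_one_sub_X_mul_succ, coeff_one_sub_X_mul_zero, alphaP_zero,
        betaP_zero, zero_add]
      simp [alphaP_one, betaP_one]
    | succ n =>
      simp only [serAP, serBP, coeff_one_sub_X_mul_succ]
      refine polynomial_eq_of_eval fun u hu => ?_
      have := betaZ_step (p := p) (one_add_mem_Icc hu) n
      simpa [eval_alphaP, eval_betaP] using this

theorem serB_sub_eq (d : ℕ) :
    serB p d - PowerSeries.X * PowerSeries.rescale (1 / (p : ℝ)) (serB p d) =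
      Phi p (serA p d - PowerSeries.X * PowerSeries.rescale (p : ℝ) (serA p d)) := by
  have hs := isRootSystem_real p
  ext n
  cases n with
  | zero =>
    have h1 := hs.a_zero
    have h2 := hs.b_zero
    simp only [Phi, PowerSeries.coeff_mk, map_sub, coeff_serB, coeff_serA]
    rw [h1, h2]
    simp
  | succ n =>
    have h := congrArg (fun f => f.coeff d) (hs.step n)
    simp only [coeff_sub, coeff_C_mul] at h
    simp only [Phi, PowerSeries.coeff_mk, map_sub, PowerSeries.coeff_succ_X_mul,
      PowerSeries.coeff_rescale, coeff_serB, coeff_serA, one_div, inv_pow]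
    exact h

end System

end PadicRoots

end

noncomputable section

namespace PadicRoots

open Filter Topology

variable {p : ℕ} [Fact p.Prime]

/-! ### Approximating roots by residues modulo `p ^ k` -/

section NearRoots

/-- The residue `c` modulo `p ^ k` contains a root of `f` at which the derivative of `f` is not
divisible by `p ^ k`; this criterion only involves `f(c)` and `f'(c)`. -/
def IsNearRoot (k : ℕ) (f : ℤ_[p][X]) (c : ℕ) : Prop :=
  (p : ℝ) ^ (-(k : ℤ)) < ‖f.derivative.eval (c : ℤ_[p])‖ ∧
    ‖f.eval (c : ℤ_[p])‖ ≤ ‖f.derivative.eval (c : ℤ_[p])‖ * (p : ℝ) ^ (-(k : ℤ))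

open Classical in
/-- The residues modulo `p ^ k` satisfying `IsNearRoot`. -/
def nearRoots (k : ℕ) (f : ℤ_[p][X]) : Finset ℕ :=
  (Finset.range (p ^ k)).filter (IsNearRoot k f)

lemma exists_taylor (f : ℤ_[p][X]) (x y : ℤ_[p]) :
    ∃ e, f.eval y = f.eval x + (f.derivative.eval x + e * (y - x)) * (y - x) := by
  obtain ⟨e, he⟩ := f.binomExpansion x (y - x)
  rw [add_sub_cancel] at he
  exact ⟨e, by rw [he]; ring⟩

lemma norm_mul_le_right (x y : ℤ_[p]) : ‖x * y‖ ≤ ‖y‖ := by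
  rw [norm_mul]
  exact mul_le_of_le_one_left (norm_nonneg _) x.norm_le_one

lemma norm_add_eq_of_lt {x y : ℤ_[p]} (h : ‖y‖ < ‖x‖) : ‖x + y‖ = ‖x‖ := by
  rw [PadicInt.norm_add_eq_max_of_ne h.ne', max_eq_left h.le]

lemma norm_derivative_eq {f : ℤ_[p][X]} {x y : ℤ_[p]}
    (h : ‖y - x‖ < ‖f.derivative.eval x‖) :
    ‖f.derivative.eval y‖ = ‖f.derivative.eval x‖ := by
  obtain ⟨e, he⟩ := sub_dvd_eval_sub y x f.derivative
  have : f.derivative.eval y = f.derivative.eval x + e * (y - x) := by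
    rw [mul_comm, ← he]; ring
  rw [this]
  exact norm_add_eq_of_lt ((norm_mul_le_right _ _).trans_lt h)

lemma norm_sub_val_le (k : ℕ) (x : ℤ_[p]) :
    ‖((PadicInt.toZModPow k x).val : ℤ_[p]) - x‖ ≤ (p : ℝ) ^ (-(k : ℤ)) := by
  rw [norm_sub_rev, norm_le_iff_pow_dvd, pow_dvd_sub_natCast_val]

/-- Hensel's lemma: near roots correspond to roots with large derivative. -/
lemma card_nearRoots (k : ℕ) (f : ℤ_[p][X]) : (nearRoots k f).card =
    {x : ℤ_[p] | f.eval x = 0 ∧ (p : ℝ) ^ (-(k : ℤ)) < ‖f.derivative.eval x‖}.ncard := by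
  classical
  have : NeZero (p ^ k) := ⟨pow_ne_zero _ (Fact.out : p.Prime).ne_zero⟩
  set q : ℝ := (p : ℝ) ^ (-(k : ℤ)) with hq
  have hq0 : 0 < q := zpow_pos prime_pos_real _
  rw [← Set.ncard_coe_finset]
  symm
  refine Set.ncard_congr (fun x _ => (PadicInt.toZModPow k x).val) ?_ ?_ ?_
  · rintro x ⟨hx, hd⟩
    have hc := norm_sub_val_le k x
    set c := (PadicInt.toZModPow k x).val with hcdef
    have hdc : ‖f.derivative.eval (c : ℤ_[p])‖ = ‖f.derivative.eval x‖ :=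
      norm_derivative_eq (hc.trans_lt hd)
    simp only [nearRoots, Finset.coe_filter, Finset.mem_range, Set.mem_ofPred_eq, IsNearRoot]
    refine ⟨ZMod.val_lt _, hdc ▸ hd, ?_⟩
    -- Taylor expansion at the root `x`: the linear term dominates, so `‖f(c)‖ = ‖f'(x)‖ ‖c - x‖`.
    obtain ⟨e, he⟩ := exists_taylor f x c
    rw [he, hx, zero_add, norm_mul, norm_add_eq_of_lt
      ((norm_mul_le_right _ _).trans_lt (hc.trans_lt hd)), hdc]
    exact mul_le_mul_of_nonneg_left hc (norm_nonneg _)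
  · rintro x y ⟨hx, hdx⟩ ⟨hy, _⟩ hxy
    have hxy' : ‖y - x‖ ≤ q := by
      rw [hq, norm_le_iff_pow_dvd, ← toZModPow_eq_iff]
      exact (ZMod.val_injective _ hxy).symm
    by_contra hne
    obtain ⟨e, he⟩ := exists_taylor f x y
    rw [hx, hy, zero_add, eq_comm, mul_eq_zero] at he
    have h1 := he.resolve_right (sub_ne_zero.2 (Ne.symm hne))
    have h2 := norm_add_eq_of_lt ((norm_mul_le_right e (y - x)).trans_lt (hxy'.trans_lt hdx))
    rw [h1, norm_zero] at h2
    rw [← h2] at hdx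
    exact absurd hdx hq0.not_gt
  · intro c hc
    simp only [nearRoots, Finset.coe_filter, Finset.mem_range, Set.mem_ofPred_eq, IsNearRoot]
      at hc
    obtain ⟨hck, hd, hf⟩ := hc
    have hd0 : 0 < ‖f.derivative.eval (c : ℤ_[p])‖ := hq0.trans hd
    have hensel := hensels_lemma (F := f) (a := (c : ℤ_[p])) (by
      refine hf.trans_lt ?_
      rw [pow_two]
      exact mul_lt_mul_of_pos_left hd hd0)
    obtain ⟨x, hx, hxc, hdx, -⟩ := hensel
    rw [coe_aeval_eq_eval] at hx
    simp only [coe_aeval_eq_eval] at hxc hdx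
    -- Hensel's lemma only bounds the distance from `c` to the root by the size of `f'(c)`; the
    -- bound on `f(c)` places the root in the residue class of `c` modulo `p ^ k`.
    have hdc : ‖(c : ℤ_[p]) - x‖ ≤ q := by
      obtain ⟨e, he⟩ := exists_taylor f x c
      have hlt : ‖e * ((c : ℤ_[p]) - x)‖ < ‖f.derivative.eval x‖ := by
        refine (norm_mul_le_right _ _).trans_lt ?_
        rw [norm_sub_rev, hdx]; exact hxc
      rw [hx, zero_add] at he
      rw [he, norm_mul, norm_add_eq_of_lt hlt, hdx] at hf
      exact le_of_mul_le_mul_left hf hd0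
    refine ⟨x, ⟨hx, hdx ▸ hd⟩, ?_⟩
    have : PadicInt.toZModPow k x = ((c : ℕ) : ZMod (p ^ k)) := by
      rw [← map_natCast (PadicInt.toZModPow (p := p) k), eq_comm, toZModPow_eq_iff,
        ← norm_le_iff_pow_dvd]
      exact hdc
    rw [this, ZMod.val_natCast_of_lt hck]

lemma card_nearRoots_le (k : ℕ) {f : ℤ_[p][X]} (hf : f ≠ 0) :
    (nearRoots k f).card ≤ numIntRoots f := by
  rw [card_nearRoots, numIntRoots_eq_ncard hf]
  exact Set.ncard_le_ncard (fun x hx => hx.1) (finite_int_roots hf)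

lemma tendsto_card_nearRoots {f : ℤ_[p][X]} (hf : f ≠ 0)
    (hs : ∀ x, f.eval x = 0 → f.derivative.eval x ≠ 0) :
    ∀ᶠ k in atTop, (nearRoots k f).card = numIntRoots f := by
  classical
  have h1 : ∀ᶠ k : ℕ in atTop, ∀ x ∈ f.roots.toFinset,
      (p : ℝ) ^ (-(k : ℤ)) < ‖f.derivative.eval x‖ := by
    refine (eventually_all_finset _).2 fun x hx => ?_
    have hx' : f.eval x = 0 := by simpa [hf] using hx
    have hpos : 0 < ‖f.derivative.eval x‖ := norm_pos_iff.2 (hs x hx')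
    have ht : Tendsto (fun k : ℕ => (p : ℝ) ^ (-(k : ℤ))) atTop (𝓝 0) := by
      have := tendsto_pow_atTop_nhds_zero_of_lt_one (inv_nonneg.2 (prime_pos_real (p := p)).le)
        (inv_lt_one_of_one_lt₀ (by exact_mod_cast (Fact.out : p.Prime).one_lt))
      simpa using this
    exact ht.eventually (gt_mem_nhds hpos)
  filter_upwards [h1] with k hk
  rw [card_nearRoots, numIntRoots_eq_ncard hf]
  congr 1
  ext x
  simp only [Set.mem_ofPred_eq]
  exact ⟨fun h => h.1, fun h => ⟨h, hk x (by simpa [hf] using h)⟩⟩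

end NearRoots

/-! ### Stability of the expectations in the degree -/

section Uniform

/-- The remainder of a random monic polynomial modulo a monic polynomial of smaller degree is
uniformly distributed. -/
lemma integral_modByMonic {m k : ℕ} {G : ℤ_[p][X]} (hG : G.Monic) (hGd : G.natDegree = m)
    {F : ℤ_[p][X] → ℝ} (hF : ∀ f, F (f %ₘ G) = F f)
    (hint : Integrable (fun a => F (monicPoly p (m + k) a)) (haarZpPow p (m + k))) :
    ∫ a, F (monicPoly p (m + k) a) ∂haarZpPow p (m + k) =
      ∫ L : Fin m → ℤ_[p], F (vecPoly L) ∂haarZpPow p m := by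
  rw [integral_haarZpPow_add_symm hint]
  have key : ∀ b : Fin k → ℤ_[p],
      ∫ a, F (monicPoly p (m + k) (Fin.append a b)) ∂haarZpPow p m =
        ∫ L : Fin m → ℤ_[p], F (vecPoly L) ∂haarZpPow p m := by
    intro b
    -- With the top coefficients `b` fixed, the remainder is the low coefficient vector translated
    -- by `w`, and Haar measure is translation invariant.
    set w : Fin m → ℤ_[p] := fun i => ((X ^ (m + k) + X ^ m * vecPoly b) %ₘ G).coeff i with hw
    have hwd : vecPoly w = (X ^ (m + k) + X ^ m * vecPoly b) %ₘ G := by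
      refine vecPoly_coeff_of_degree_lt ?_
      have := degree_modByMonic_lt (X ^ (m + k) + X ^ m * vecPoly b) hG
      rwa [degree_eq_natDegree hG.ne_zero, hGd] at this
    rw [← integral_add_right_eq_self (μ := haarZpPow p m)
      (fun L : Fin m → ℤ_[p] => F (vecPoly L)) w]
    refine integral_congr_ae (Eventually.of_forall fun a => ?_)
    simp only
    rw [← hF, monicPoly_eq, vecPoly_append, vecPoly_add, hwd,
      show X ^ (m + k) + (vecPoly a + X ^ m * vecPoly b) =
        vecPoly a + (X ^ (m + k) + X ^ m * vecPoly b) by ring, add_modByMonic,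
      (modByMonic_eq_self_iff hG).2]
    rw [degree_eq_natDegree hG.ne_zero, hGd]
    exact degree_vecPoly_lt a
  simp only [key]
  simp

lemma continuous_eval_monicPoly (n : ℕ) (c : ℤ_[p]) :
    Continuous fun a => (monicPoly p n a).eval c := by
  simp only [monicPoly, eval_add, eval_pow, eval_X, eval_finsetSum, eval_mul, eval_C]
  fun_prop

lemma continuous_eval_derivative_monicPoly (n : ℕ) (c : ℤ_[p]) :
    Continuous fun a => (monicPoly p n a).derivative.eval c := by
  simp only [monicPoly, derivative_add, derivative_sum, derivative_C_mul, eval_add, eval_finsetSum,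
    eval_mul, eval_C]
  fun_prop

/-- The value at `c` is the remainder modulo `X - c`, hence uniform in `ℤ_[p]`. -/
lemma real_pow_dvd_eval_monicPoly (n k : ℕ) (c : ℤ_[p]) :
    (haarZpPow p (n + 1)).real {a | (p : ℤ_[p]) ^ k ∣ (monicPoly p (n + 1) a).eval c} =
      ((p : ℝ) ^ k)⁻¹ := by
  classical
  rw [add_comm n 1]
  have hset : MeasurableSet
      {a : Fin (1 + n) → ℤ_[p] | (p : ℤ_[p]) ^ k ∣ (monicPoly p (1 + n) a).eval c} := by
    have := (isOpen_setOf_pow_dvd_sub k (0 : ℤ_[p])).preimage (continuous_eval_monicPoly (1 + n) c)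
    simp only [sub_zero] at this
    exact this.measurableSet
  set F : ℤ_[p][X] → ℝ := fun f => if (p : ℤ_[p]) ^ k ∣ f.eval c then 1 else 0 with hF
  have hF' : ∀ f, F (f %ₘ (X - C c)) = F f := by
    intro f
    simp only [hF, modByMonic_X_sub_C_eq_C_eval, eval_C]
  have hFi : (fun a => F (monicPoly p (1 + n) a)) = Set.indicator
      {a : Fin (1 + n) → ℤ_[p] | (p : ℤ_[p]) ^ k ∣ (monicPoly p (1 + n) a).eval c}
        (fun _ => 1) := by
    funext a
    simp [hF, Set.indicator_apply]
  have h1 := integral_modByMonic (k := n) (monic_X_sub_C c) (natDegree_X_sub_C c) hF'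
    (by rw [hFi]; exact (integrable_const _).indicator hset)
  have hLi : (fun L : Fin 1 → ℤ_[p] => F (vecPoly L)) =
      Set.indicator (cyl k (0 : Fin 1 → ℤ_[p])) (fun _ => 1) := by
    funext L
    simp [hF, Set.indicator_apply, cyl, vecPoly]
  rw [hFi, integral_indicator_const _ hset, hLi,
    integral_indicator_const _ (measurableSet_cyl _ _), real_haarZpPow_cyl] at h1
  simpa using h1

/-- Almost every monic polynomial has only simple roots in `ℤ_[p]`. -/
lemma ae_simple_roots (n : ℕ) : ∀ᵐ a ∂haarZpPow p (n + 1),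
    ∀ x, (monicPoly p (n + 1) a).eval x = 0 → (monicPoly p (n + 1) a).derivative.eval x ≠ 0 := by
  have hp := prime_pos_real (p := p)
  set Bad : Set (Fin (n + 1) → ℤ_[p]) := {a | ¬ ∀ x, (monicPoly p (n + 1) a).eval x = 0 →
    (monicPoly p (n + 1) a).derivative.eval x ≠ 0} with hBad
  have hle : ∀ k : ℕ, (haarZpPow p (n + 1)).real Bad ≤ ((p : ℝ)⁻¹) ^ k := by
    intro k
    have : NeZero (p ^ k) := ⟨pow_ne_zero _ (Fact.out : p.Prime).ne_zero⟩
    -- A multiple root congruent to `c` modulo `p ^ k` forces `p ^ (2k) ∣ f(c)`. This has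
    -- probability `p ^ (-2k)` for each of the `p ^ k` residues, so the union has measure at most `p
    -- ^ (-k)`.
    have hsub : Bad ⊆ ⋃ c ∈ Finset.range (p ^ k), {a : Fin (n + 1) → ℤ_[p] |
        (p : ℤ_[p]) ^ (k + k) ∣ (monicPoly p (n + 1) a).eval (c : ℤ_[p])} := by
      intro a ha
      simp only [hBad, Set.mem_ofPred_eq, not_forall, not_not] at ha
      obtain ⟨x, hx, hx'⟩ := ha
      simp only [Set.mem_iUnion, Set.mem_ofPred_eq, Finset.mem_range]
      refine ⟨(PadicInt.toZModPow k x).val, ZMod.val_lt _, ?_⟩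
      obtain ⟨e, he⟩ := exists_taylor (monicPoly p (n + 1) a) x
        ((PadicInt.toZModPow k x).val : ℤ_[p])
      have hd : (p : ℤ_[p]) ^ k ∣ ((PadicInt.toZModPow k x).val : ℤ_[p]) - x := by
        rw [dvd_sub_comm, pow_dvd_sub_natCast_val]
      rw [he, hx, hx', zero_add, zero_add, pow_add]
      exact mul_dvd_mul (hd.mul_left _) hd
    calc (haarZpPow p (n + 1)).real Bad ≤ _ := measureReal_mono hsub (measure_ne_top _ _)
      _ ≤ ∑ c ∈ Finset.range (p ^ k), (haarZpPow p (n + 1)).real {a : Fin (n + 1) → ℤ_[p] |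
        (p : ℤ_[p]) ^ (k + k) ∣ (monicPoly p (n + 1) a).eval (c : ℤ_[p])} :=
          measureReal_biUnion_finset_le _ _
      _ = _ := by
        simp only [real_pow_dvd_eval_monicPoly, Finset.sum_const, Finset.card_range, nsmul_eq_mul]
        push_cast
        rw [pow_add, inv_pow]
        field_simp
  have h0 : (haarZpPow p (n + 1)).real Bad = 0 :=
    le_antisymm (ge_of_tendsto' (tendsto_pow_atTop_nhds_zero_of_lt_one (inv_nonneg.2 hp.le)
      (inv_lt_one_of_one_lt₀ (by exact_mod_cast (Fact.out : p.Prime).one_lt))) hle)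
      measureReal_nonneg
  rw [ae_iff]
  exact (measureReal_eq_zero_iff).1 h0

open Classical in
/-- The indicator of the event that all elements of `S` are near roots. -/
def nearIndicator (k : ℕ) (S : Finset ℕ) (f : ℤ_[p][X]) : ℝ :=
  if ∀ c ∈ S, IsNearRoot k f c then 1 else 0

/-- Being a near root at `c` involves only `f(c)` and `f'(c)`, which depend only on `f` modulo `(X -
c) ^ 2`. -/
lemma nearIndicator_modByMonic (k : ℕ) (S : Finset ℕ) (f : ℤ_[p][X]) :
    nearIndicator k S (f %ₘ ∏ c ∈ S, (X - C (c : ℤ_[p])) ^ 2) = nearIndicator k S f := by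
  classical
  set G : ℤ_[p][X] := ∏ c ∈ S, (X - C (c : ℤ_[p])) ^ 2 with hG
  have key : ∀ c ∈ S, IsNearRoot k (f %ₘ G) c ↔ IsNearRoot k f c := by
    intro c hc
    obtain ⟨Q, hQ⟩ : (X - C (c : ℤ_[p])) ^ 2 ∣ G :=
      Finset.dvd_prod_of_mem (fun c : ℕ => (X - C (c : ℤ_[p])) ^ 2) hc
    have hf : f = f %ₘ G + (X - C (c : ℤ_[p])) ^ 2 * (Q * (f /ₘ G)) := by
      rw [← mul_assoc, ← hQ, modByMonic_add_div]
    have h1 : f.eval (c : ℤ_[p]) = (f %ₘ G).eval (c : ℤ_[p]) := by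
      conv_lhs => rw [hf]
      simp
    have h2 : f.derivative.eval (c : ℤ_[p]) = (f %ₘ G).derivative.eval (c : ℤ_[p]) := by
      conv_lhs => rw [hf]
      simp [derivative_mul, derivative_pow]
    simp only [IsNearRoot, h1, h2]
  simp only [nearIndicator]
  congr 1
  exact propext (forall₂_congr key)

lemma measurable_nearIndicator (n k : ℕ) (S : Finset ℕ) :
    Measurable fun a => nearIndicator k S (monicPoly p n a) := by
  classical
  refine Measurable.ite ?_ measurable_const measurable_const
  have : {a | ∀ c ∈ S, IsNearRoot k (monicPoly p n a) c} =
      ⋂ c ∈ S, {a | IsNearRoot k (monicPoly p n a) c} := by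
    ext a; simp
  rw [this]
  refine Finset.measurableSet_biInter _ fun c _ => ?_
  have h1 := (continuous_eval_monicPoly n (c : ℤ_[p])).norm.measurable
  have h2 := (continuous_eval_derivative_monicPoly n (c : ℤ_[p])).norm.measurable
  exact (measurableSet_lt measurable_const h2).inter (measurableSet_le h1 (h2.mul_const _))

lemma choose_card_nearRoots (k d : ℕ) (f : ℤ_[p][X]) : ((nearRoots k f).card.choose d : ℝ) =
    ∑ S ∈ (Finset.range (p ^ k)).powersetCard d, nearIndicator k S f := by
  classical
  rw [← Finset.card_powersetCard]
  simp only [nearIndicator, Finset.sum_boole]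
  congr 2
  ext S
  simp only [Finset.mem_powersetCard, Finset.mem_filter, nearRoots, Finset.subset_iff,
    Finset.mem_range]
  constructor
  · rintro ⟨h1, h2⟩
    exact ⟨⟨fun x hx => (h1 hx).1, h2⟩, fun c hc => (h1 hc).2⟩
  · rintro ⟨⟨h1, h2⟩, h3⟩
    exact ⟨fun x hx => ⟨h1 hx, h3 x hx⟩, h2⟩

/-- For each `d`-set of residues the modulus has degree `2 d`, whence the threshold; the value
obtained does not involve `j`. -/
lemma integral_choose_nearRoots (d j k : ℕ) :
    ∫ a, ((nearRoots k (monicPoly p (2 * d + j) a)).card.choose d : ℝ) ∂haarZpPow p (2 * d + j) =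
      ∑ S ∈ (Finset.range (p ^ k)).powersetCard d,
        ∫ L : Fin (2 * d) → ℤ_[p], nearIndicator k S (vecPoly L) ∂haarZpPow p (2 * d) := by
  have hint : ∀ S, Integrable (fun a => nearIndicator k S (monicPoly p (2 * d + j) a))
      (haarZpPow p (2 * d + j)) := by
    intro S
    refine Integrable.of_bound (measurable_nearIndicator _ _ _).aestronglyMeasurable 1 ?_
    refine Eventually.of_forall fun a => ?_
    rw [nearIndicator]
    split_ifs <;> simp
  simp only [choose_card_nearRoots]
  rw [integral_finsetSum _ fun S _ => hint S]
  refine Finset.sum_congr rfl fun S hS => ?_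
  have hcard := (Finset.mem_powersetCard.1 hS).2
  refine integral_modByMonic (monic_prod_of_monic _ _ fun c _ => (monic_X_sub_C _).pow 2) ?_
    (nearIndicator_modByMonic k S) (hint S)
  rw [natDegree_prod_of_monic _ _ fun c _ => (monic_X_sub_C _).pow 2]
  simp only [natDegree_pow, natDegree_X_sub_C, mul_one, Finset.sum_const, hcard, smul_eq_mul]
  ring

/-- By dominated convergence the expectation is the limit in `k` of its near-root version, which is
the same for all degrees at least `2 d`. -/
theorem alpha_eq_of_le {n d : ℕ} (h : 2 * d ≤ n) : alpha p n d = alpha p (2 * d) d := by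
  -- For `d = 0` the count is constantly `1`; otherwise the degree is positive, as `ae_simple_roots`
  -- requires.
  rcases Nat.eq_zero_or_pos d with rfl | hd
  · simp [alpha, numRootSets_eq]
  have key : ∀ j, Tendsto (fun k => ∑ S ∈ (Finset.range (p ^ k)).powersetCard d,
      ∫ L : Fin (2 * d) → ℤ_[p], nearIndicator k S (vecPoly L) ∂haarZpPow p (2 * d)) atTop
        (𝓝 (alpha p (2 * d + j) d)) := by
    intro j
    simp only [← integral_choose_nearRoots d j]
    have hmonic : ∀ a, (monicPoly p (2 * d + j) a).Monic := fun a => monic_X_pow_add_vecPoly a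
    rw [alpha]
    refine tendsto_integral_of_dominated_convergence
      (fun _ => (((2 * d + j).choose d : ℕ) : ℝ)) (fun k => ?_) (integrable_const _)
      (fun k => Eventually.of_forall fun a => ?_) ?_
    · simp only [choose_card_nearRoots]
      exact (Finset.measurable_sum _ fun S _ =>
        measurable_nearIndicator _ _ _).aestronglyMeasurable
    · rw [Real.norm_of_nonneg (by positivity)]
      have h1 := card_nearRoots_le k (hmonic a).ne_zero
      rw [← numRoots_monicPoly] at h1
      exact_mod_cast Nat.choose_le_choose d (h1.trans (numRoots_monicPoly_le p _ a))
    · have hae : ∀ᵐ a ∂haarZpPow p (2 * d + j), ∀ x, (monicPoly p (2 * d + j) a).eval x = 0 →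
          (monicPoly p (2 * d + j) a).derivative.eval x ≠ 0 := by
        obtain ⟨m, hm⟩ : ∃ m, 2 * d + j = m + 1 := ⟨2 * d + j - 1, by omega⟩
        rw [hm]
        exact ae_simple_roots m
      filter_upwards [hae] with a ha
      refine tendsto_const_nhds.congr' ?_
      filter_upwards [tendsto_card_nearRoots (hmonic a).ne_zero ha] with k hk
      rw [numRootSets_eq, numRoots_monicPoly, hk]
  obtain ⟨j, rfl⟩ := Nat.exists_eq_add_of_le h
  exact tendsto_nhds_unique (key j) (by simpa using key 0)

end Uniform

end PadicRoots

end

noncomputable section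

namespace PadicRoots

variable (p : ℕ) [Fact p.Prime]

/-! ### Degree bounds and values at `1` -/

section Degree

lemma coeff_serR (d n : ℕ) :
    PowerSeries.coeff n (serR p d) = (PowerSeries.coeff n (serRP p)).coeff d := by
  rw [← coeff_swapVars, swapVars_serRP, PowerSeries.coeff_mk]

lemma coeff_serAP_coeff_eq_zero {n d : ℕ} (h : 2 * d < n) :
    (PowerSeries.coeff n (serAP p)).coeff d = 0 := by
  obtain ⟨m, rfl⟩ := Nat.exists_eq_add_of_lt h
  rw [serAP, coeff_one_sub_X_mul_succ, coeff_sub, coeff_alphaP, coeff_alphaP,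
    alpha_eq_of_le (by omega), alpha_eq_of_le (n := 2 * d + m) (by omega), sub_self]

/-- Induction on `d` through the logarithmic derivative relation: in the coefficient of `tⁿ u ^ d`
every term except the one with `(0, n)` has a factor that vanishes, either by the bound for `A` or
by induction. -/
lemma coeff_serBP_coeff_eq_zero {n d : ℕ} (h : 2 * d < n) :
    (PowerSeries.coeff n (serBP p)).coeff d = 0 := by
  induction d using Nat.strong_induction_on generalizing n with
  | _ d ih =>
  have hs := isRootSystem_real p
  have hc := congrArg (fun f => f.coeff d) (hs.conv n)
  simp only [finsetSum_coeff, coeff_C_mul, coeff_zero] at hc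
  rw [Finset.sum_eq_single (0, n)] at hc
  · rw [hs.a_zero, one_mul] at hc
    simp only [Nat.cast_zero, zero_sub, pow_zero, mul_one, neg_mul, neg_eq_zero, mul_eq_zero,
      Nat.cast_eq_zero] at hc
    rcases hc with (hc | hc) | hc
    · exact absurd hc (Fact.out : p.Prime).ne_zero
    · omega
    · exact hc
  · rintro ⟨i, j⟩ hij hne
    rw [Finset.HasAntidiagonal.mem_antidiagonal] at hij
    simp only at hij ⊢
    rw [Polynomial.coeff_mul, Finset.sum_eq_zero, mul_zero]
    rintro ⟨d₁, d₂⟩ hd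
    rw [Finset.HasAntidiagonal.mem_antidiagonal] at hd
    simp only at hd ⊢
    by_cases hi : 2 * d₁ < i
    · rw [coeff_serAP_coeff_eq_zero p hi, zero_mul]
    · have : d₁ ≠ 0 := by
        rintro rfl
        exact hne (Prod.ext_iff.2 ⟨by simp only; omega, by simp only; omega⟩)
      rw [ih d₂ (by omega) (by omega), mul_zero]
  · intro hne
    exact absurd (Finset.HasAntidiagonal.mem_antidiagonal.2 (zero_add n)) hne

lemma coeff_serRP_coeff_eq_zero {n d : ℕ} (h : 2 * d < n) :
    (PowerSeries.coeff n (serRP p)).coeff d = 0 := by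
  rw [serRP_eq, PowerSeries.coeff_mul, finsetSum_coeff]
  refine Finset.sum_eq_zero ?_
  rintro ⟨i, j⟩ hij
  rw [Finset.HasAntidiagonal.mem_antidiagonal] at hij
  simp only at hij ⊢
  rw [PowerSeries.coeff_rescale, ← C_pow, mul_assoc, coeff_C_mul, Polynomial.coeff_mul,
    Finset.sum_eq_zero, mul_zero]
  rintro ⟨d₁, d₂⟩ hd
  rw [Finset.HasAntidiagonal.mem_antidiagonal] at hd
  simp only at hd ⊢
  by_cases hi : 2 * d₁ < i
  · rw [coeff_serAP_coeff_eq_zero p hi, zero_mul]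
  · rw [coeff_serBP_coeff_eq_zero p (by omega : 2 * d₂ < j), mul_zero]

lemma coe_trunc_eq {f : PowerSeries ℝ} {m : ℕ} (h : ∀ n, m < n → PowerSeries.coeff n f = 0) :
    ((PowerSeries.trunc (m + 1) f : ℝ[X]) : PowerSeries ℝ) = f := by
  ext n
  rw [coeff_coe, PowerSeries.coeff_trunc]
  split_ifs with hn
  · rfl
  · exact (h n (by omega)).symm

lemma eval_trunc (f : PowerSeries ℝ) (m : ℕ) (x : ℝ) :
    (PowerSeries.trunc m f).eval x = ∑ i ∈ Finset.range m, PowerSeries.coeff i f * x ^ i := by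
  rw [Polynomial.eval, PowerSeries.eval₂_trunc_eq_sum_range]
  simp

lemma eval_trunc_eq_of_le {f : PowerSeries ℝ} {m k : ℕ}
    (h : ∀ n, m < n → PowerSeries.coeff n f = 0) (hk : m ≤ k) (x : ℝ) :
    (PowerSeries.trunc (m + 1) f).eval x =
      ∑ i ∈ Finset.range (k + 1), PowerSeries.coeff i f * x ^ i := by
  rw [eval_trunc]
  refine Finset.sum_subset (Finset.range_subset_range.2 (by omega)) fun i _ hi => ?_
  rw [h i (by rw [Finset.mem_range] at hi; omega), zero_mul]

/-- The polynomial `A_d`. -/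
def polyA (d : ℕ) : ℝ[X] := PowerSeries.trunc (2 * d + 1) (serA p d)

/-- The polynomial `B_d`. -/
def polyB (d : ℕ) : ℝ[X] := PowerSeries.trunc (2 * d + 1) (serB p d)

/-- The polynomial `R_d`. -/
def polyR (d : ℕ) : ℝ[X] := PowerSeries.trunc (2 * d + 1) (serR p d)

lemma coeff_serA_eq_zero {d : ℕ} (n : ℕ) (h : 2 * d < n) :
    PowerSeries.coeff n (serA p d) = 0 := by
  rw [coeff_serA, coeff_serAP_coeff_eq_zero p h]

lemma coeff_serB_eq_zero {d : ℕ} (n : ℕ) (h : 2 * d < n) :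
    PowerSeries.coeff n (serB p d) = 0 := by
  rw [coeff_serB, coeff_serBP_coeff_eq_zero p h]

lemma coeff_serR_eq_zero {d : ℕ} (n : ℕ) (h : 2 * d < n) :
    PowerSeries.coeff n (serR p d) = 0 := by
  rw [coeff_serR, coeff_serRP_coeff_eq_zero p h]

lemma coe_polyA (d : ℕ) : (polyA p d : PowerSeries ℝ) = serA p d :=
  coe_trunc_eq (coeff_serA_eq_zero p)

lemma coe_polyB (d : ℕ) : (polyB p d : PowerSeries ℝ) = serB p d :=
  coe_trunc_eq (coeff_serB_eq_zero p)

lemma coe_polyR (d : ℕ) : (polyR p d : PowerSeries ℝ) = serR p d :=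
  coe_trunc_eq (coeff_serR_eq_zero p)

lemma natDegree_trunc_succ_le (f : PowerSeries ℝ) (m : ℕ) :
    (PowerSeries.trunc (m + 1) f).natDegree ≤ m :=
  Nat.lt_succ_iff.1 (PowerSeries.natDegree_trunc_lt f m)

lemma alpha_eq_eval {n d : ℕ} (h : 2 * d ≤ n) : alpha p n d = (polyA p d).eval 1 := by
  rw [polyA, eval_trunc_eq_of_le (coeff_serA_eq_zero p) h]
  simp only [one_pow, mul_one]
  exact (sum_coeff_one_sub_X_mul (fun n => alpha p n d) n).symm

lemma beta_eq_eval {n d : ℕ} (h : 2 * d ≤ n) : beta p n d = (polyB p d).eval 1 := by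
  rw [polyB, eval_trunc_eq_of_le (coeff_serB_eq_zero p) h]
  simp only [one_pow, mul_one]
  exact (sum_coeff_one_sub_X_mul (fun n => beta p n d) n).symm

theorem mk_serR_eq_pow : (PowerSeries.mk fun d => serR p d : PowerSeries (PowerSeries ℝ)) =
    (PowerSeries.mk fun d => serB p d) ^ (p + 1) := by
  rw [mk_serR, mk_rescale_serA, pow_succ]

lemma mk_polyR : PowerSeries.mk (polyR p) = PowerSeries.mk (polyB p) ^ (p + 1) := by
  have hinj : Function.Injective
      (PowerSeries.map (Polynomial.coeToPowerSeries.ringHom (R := ℝ))) := by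
    intro F G h
    ext1 n
    have := congrArg (PowerSeries.coeff n) h
    rw [PowerSeries.coeff_map, PowerSeries.coeff_map] at this
    exact Polynomial.coe_injective ℝ this
  refine hinj ?_
  rw [map_pow]
  convert mk_serR_eq_pow p using 2
  · ext1 d
    simp [coe_polyR]
  · ext1 d
    simp [coe_polyB]

/-- The third relation of (b), telescoped. At an index where the right side vanishes it compares the
values of `B_d` at `1` and at `1/p`. -/
lemma sum_serBP_sub (n : ℕ) :
    ∑ i ∈ Finset.range (n + 1), PowerSeries.coeff i (serBP p) -
      ∑ i ∈ Finset.range n, C (((p : ℝ) ^ i)⁻¹) * PowerSeries.coeff i (serBP p) =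
    C (((p : ℝ) ^ n.choose 2)⁻¹) * PowerSeries.coeff n (serAP p) := by
  have hs := isRootSystem_real p
  induction n with
  | zero =>
    have h1 := hs.a_zero
    have h2 := hs.b_zero
    beta_reduce at h1 h2
    simp [h1, h2]
  | succ n ih =>
    have hp := (prime_pos_real (p := p)).ne'
    have hst := hs.step n
    rw [Finset.sum_range_succ, Finset.sum_range_succ (fun i => C _ * _) n, add_sub_add_comm, ih, hst, mul_sub,
      ← mul_assoc, ← C_mul]
    have : ((p : ℝ) ^ (n + 1).choose 2)⁻¹ * (p : ℝ) ^ n = ((p : ℝ) ^ n.choose 2)⁻¹ := by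
      rw [Nat.choose_succ_succ' n 1, Nat.choose_one_right, pow_add]
      field_simp
    rw [this]
    ring

lemma eval_polyB_inv (d : ℕ) : (polyB p d).eval (p : ℝ)⁻¹ = (polyB p d).eval 1 := by
  -- At index `2 d + 1` the coefficient of `A_d` is zero and both partial sums already contain all
  -- of `B_d`.
  have h := congrArg (fun f => f.coeff d) (sum_serBP_sub p (2 * d + 1))
  simp only [coeff_sub, finsetSum_coeff, coeff_C_mul, ← coeff_serB, ← coeff_serA] at h
  rw [coeff_serA_eq_zero p _ (Nat.lt_succ_self _), mul_zero, Finset.sum_range_succ,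
    coeff_serB_eq_zero p _ (Nat.lt_succ_self _), add_zero, sub_eq_zero] at h
  rw [polyB, eval_trunc, eval_trunc]
  simp only [one_pow, mul_one, inv_pow]
  rw [h]
  exact Finset.sum_congr rfl fun i _ => mul_comm _ _

lemma eval_polyR_inv (d : ℕ) : (polyR p d).eval (p : ℝ)⁻¹ = (polyR p d).eval 1 := by
  have h : ∀ x : ℝ, PowerSeries.mk (fun d => (polyR p d).eval x) =
      PowerSeries.mk (fun d => (polyB p d).eval x) ^ (p + 1) := by
    intro x
    have := congrArg (PowerSeries.map (evalRingHom x)) (mk_polyR p)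
    rw [map_pow] at this
    convert this using 2 <;>
    · ext1 d
      simp
  have h' := (h (p : ℝ)⁻¹).trans ((congrArg (fun f => PowerSeries.mk f ^ (p + 1))
    (funext fun d => eval_polyB_inv p d)).trans (h 1).symm)
  simpa using congrArg (PowerSeries.coeff d) h'

lemma sum_coeff_one_sub_C_mul_X_mul {K : Type*} [Field K] {x : K} (hx : x ≠ 0)
    (F : PowerSeries K) (n : ℕ) :
    ∑ i ∈ Finset.range (n + 1),
      PowerSeries.coeff i ((1 - PowerSeries.C x * PowerSeries.X) * F) * x⁻¹ ^ i =
    PowerSeries.coeff n F * x⁻¹ ^ n := by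
  induction n with
  | zero => simp
  | succ n ih =>
    rw [Finset.sum_range_succ, ih, sub_mul, one_mul, map_sub, mul_assoc, PowerSeries.coeff_C_mul,
      PowerSeries.coeff_succ_X_mul, pow_succ]
    field_simp
    ring

/-- Partial fractions for `1 / ((1 - t) (1 - x t))`. The sums run up to `n + 1` although the result
is the coefficient of index `n`; this is the gain of one in the range for `ρ`. -/
lemma sum_coeff_two_factors {K : Type*} [Field K] {x : K} (hx : x ≠ 0) (F : PowerSeries K)
    (n : ℕ) :
    x ^ (n + 1) * (∑ i ∈ Finset.range (n + 1 + 1), PowerSeries.coeff i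
      ((1 - PowerSeries.X) * (1 - PowerSeries.C x * PowerSeries.X) * F) * x⁻¹ ^ i) -
    ∑ i ∈ Finset.range (n + 1 + 1), PowerSeries.coeff i
      ((1 - PowerSeries.X) * (1 - PowerSeries.C x * PowerSeries.X) * F) * 1 ^ i =
    (x - 1) * PowerSeries.coeff n F := by
  have h1 := sum_coeff_one_sub_C_mul_X_mul hx ((1 - PowerSeries.X) * F) (n + 1)
  have h2 := sum_coeff_one_sub_C_mul_X_mul (one_ne_zero : (1 : K) ≠ 0)
    ((1 - PowerSeries.C x * PowerSeries.X) * F) (n + 1)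
  rw [map_one, one_mul, ← mul_assoc] at h2
  rw [← mul_assoc, mul_comm (1 - PowerSeries.C x * PowerSeries.X)] at h1
  simp only [inv_one] at h2
  rw [h1, h2, one_pow, mul_one, mul_left_comm, inv_pow, mul_inv_cancel₀ (pow_ne_zero _ hx),
    mul_one]
  simp only [sub_mul, one_mul, map_sub, mul_assoc, PowerSeries.coeff_C_mul,
    PowerSeries.coeff_succ_X_mul]
  ring

/-- Once the partial sums are the full values, `p ^ (n + 1) R_d(1/p) - R_d(1) = (p ^ (n + 1) - 1)
ρ(n, d)`, and the two values of `R_d` coincide. -/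
theorem rho_eq_eval {n d : ℕ} (h : 2 * d ≤ n + 1) : rho p n d = (polyR p d).eval 1 := by
  have hp0 := (prime_pos_real (p := p)).ne'
  have hp1 : (1 : ℝ) < p := by exact_mod_cast (Fact.out : p.Prime).one_lt
  have key := sum_coeff_two_factors hp0
    (PowerSeries.mk fun n => (∑ i ∈ Finset.range (n + 1), (p : ℝ) ^ i) * rho p n d) n
  change (p : ℝ) ^ (n + 1) * (∑ i ∈ Finset.range (n + 1 + 1), PowerSeries.coeff i (serR p d) *
    (p : ℝ)⁻¹ ^ i) - ∑ i ∈ Finset.range (n + 1 + 1), PowerSeries.coeff i (serR p d) * 1 ^ i = _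
    at key
  rw [← eval_trunc_eq_of_le (coeff_serR_eq_zero p) h, ← eval_trunc_eq_of_le
    (coeff_serR_eq_zero p) h, ← polyR, eval_polyR_inv, PowerSeries.coeff_mk,
    geom_sum_eq hp1.ne'] at key
  have h1 : (p : ℝ) - 1 ≠ 0 := by linarith
  have h2 : (p : ℝ) ^ (n + 1) - 1 ≠ 0 := by
    have := one_lt_pow₀ hp1 n.add_one_ne_zero
    linarith
  have e : ((p : ℝ) - 1) * (((p : ℝ) ^ (n + 1) - 1) / ((p : ℝ) - 1) * rho p n d) =
      ((p : ℝ) ^ (n + 1) - 1) * rho p n d := by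
    rw [← mul_assoc, mul_div_cancel₀ _ h1]
  refine (mul_left_cancel₀ h2 ?_).symm
  linear_combination key + e

end Degree

end PadicRoots

end

noncomputable section

namespace PadicRoots

variable (p : ℕ) [Fact p.Prime]

/-! ### Values of rational functions without poles -/

section Values

/-- `HasValue` refers to the reduced denominator, which divides any other one; this permits
computing with unreduced fractions. -/
lemma hasValue_div {P Q : ℚ[X]} {x : ℝ} (hQ : aeval x Q ≠ 0) :
    HasValue (algebraMap ℚ[X] (RatFunc ℚ) P / algebraMap ℚ[X] (RatFunc ℚ) Q) x
      (aeval x P / aeval x Q) := by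
  have hQ0 : Q ≠ 0 := by rintro rfl; simp at hQ
  set F := algebraMap ℚ[X] (RatFunc ℚ) P / algebraMap ℚ[X] (RatFunc ℚ) Q with hF
  have hd : aeval x F.denom ≠ 0 := by
    obtain ⟨e, he⟩ := RatFunc.denom_div_dvd P Q
    intro h0
    rw [he, map_mul, ← hF, h0, zero_mul] at hQ
    exact hQ rfl
  refine ⟨hd, ?_⟩
  have h := congrArg (aeval x) ((RatFunc.num_mul_eq_mul_denom_iff hQ0).2 hF)
  rw [map_mul, map_mul] at h
  rw [RatFunc.eval, ← aeval_def, ← aeval_def, div_eq_div_iff hd hQ, h]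

lemma HasValue.eq_div {F : RatFunc ℚ} {x v : ℝ} (h : HasValue F x v) :
    aeval x F.num / aeval x F.denom = v := h.2

lemma HasValue.add {F G : RatFunc ℚ} {x v w : ℝ} (hF : HasValue F x v) (hG : HasValue G x w) :
    HasValue (F + G) x (v + w) := by
  have := hasValue_div (P := F.num * G.denom + F.denom * G.num) (Q := F.denom * G.denom) (x := x)
    (by rw [map_mul]; exact mul_ne_zero hF.1 hG.1)
  rw [← hF.eq_div, ← hG.eq_div, div_add_div _ _ hF.1 hG.1]
  simp only [map_mul, map_add] at this
  rw [← div_add_div _ _ (RatFunc.algebraMap_ne_zero F.denom_ne_zero)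
    (RatFunc.algebraMap_ne_zero G.denom_ne_zero), RatFunc.num_div_denom,
    RatFunc.num_div_denom] at this
  exact this

lemma HasValue.mul {F G : RatFunc ℚ} {x v w : ℝ} (hF : HasValue F x v) (hG : HasValue G x w) :
    HasValue (F * G) x (v * w) := by
  have := hasValue_div (P := F.num * G.num) (Q := F.denom * G.denom) (x := x)
    (by rw [map_mul]; exact mul_ne_zero hF.1 hG.1)
  rw [← hF.eq_div, ← hG.eq_div, div_mul_div_comm]
  simp only [map_mul] at this
  rw [← div_mul_div_comm, RatFunc.num_div_denom, RatFunc.num_div_denom] at this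
  exact this

lemma HasValue.inv {F : RatFunc ℚ} {x v : ℝ} (hF : HasValue F x v) (hv : v ≠ 0) :
    HasValue F⁻¹ x v⁻¹ := by
  have hn : aeval x F.num ≠ 0 := by
    intro h0
    rw [← hF.eq_div, h0, zero_div] at hv
    exact hv rfl
  have := hasValue_div (P := F.denom) (Q := F.num) hn
  rwa [← inv_div, RatFunc.num_div_denom, ← inv_div (aeval x F.num), hF.eq_div] at this

lemma hasValue_natCast (n : ℕ) (x : ℝ) : HasValue (n : RatFunc ℚ) x n := by
  have := hasValue_div (P := (n : ℚ[X])) (Q := 1) (x := x) (by simp)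
  simpa using this

lemma hasValue_intCast (n : ℤ) (x : ℝ) : HasValue (n : RatFunc ℚ) x n := by
  have := hasValue_div (P := (n : ℚ[X])) (Q := 1) (x := x) (by simp)
  simpa using this

lemma hasValue_X (x : ℝ) : HasValue RatFunc.X x x := by
  have := hasValue_div (P := (X : ℚ[X])) (Q := 1) (x := x) (by simp)
  simpa using this

lemma hasValue_zero (x : ℝ) : HasValue 0 x 0 := by simpa using hasValue_natCast 0 x

lemma hasValue_one (x : ℝ) : HasValue 1 x 1 := by simpa using hasValue_natCast 1 x

lemma HasValue.neg {F : RatFunc ℚ} {x v : ℝ} (hF : HasValue F x v) : HasValue (-F) x (-v) := by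
  simpa using (hasValue_intCast (-1) x).mul hF

lemma HasValue.sub {F G : RatFunc ℚ} {x v w : ℝ} (hF : HasValue F x v) (hG : HasValue G x w) :
    HasValue (F - G) x (v - w) := by
  simpa [sub_eq_add_neg] using hF.add hG.neg

lemma HasValue.pow {F : RatFunc ℚ} {x v : ℝ} (hF : HasValue F x v) (n : ℕ) :
    HasValue (F ^ n) x (v ^ n) := by
  induction n with
  | zero => simpa using hasValue_one x
  | succ n ih => rw [pow_succ, pow_succ]; exact ih.mul hF

lemma HasValue.sum {ι : Type*} {s : Finset ι} {F : ι → RatFunc ℚ} {x : ℝ} {v : ι → ℝ}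
    (h : ∀ i ∈ s, HasValue (F i) x (v i)) : HasValue (∑ i ∈ s, F i) x (∑ i ∈ s, v i) := by
  classical
  induction s using Finset.induction_on with
  | empty => simpa using hasValue_zero x
  | insert i s hi ih =>
    rw [Finset.sum_insert hi, Finset.sum_insert hi]
    exact (h i (Finset.mem_insert_self i s)).add
      (ih fun j hj => h j (Finset.mem_insert_of_mem hj))

/-- The coefficients of `F` have no pole at `x`, and `f` is the polynomial of their values. -/
def CoeffHasValue (F : (RatFunc ℚ)[X]) (x : ℝ) (f : ℝ[X]) : Prop :=
  ∀ d, HasValue (F.coeff d) x (f.coeff d)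

namespace CoeffHasValue

variable {F G : (RatFunc ℚ)[X]} {x v : ℝ} {f g : ℝ[X]}

lemma add (hF : CoeffHasValue F x f) (hG : CoeffHasValue G x g) : CoeffHasValue (F + G) x (f + g) :=
  fun d => by rw [coeff_add, coeff_add]; exact (hF d).add (hG d)

lemma sub (hF : CoeffHasValue F x f) (hG : CoeffHasValue G x g) : CoeffHasValue (F - G) x (f - g) :=
  fun d => by rw [coeff_sub, coeff_sub]; exact (hF d).sub (hG d)

lemma mul (hF : CoeffHasValue F x f) (hG : CoeffHasValue G x g) : CoeffHasValue (F * G) x (f * g) :=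
  fun d => by
    rw [Polynomial.coeff_mul, Polynomial.coeff_mul]
    exact HasValue.sum fun i _ => (hF i.1).mul (hG i.2)

lemma const {a : RatFunc ℚ} (h : HasValue a x v) : CoeffHasValue (C a) x (C v) := fun d => by
  rw [coeff_C, coeff_C]
  split_ifs
  · exact h
  · exact hasValue_zero x

lemma one : CoeffHasValue 1 x 1 := by simpa using const (hasValue_one x)

lemma X : CoeffHasValue Polynomial.X x Polynomial.X := fun d => by
  rw [coeff_X, coeff_X]
  split_ifs
  · exact hasValue_one x
  · exact hasValue_zero x

lemma sum {ι : Type*} {s : Finset ι} {F : ι → (RatFunc ℚ)[X]} {f : ι → ℝ[X]}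
    (h : ∀ i ∈ s, CoeffHasValue (F i) x (f i)) :
    CoeffHasValue (∑ i ∈ s, F i) x (∑ i ∈ s, f i) := fun d => by
  rw [finsetSum_coeff, finsetSum_coeff]
  exact HasValue.sum fun i hi => h i hi d

lemma pow (hF : CoeffHasValue F x f) (n : ℕ) : CoeffHasValue (F ^ n) x (f ^ n) := by
  induction n with
  | zero => simpa using one
  | succ n ih => rw [pow_succ, pow_succ]; exact ih.mul hF

lemma comp (hF : CoeffHasValue F x f) (hG : CoeffHasValue G x g) :
    CoeffHasValue (F.comp G) x (f.comp g) := by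
  rw [Polynomial.comp, Polynomial.comp,
    eval₂_eq_sum_range' C (Nat.lt_succ_of_le (le_max_left F.natDegree f.natDegree)),
    eval₂_eq_sum_range' C (Nat.lt_succ_of_le (le_max_right F.natDegree f.natDegree))]
  exact sum fun i _ => (const (hF i)).mul (hG.pow i)

end CoeffHasValue

end Values

/-! ### The substitution `X ↦ 1/X` -/

section Inversion

/-- Up to a power of `X`, the value at `1/X` is the reversed polynomial. Nonvanishing is what lets
the substitution extend to all rational functions. -/
lemma eval₂_C_X_inv_ne_zero {P : ℚ[X]} (hP : P ≠ 0) :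
    P.eval₂ (RatFunc.C : ℚ →+* RatFunc ℚ) RatFunc.X⁻¹ ≠ 0 := by
  intro h
  let : Invertible (RatFunc.X⁻¹ : RatFunc ℚ) := invertibleOfNonzero (inv_ne_zero RatFunc.X_ne_zero)
  have hhom : eval₂RingHom (RatFunc.C : ℚ →+* RatFunc ℚ) RatFunc.X = algebraMap ℚ[X] (RatFunc ℚ) :=
    Polynomial.ringHom_ext (by simp) (by simp)
  rw [← eval₂_reverse_eq_zero_iff, invOf_eq_inv, inv_inv, ← coe_eval₂RingHom, hhom,
    map_eq_zero_iff _ (RatFunc.algebraMap_injective ℚ), reverse_eq_zero] at h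
  exact hP h

/-- The ring homomorphism `F ↦ F(1/X)`. -/
def invHom : RatFunc ℚ →+* RatFunc ℚ :=
  RatFunc.liftRingHom (eval₂RingHom RatFunc.C RatFunc.X⁻¹) fun P hP => by
    rw [Submonoid.mem_comap, mem_nonZeroDivisors_iff_ne_zero]
    exact eval₂_C_X_inv_ne_zero (nonZeroDivisors.ne_zero hP)

lemma invHom_apply (F : RatFunc ℚ) : invHom F = substInv F := by
  rw [invHom, RatFunc.liftRingHom_apply]
  rfl

lemma invHom_X : invHom RatFunc.X = RatFunc.X⁻¹ := by
  rw [invHom_apply, substInv, RatFunc.eval_X]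

end Inversion

/-! ### Solving the recurrences over `ℚ(X)` -/

section Solve

variable {L : Type*} [Field L]

/-- The interior terms of the relation `IsRootSystem.conv`, in degree `n + 1`. -/
def convMid (x : L) (a b : ℕ → L[X]) (n : ℕ) : L[X] :=
  ∑ i ∈ Finset.range n,
    C ((((i + 1 : ℕ) : L) - x * ((n - i : ℕ) : L)) * x ^ (i + 1)) * (a (i + 1) * b (n - i))

/-- The terms of lower index in the relation `IsRootSystem.step`. -/
def stepRest (x : L) (a b : ℕ → L[X]) (n : ℕ) : L[X] :=
  C (x ^ n)⁻¹ * b n - C ((x ^ (n + 1).choose 2)⁻¹ * x ^ n) * a n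

/-- The determinant of the linear system for `a (n + 1)` and `b (n + 1)`. -/
def stepDet (x : L) (n : ℕ) : L :=
  ((n + 1 : ℕ) : L) * (x ^ (n + 1) - x * (x ^ (n + 1).choose 2)⁻¹)

/-- The value of `a (n + 1)` in terms of the values of lower index. -/
def nextA (x : L) (a b : ℕ → L[X]) (n : ℕ) : L[X] :=
  C (stepDet x n)⁻¹ * (C (x * ((n + 1 : ℕ) : L)) * stepRest x a b n - convMid x a b n)

/-- The value of `b (n + 1)` in terms of the values of lower index. -/
def nextB (x : L) (a b : ℕ → L[X]) (n : ℕ) : L[X] :=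
  C (x ^ (n + 1).choose 2)⁻¹ * nextA x a b n + stepRest x a b n

/-- The determinant can vanish only if `x ^ (n + (n + 1).choose 2) = 1`. For `n = 0` it is
identically zero, which is why the terms of index `1` are prescribed as initial data. -/
lemma stepDet_ne_zero [CharZero L] {x : L} (hx : x ≠ 0) (hx1 : ∀ m, 0 < m → x ^ m ≠ 1) {n : ℕ}
    (hn : 1 ≤ n) : stepDet x n ≠ 0 := by
  refine mul_ne_zero (Nat.cast_ne_zero.2 n.succ_ne_zero) ?_
  intro h
  refine hx1 (n + (n + 1).choose 2) (by omega) ?_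
  field_simp at h
  have h' : x * x ^ (n + (n + 1).choose 2) = x * 1 := by
    rw [pow_add]
    linear_combination h
  exact mul_left_cancel₀ hx h'

/-- Only the two extreme terms of the convolution contain unknowns of index `n + 1`; eliminating `b
(n + 1)` by the step relation leaves a linear equation for `a (n + 1)`. -/
lemma IsRootSystem.eq_next {x : L} {a b : ℕ → L[X]} (h : IsRootSystem x a b) {n : ℕ}
    (hdet : stepDet x n ≠ 0) : a (n + 1) = nextA x a b n ∧ b (n + 1) = nextB x a b n := by
  have hst : b (n + 1) = C (x ^ (n + 1).choose 2)⁻¹ * a (n + 1) + stepRest x a b n := by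
    rw [stepRest, C_mul]
    linear_combination h.step n
  have ha : a (n + 1) = nextA x a b n := by
    have hc := h.conv (n + 1)
    rw [Finset.Nat.sum_antidiagonal_eq_sum_range_succ_mk, Finset.sum_range_succ,
      Finset.sum_range_succ'] at hc
    simp only [Nat.add_sub_add_right, Nat.sub_self, Nat.sub_zero, h.a_zero, h.b_zero, one_mul,
      mul_one, pow_zero, Nat.cast_zero, mul_zero, sub_zero, zero_sub] at hc
    change convMid x a b n + _ + _ = 0 at hc
    rw [hst] at hc
    have e : C (stepDet x n) * a (n + 1) =
        C (x * ((n + 1 : ℕ) : L)) * stepRest x a b n - convMid x a b n := by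
      rw [stepDet]
      simp only [C_mul, C_sub, C_neg] at hc ⊢
      linear_combination hc
    rw [nextA, ← e, ← mul_assoc, ← C_mul, inv_mul_cancel₀ hdet, C_1, one_mul]
  exact ⟨ha, by rw [hst, nextB, ha]⟩

lemma stepRest_inv {x : L} (hx : x ≠ 0) (a b : ℕ → L[X]) (n : ℕ) :
    stepRest x⁻¹ b a n = C (-x ^ (n + 1).choose 2) * stepRest x a b n := by
  rw [stepRest, stepRest]
  ext d
  simp only [coeff_sub, coeff_C_mul, inv_pow, inv_inv]
  field_simp
  ring

lemma convMid_inv {x : L} (hx : x ≠ 0) (a b : ℕ → L[X]) (n : ℕ) :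
    convMid x⁻¹ b a n = C (-(x ^ (n + 2))⁻¹) * convMid x a b n := by
  rw [convMid, convMid, ← Finset.sum_range_reflect, Finset.mul_sum]
  refine Finset.sum_congr rfl fun i hi => ?_
  rw [Finset.mem_range] at hi
  obtain ⟨k, rfl⟩ := Nat.exists_eq_add_of_lt hi
  rw [show i + k + 1 - 1 - i + 1 = k + 1 by omega, show i + k + 1 - (i + k + 1 - 1 - i) = i + 1 by
    omega, show i + k + 1 - i = k + 1 by omega, mul_comm (b _), ← mul_assoc (C (-_)), ← C_mul]
  congr 2
  rw [inv_pow]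
  field_simp
  ring

/-- The duality behind (a): inverting `x` and exchanging the sequences multiplies the known terms
and the determinant by monomials up to sign, and exchanges the two solutions. -/
lemma nextA_inv {x : L} (hx : x ≠ 0) (a b : ℕ → L[X]) {n : ℕ} (hdet : stepDet x n ≠ 0) :
    nextA x⁻¹ b a n = nextB x a b n := by
  have hdet' : stepDet x⁻¹ n = -(x ^ (n + 1).choose 2 * (x ^ (n + 2))⁻¹) * stepDet x n := by
    rw [stepDet, stepDet, inv_pow, inv_pow, inv_inv]
    field_simp
    ring
  rw [nextB, nextA, nextA, hdet', stepRest_inv hx, convMid_inv hx]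
  have hd : stepDet x n * x ^ (n + 1).choose 2 =
      ((n + 1 : ℕ) : L) * (x ^ (n + 1) * x ^ (n + 1).choose 2 - x) := by
    rw [stepDet]
    field_simp
  ext d
  simp only [coeff_sub, coeff_add, coeff_C_mul]
  generalize (stepRest x a b n).coeff d = M
  generalize (convMid x a b n).coeff d = S
  generalize stepDet x n = D at hdet hd
  rw [pow_succ x (n + 1)]
  have hy : x ^ (n + 1) ≠ 0 := pow_ne_zero _ hx
  have hq : x ^ (n + 1).choose 2 ≠ 0 := pow_ne_zero _ hx
  generalize x ^ (n + 1) = y at *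
  generalize x ^ (n + 1).choose 2 = q at *
  generalize ((n + 1 : ℕ) : L) = N at *
  field_simp
  linear_combination -M * hd

lemma nextB_inv {x : L} (hx : x ≠ 0) (a b : ℕ → L[X]) {n : ℕ} (hdet : stepDet x⁻¹ n ≠ 0) :
    nextB x⁻¹ b a n = nextA x a b n := by
  rw [← nextA_inv (inv_ne_zero hx) b a hdet, inv_inv]

lemma map_stepRest {L' : Type*} [Field L'] (φ : L →+* L') (x : L) (a b : ℕ → L[X]) (n : ℕ) :
    (stepRest x a b n).map φ = stepRest (φ x) (fun i => (a i).map φ) (fun i => (b i).map φ) n := by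
  simp [stepRest]

lemma map_convMid {L' : Type*} [Field L'] (φ : L →+* L') (x : L) (a b : ℕ → L[X]) (n : ℕ) :
    (convMid x a b n).map φ = convMid (φ x) (fun i => (a i).map φ) (fun i => (b i).map φ) n := by
  simp only [convMid, Polynomial.map_sum, Polynomial.map_mul, map_C, map_mul φ, map_sub φ,
    map_pow φ, map_natCast φ]

lemma map_stepDet {L' : Type*} [Field L'] (φ : L →+* L') (x : L) (n : ℕ) :
    φ (stepDet x n) = stepDet (φ x) n := by
  simp [stepDet]

lemma map_nextA {L' : Type*} [Field L'] (φ : L →+* L') (x : L) (a b : ℕ → L[X]) (n : ℕ) :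
    (nextA x a b n).map φ = nextA (φ x) (fun i => (a i).map φ) (fun i => (b i).map φ) n := by
  simp only [nextA, Polynomial.map_mul, Polynomial.map_sub, map_stepRest, map_convMid, map_C,
    map_inv₀, map_stepDet, map_mul φ, map_natCast φ]

lemma map_nextB {L' : Type*} [Field L'] (φ : L →+* L') (x : L) (a b : ℕ → L[X]) (n : ℕ) :
    (nextB x a b n).map φ = nextB (φ x) (fun i => (a i).map φ) (fun i => (b i).map φ) n := by
  simp only [nextB, Polynomial.map_mul, Polynomial.map_add, map_stepRest, map_nextA, map_C,
    map_inv₀, map_pow]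

lemma stepRest_congr {x : L} {a b a' b' : ℕ → L[X]} {n : ℕ} (ha : ∀ i ≤ n, a i = a' i)
    (hb : ∀ i ≤ n, b i = b' i) : stepRest x a b n = stepRest x a' b' n := by
  rw [stepRest, stepRest, ha n le_rfl, hb n le_rfl]

lemma convMid_congr {x : L} {a b a' b' : ℕ → L[X]} {n : ℕ} (ha : ∀ i ≤ n, a i = a' i)
    (hb : ∀ i ≤ n, b i = b' i) : convMid x a b n = convMid x a' b' n :=
  Finset.sum_congr rfl fun i hi => by
    rw [ha (i + 1) (Finset.mem_range.1 hi), hb (n - i) (Nat.sub_le _ _)]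

lemma nextA_congr {x : L} {a b a' b' : ℕ → L[X]} {n : ℕ} (ha : ∀ i ≤ n, a i = a' i)
    (hb : ∀ i ≤ n, b i = b' i) : nextA x a b n = nextA x a' b' n := by
  rw [nextA, nextA, stepRest_congr ha hb, convMid_congr ha hb]

lemma nextB_congr {x : L} {a b a' b' : ℕ → L[X]} {n : ℕ} (ha : ∀ i ≤ n, a i = a' i)
    (hb : ∀ i ≤ n, b i = b' i) : nextB x a b n = nextB x a' b' n := by
  rw [nextB, nextB, stepRest_congr ha hb, nextA_congr ha hb]

lemma coeffHasValue_nextA {x : ℝ} (hx : x ≠ 0) {a b : ℕ → (RatFunc ℚ)[X]} {a' b' : ℕ → ℝ[X]}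
    {n : ℕ} (hdet : stepDet x n ≠ 0) (ha : ∀ i ≤ n, CoeffHasValue (a i) x (a' i))
    (hb : ∀ i ≤ n, CoeffHasValue (b i) x (b' i)) :
    CoeffHasValue (stepRest RatFunc.X a b n) x (stepRest x a' b' n) ∧
      CoeffHasValue (nextA RatFunc.X a b n) x (nextA x a' b' n) := by
  have hX := hasValue_X x
  have hs : CoeffHasValue (stepRest RatFunc.X a b n) x (stepRest x a' b' n) :=
    ((CoeffHasValue.const ((hX.pow n).inv (pow_ne_zero _ hx))).mul (hb n le_rfl)).sub
      ((CoeffHasValue.const (((hX.pow _).inv (pow_ne_zero _ hx)).mul (hX.pow n))).mul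
        (ha n le_rfl))
  have hc : CoeffHasValue (convMid RatFunc.X a b n) x (convMid x a' b' n) :=
    CoeffHasValue.sum fun i hi => (CoeffHasValue.const (((hasValue_natCast _ x).sub
      (hX.mul (hasValue_natCast _ x))).mul (hX.pow _))).mul
      ((ha _ (Finset.mem_range.1 hi)).mul (hb _ (Nat.sub_le _ _)))
  have hD : HasValue (stepDet RatFunc.X n) x (stepDet x n) :=
    (hasValue_natCast _ x).mul ((hX.pow _).sub (hX.mul ((hX.pow _).inv (pow_ne_zero _ hx))))
  exact ⟨hs, (CoeffHasValue.const (hD.inv hdet)).mul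
    (((CoeffHasValue.const (hX.mul (hasValue_natCast _ x))).mul hs).sub hc)⟩

lemma coeffHasValue_nextB {x : ℝ} (hx : x ≠ 0) {a b : ℕ → (RatFunc ℚ)[X]} {a' b' : ℕ → ℝ[X]}
    {n : ℕ} (hdet : stepDet x n ≠ 0) (ha : ∀ i ≤ n, CoeffHasValue (a i) x (a' i))
    (hb : ∀ i ≤ n, CoeffHasValue (b i) x (b' i)) :
    CoeffHasValue (nextB RatFunc.X a b n) x (nextB x a' b' n) := by
  obtain ⟨hs, hA⟩ := coeffHasValue_nextA hx hdet ha hb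
  exact ((CoeffHasValue.const (((hasValue_X x).pow _).inv (pow_ne_zero _ hx))).mul hA).add hs

lemma ratFunc_X_pow_ne_one {m : ℕ} (hm : 0 < m) : (RatFunc.X : RatFunc ℚ) ^ m ≠ 1 := by
  intro h
  rw [← RatFunc.algebraMap_X, ← map_pow, ← map_one (algebraMap ℚ[X] (RatFunc ℚ))] at h
  have := congrArg natDegree (RatFunc.algebraMap_injective ℚ h)
  rw [natDegree_X_pow, natDegree_one] at this
  omega

lemma natCast_pow_ne_one {m : ℕ} (hm : 0 < m) : (p : ℝ) ^ m ≠ 1 := by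
  have hp1 : (1 : ℝ) < p := by exact_mod_cast (Fact.out : p.Prime).one_lt
  exact (one_lt_pow₀ hp1 hm.ne').ne'

/-- The recursion is run over `ℚ(X)`. Its specialization at a prime is the real recursion, whose
determinants do not vanish there, so no poles arise at primes; the duality propagates from the
self-dual initial terms. -/
theorem exists_coeffHasValue_ser (n : ℕ) : ∃ A B : (RatFunc ℚ)[X],
    (∀ (p : ℕ) [Fact p.Prime], CoeffHasValue A p (PowerSeries.coeff n (serAP p)) ∧
      CoeffHasValue B p (PowerSeries.coeff n (serBP p))) ∧
    A.map invHom = B ∧ B.map invHom = A := by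
  induction n using Nat.strong_induction_on with
  | _ n ih =>
  match n, ih with
  | 0, _ =>
    refine ⟨1, 1, fun p _ => ?_, by simp, by simp⟩
    rw [(isRootSystem_real p).a_zero, (isRootSystem_real p).b_zero]
    exact ⟨.one, .one⟩
  | 1, _ =>
    refine ⟨X, X, fun p _ => ?_, by simp, by simp⟩
    rw [(isRootSystem_real p).a_one, (isRootSystem_real p).b_one]
    exact ⟨.X, .X⟩
  | n + 2, ih =>
    choose! A B hv hA hB using ih
    have hX := RatFunc.X_ne_zero (K := ℚ)
    refine ⟨nextA RatFunc.X A B (n + 1), nextB RatFunc.X A B (n + 1), fun p _ => ?_, ?_, ?_⟩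
    · have hp := (prime_pos_real (p := p)).ne'
      have hdet : stepDet (p : ℝ) (n + 1) ≠ 0 :=
        stepDet_ne_zero hp (fun m hm => natCast_pow_ne_one p hm) (by omega)
      obtain ⟨h1, h2⟩ := (isRootSystem_real p).eq_next hdet
      rw [h1, h2]
      exact ⟨(coeffHasValue_nextA hp hdet (fun i hi => (hv i (by omega) p).1)
        fun i hi => (hv i (by omega) p).2).2, coeffHasValue_nextB hp hdet
        (fun i hi => (hv i (by omega) p).1) fun i hi => (hv i (by omega) p).2⟩
    · rw [map_nextA, invHom_X, nextA_congr (fun i hi => hA i (by omega))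
        (fun i hi => hB i (by omega)), nextA_inv hX]
      exact stepDet_ne_zero hX (fun m hm => ratFunc_X_pow_ne_one hm) (by omega)
    · rw [map_nextB, invHom_X, nextB_congr (fun i hi => hA i (by omega))
        (fun i hi => hB i (by omega)), nextB_inv hX]
      refine stepDet_ne_zero (inv_ne_zero hX) (fun m hm h => ratFunc_X_pow_ne_one hm ?_) (by omega)
      rwa [inv_pow, inv_eq_one] at h

lemma rhoP_eq (n : ℕ) : rhoP p n = C ((∑ i ∈ Finset.range (n + 1), (p : ℝ) ^ i)⁻¹) *
    ∑ r ∈ Finset.range (n + 1), C ((p : ℝ) ^ r) * (alphaP p r * betaP p (n - r)) := by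
  have hp := prime_pos_real (p := p)
  have h0 : (∑ i ∈ Finset.range (n + 1), (p : ℝ) ^ i) ≠ 0 :=
    (Finset.sum_pos (fun i _ => pow_pos hp i) ⟨0, by simp⟩).ne'
  refine polynomial_eq_of_eval fun u hu => ?_
  rw [eval_mul, eval_C, eval_finsetSum, eval_rhoP, eq_inv_mul_iff_mul_eq₀ h0,
    rhoZ_eq (one_add_mem_Icc hu)]
  simp only [eval_mul, eval_C, eval_alphaP, eval_betaP, mul_assoc]

theorem exists_coeffHasValue (n : ℕ) : ∃ A B R : (RatFunc ℚ)[X],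
    (∀ (p : ℕ) [Fact p.Prime], CoeffHasValue A p (alphaP p n) ∧
      CoeffHasValue B p (betaP p n) ∧ CoeffHasValue R p (rhoP p n)) ∧
    R.map invHom = R ∧ B.map invHom = A := by
  choose a b hv ha hb using exists_coeffHasValue_ser
  have hα : ∀ n (p : ℕ) [Fact p.Prime],
      CoeffHasValue (∑ i ∈ Finset.range (n + 1), a i) p (alphaP p n) := fun n p _ => by
    rw [← sum_coeff_one_sub_X_mul (alphaP p) n]
    exact .sum fun i _ => (hv i p).1
  have hβ : ∀ n (p : ℕ) [Fact p.Prime],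
      CoeffHasValue (∑ i ∈ Finset.range (n + 1), b i) p (betaP p n) := fun n p _ => by
    rw [← sum_coeff_one_sub_X_mul (betaP p) n]
    exact .sum fun i _ => (hv i p).2
  refine ⟨∑ i ∈ Finset.range (n + 1), a i, ∑ i ∈ Finset.range (n + 1), b i,
    C ((∑ i ∈ Finset.range (n + 1), RatFunc.X ^ i)⁻¹) * ∑ r ∈ Finset.range (n + 1),
      C (RatFunc.X ^ r) * ((∑ i ∈ Finset.range (r + 1), a i) *
        ∑ i ∈ Finset.range (n - r + 1), b i), fun p _ => ⟨hα n p, hβ n p, ?_⟩, ?_, ?_⟩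
  · rw [rhoP_eq]
    have hp := prime_pos_real (p := p)
    refine (CoeffHasValue.const ((HasValue.sum fun i _ => (hasValue_X _).pow i).inv
      (Finset.sum_pos (fun i _ => pow_pos hp i) ⟨0, by simp⟩).ne')).mul ?_
    exact .sum fun r _ => (CoeffHasValue.const ((hasValue_X _).pow r)).mul
      ((hα r p).mul (hβ (n - r) p))
  · have hX := RatFunc.X_ne_zero (K := ℚ)
    simp only [Polynomial.map_mul, Polynomial.map_sum, map_C, ha, hb, map_inv₀,
      map_sum invHom, map_pow invHom, invHom_X]
    -- Inversion multiplies `1 + X + ⋯ + Xⁿ` by `X ^ (-n)`. The same power appears in the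
    -- convolution after the exchange `r ↔ n - r`, which also swaps the `α` and `β` factors back.
    have h1 : ∑ i ∈ Finset.range (n + 1), (RatFunc.X : RatFunc ℚ)⁻¹ ^ i =
        (RatFunc.X ^ n)⁻¹ * ∑ i ∈ Finset.range (n + 1), RatFunc.X ^ i := by
      rw [← Finset.sum_range_reflect, Finset.mul_sum]
      refine Finset.sum_congr rfl fun i hi => ?_
      obtain ⟨k, rfl⟩ := Nat.exists_eq_add_of_le (Nat.lt_succ_iff.1 (Finset.mem_range.1 hi))
      rw [show i + k + 1 - 1 - i = k by omega, pow_add, inv_pow]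
      field_simp
    rw [h1, mul_inv, inv_inv, C_mul, mul_right_comm, mul_comm (C (RatFunc.X ^ n) * _)]
    congr 1
    rw [← Finset.sum_range_reflect, Finset.mul_sum]
    refine Finset.sum_congr rfl fun i hi => ?_
    obtain ⟨k, rfl⟩ := Nat.exists_eq_add_of_le (Nat.lt_succ_iff.1 (Finset.mem_range.1 hi))
    rw [show i + k + 1 - 1 - i = k by omega, show i + k - k = i by omega,
      show i + k - i = k by omega, ← mul_assoc (C _), ← C_mul, mul_comm (∑ _ ∈ _, b _)]
    congr 2
    rw [pow_add, inv_pow]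
    field_simp
  · simp only [Polynomial.map_sum, hb]

/-- Treats both halves of (a) at once: `G = X` gives the expectations and `G = X - 1` the
probabilities. Integer coefficients make `G` invariant under `X ↦ 1/X` on scalars. -/
theorem exists_ratFunc_of_comp (G : ℤ[X]) (n d : ℕ) : ∃ Fα Fβ Fρ : RatFunc ℚ,
    (∀ (p : ℕ) [Fact p.Prime],
      HasValue Fα p (((alphaP p n).comp (G.map (Int.castRingHom ℝ))).coeff d) ∧
      HasValue Fβ p (((betaP p n).comp (G.map (Int.castRingHom ℝ))).coeff d) ∧
      HasValue Fρ p (((rhoP p n).comp (G.map (Int.castRingHom ℝ))).coeff d)) ∧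
    Fρ = substInv Fρ ∧ Fα = substInv Fβ := by
  obtain ⟨A, B, R, hv, hR, hB⟩ := exists_coeffHasValue n
  have hG : ∀ x : ℝ, CoeffHasValue (G.map (Int.castRingHom (RatFunc ℚ))) x
      (G.map (Int.castRingHom ℝ)) := fun x d => by
    simpa using hasValue_intCast (G.coeff d) x
  have hσ : (G.map (Int.castRingHom (RatFunc ℚ))).map invHom =
      G.map (Int.castRingHom (RatFunc ℚ)) := by
    rw [Polynomial.map_map]
    congr 1
    exact RingHom.ext_int _ _
  refine ⟨(A.comp (G.map (Int.castRingHom _))).coeff d, (B.comp (G.map (Int.castRingHom _))).coeff d,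
    (R.comp (G.map (Int.castRingHom _))).coeff d, fun p _ => ?_, ?_, ?_⟩
  · obtain ⟨h1, h2, h3⟩ := hv p
    exact ⟨h1.comp (hG _) d, h2.comp (hG _) d, h3.comp (hG _) d⟩
  · rw [← invHom_apply, ← coeff_map, map_comp, hσ, hR]
  · rw [← invHom_apply, ← coeff_map, map_comp, hσ, hB]

end Solve

end PadicRoots

end

/-! ### The main theorem -/

theorem theorem1 :
    -- the expectations exist, and the numbers of roots are random variables
    (∀ (p : ℕ) [Fact p.Prime] (n : ℕ),
      (AEMeasurable (fun a => PadicRoots.numRoots p (PadicRoots.genPoly p n a))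
          (PadicRoots.haarZpPow p (n + 1)) ∧
        AEMeasurable (fun a => PadicRoots.numRoots p (PadicRoots.monicPoly p n a))
          (PadicRoots.haarZpPow p n) ∧
        AEMeasurable (fun a => PadicRoots.numRoots p (PadicRoots.monicPoly p n a))
          (PadicRoots.reducedMeasure p n)) ∧
      ∀ d : ℕ,
        Integrable (fun a => (PadicRoots.numRootSets p d (PadicRoots.genPoly p n a) : ℝ))
          (PadicRoots.haarZpPow p (n + 1)) ∧
        Integrable (fun a => (PadicRoots.numRootSets p d (PadicRoots.monicPoly p n a) : ℝ))
          (PadicRoots.haarZpPow p n) ∧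
        Integrable (fun a => (PadicRoots.numRootSets p d (PadicRoots.monicPoly p n a) : ℝ))
          (PadicRoots.reducedMeasure p n)) ∧
    -- (a), for the expectations
    (∀ n d : ℕ, ∃ Fα Fβ Fρ : RatFunc ℚ,
      (∀ (p : ℕ) [Fact p.Prime],
        PadicRoots.HasValue Fα p (PadicRoots.alpha p n d) ∧
        PadicRoots.HasValue Fβ p (PadicRoots.beta p n d) ∧
        PadicRoots.HasValue Fρ p (PadicRoots.rho p n d)) ∧
      Fρ = PadicRoots.substInv Fρ ∧
      Fα = PadicRoots.substInv Fβ) ∧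
    -- (a), for the probabilities
    (∀ n r : ℕ, ∃ Fα Fβ Fρ : RatFunc ℚ,
      (∀ (p : ℕ) [Fact p.Prime],
        PadicRoots.HasValue Fα p (PadicRoots.alphaStar p n r) ∧
        PadicRoots.HasValue Fβ p (PadicRoots.betaStar p n r) ∧
        PadicRoots.HasValue Fρ p (PadicRoots.rhoStar p n r)) ∧
      Fρ = PadicRoots.substInv Fρ ∧
      Fα = PadicRoots.substInv Fβ) ∧
    -- (b), as identities in `ℝ⟦t⟧⟦u⟧` and in `ℝ⟦t⟧`
    (∀ (p : ℕ) [Fact p.Prime],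
      ((PowerSeries.mk fun d => PowerSeries.rescale (p : ℝ) (PadicRoots.serA p d) :
          PowerSeries (PowerSeries ℝ)) =
        (PowerSeries.mk fun d => PadicRoots.serB p d) ^ p) ∧
      ((PowerSeries.mk fun d => PadicRoots.serR p d : PowerSeries (PowerSeries ℝ)) =
        (PowerSeries.mk fun d => PowerSeries.rescale (p : ℝ) (PadicRoots.serA p d)) *
          (PowerSeries.mk fun d => PadicRoots.serB p d)) ∧
      ((PowerSeries.mk fun d => PadicRoots.serR p d : PowerSeries (PowerSeries ℝ)) =
        (PowerSeries.mk fun d => PadicRoots.serB p d) ^ (p + 1)) ∧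
      ∀ d : ℕ,
        PadicRoots.serB p d -
            PowerSeries.X * PowerSeries.rescale (1 / (p : ℝ)) (PadicRoots.serB p d) =
          PadicRoots.Phi p (PadicRoots.serA p d -
            PowerSeries.X * PowerSeries.rescale (p : ℝ) (PadicRoots.serA p d))) ∧
    -- (c)
    (∀ (p : ℕ) [Fact p.Prime] (d : ℕ), ∃ A B R : Polynomial ℝ,
      (A.natDegree ≤ 2 * d ∧ B.natDegree ≤ 2 * d ∧ R.natDegree ≤ 2 * d) ∧
      (PadicRoots.serA p d = A ∧ PadicRoots.serB p d = B ∧ PadicRoots.serR p d = R) ∧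
      (∀ n : ℕ, 2 * d ≤ n →
        PadicRoots.alpha p n d = A.eval 1 ∧ PadicRoots.beta p n d = B.eval 1) ∧
      (∀ n : ℕ, 2 * d ≤ n + 1 → PadicRoots.rho p n d = R.eval 1)) := by
  refine ⟨fun p _ n => ⟨⟨(PadicRoots.measurable_numRoots_genPoly n).aemeasurable,
    (PadicRoots.measurable_numRoots_monicPoly n).aemeasurable,
    (PadicRoots.measurable_numRoots_monicPoly n).aemeasurable⟩, fun d =>
    ⟨PadicRoots.integrable_numRootSets_of_le p (PadicRoots.measurable_numRoots_genPoly n)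
      (PadicRoots.numRoots_genPoly_le p n) d,
    PadicRoots.integrable_numRootSets_of_le p (PadicRoots.measurable_numRoots_monicPoly n)
      (PadicRoots.numRoots_monicPoly_le p n) d,
    PadicRoots.integrable_numRootSets_of_le p (PadicRoots.measurable_numRoots_monicPoly n)
      (PadicRoots.numRoots_monicPoly_le p n) d⟩⟩, fun n d => ?_, fun n r => ?_, fun p _ =>
    ⟨PadicRoots.mk_rescale_serA p, PadicRoots.mk_serR p, PadicRoots.mk_serR_eq_pow p,
      PadicRoots.serB_sub_eq p⟩, fun p _ d =>
    ⟨PadicRoots.polyA p d, PadicRoots.polyB p d, PadicRoots.polyR p d,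
      ⟨PadicRoots.natDegree_trunc_succ_le _ _, PadicRoots.natDegree_trunc_succ_le _ _,
        PadicRoots.natDegree_trunc_succ_le _ _⟩,
      ⟨(PadicRoots.coe_polyA p d).symm, (PadicRoots.coe_polyB p d).symm,
        (PadicRoots.coe_polyR p d).symm⟩,
      fun n hn => ⟨PadicRoots.alpha_eq_eval p hn, PadicRoots.beta_eq_eval p hn⟩,
      fun n hn => PadicRoots.rho_eq_eval p hn⟩⟩
  · simpa [PadicRoots.coeff_alphaP, PadicRoots.coeff_betaP, PadicRoots.coeff_rhoP] using
      PadicRoots.exists_ratFunc_of_comp Polynomial.X n d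
  · have hX : (Polynomial.X - 1 : Polynomial ℤ).map (Int.castRingHom ℝ) = Polynomial.X - 1 := by
      rw [Polynomial.map_sub, Polynomial.map_X, Polynomial.map_one]
    have h := PadicRoots.exists_ratFunc_of_comp (Polynomial.X - 1) n r
    simp only [hX, ← PadicRoots.alphaStarP_eq, ← PadicRoots.betaStarP_eq,
      ← PadicRoots.rhoStarP_eq, PadicRoots.coeff_alphaStarP, PadicRoots.coeff_betaStarP,
      PadicRoots.coeff_rhoStarP] at h
    exact h
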